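/- All graphs are finite and simple. A set $S$ of edges of a graph $G$ is a *cyclic edge cut* if two different components of $G-S$ contain cycles; the *cyclic edge-connectivity* of $G$ is the least size of a cyclic edge cut. A *snark* is a cubic graph with cyclic edge-connectivity at least $4$, edge-chromatic number $4$ and girth at least $5$. A *$2$-factor* is a $2$-regular spanning subgraph; it is *odd* if all its cycles have odd length, and a graph is *odd $2$-factored* if all its $2$-factors are odd. An edge $xy$ of a snark $L$ is a *bold-edge* if (i) all $2$-factors of $L-x$ and of $L-y$ are odd, (ii) all $2$-factors of $L$ containing $xy$ are odd, and (iii) all $2$-factors of $L$ avoiding $xy$ are odd. Two independent edges $ab$, $cd$ of a snark $R$ form a *gadget-pair* if (i) no $2$-factor of $R$ avoids both; (ii) all $2$-factors of $R$ containing exactly one of them are odd; (iii) all $2$-factors of $R$ containing both are odd and contain $ab$ and $cd$ in different cycles; (iv) in every $2$-factor of $(R-\{ab,cd\})\cup\{ac,ad,bc,bd\}$ that contains exactly one edge of $\{ac,ad,bc,bd\}$, the cycle through that edge is even and all other cycles are odd. A *bold-gadget dot product* of snarks $L$ and $R$ is obtained by choosing a bold-edge $xy$ of $L$, with $N(x)\setminus\{y\}=\{r,s\}$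 and $N(y)\setminus\{x\}=\{t,u\}$, and a gadget-pair $ab$, $cd$ of $R$ (with any naming of these vertices), and forming from the disjoint union of $L-\{x,y\}$ and $R-\{ab,cd\}$ a new graph by adding the edges $ra$, $sb$, $tc$, $ud$. For odd $t\ge 5$ the *Flower snark* $J(t)$ has vertices $h_i,u_i,v_i,w_i$ ($1\le i\le t$) and edges $h_iu_i$, $h_iv_i$, $h_iw_i$ ($1\le i\le t$), $u_ju_{j+1}$, $v_jv_{j+1}$, $w_jw_{j+1}$ ($1\le j\le t-1$), and $u_tv_1$, $v_tu_1$, $w_tw_1$. Let $P_{18}$, $P_{26}$, $P_{34}$ be the following graphs on $\{1,\dots,n\}$ with $n=18,26,34$; they are, respectively, a bold-gadget dot product $L\cdot R$ with $R$ the Petersen graph and $L$ the Petersen graph, $P_{18}$, $P_{26}$. For an integer $k$ let $B_k$ denote the graph on $k+1,\dots,k+10$ with edges (writing $i$ for $k+i$) $\{1,2\},\{1,6\},\{2,3\},\{2,4\},\{3,10\},\{4,5\},\{4,8\},\{5,6\},\{5,10\},\{6,7\},\{7,8\},\{8,9\},\{9,10\}$. * $P_{18}$: the edges of $B_8$, the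 edges $\{1,2\},\{1,4\},\{2,3\},\{2,6\},\{3,8\},\{4,5\},\{4,8\},\{5,6\},\{6,7\},\{7,8\}$, and $\{1,9\},\{3,11\},\{5,15\},\{7,17\}$. * $P_{26}$: the edges of $B_6$ and $B_{16}$, the edges $\{1,2\},\{2,3\},\{2,5\},\{4,5\},\{5,6\}$, and $\{1,7\},\{3,13\},\{4,9\},\{6,15\},\{1,19\},\{3,17\},\{4,23\},\{6,25\}$. * $P_{34}$: the edges of $B_4$ and $B_{14}$, the edges $\{25,26\},\{25,34\},\{26,27\},\{26,28\},\{27,30\},\{28,29\},\{28,32\},\{29,30\},\{29,34\},\{30,31\},\{31,32\},\{32,33\},\{33,34\}$, and $\{1,5\},\{2,7\},\{3,13\},\{4,11\},\{1,17\},\{2,21\},\{3,23\},\{4,15\},\{1,25\},\{2,33\},\{3,27\},\{4,31\}$. **Theorem.** Let $G$ be an odd $2$-factored snark of cyclic edge-connectivity four that can be obtained from the Petersen graph and the Flower snarks $J(t)$ ($t\ge5$ odd) by iterating the bold-gadget dot product. Then $G$ is isomorphic to $P_{18}$, $P_{26}$ or $P_{34}$. -/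

import Mathlib

namespace BoldGadget

universe u

/-! ### Cyclic edge-connectivity and snarks -/

/-- Every vertex has exactly three neighbours. -/
def IsCubic {V : Type u} (G : SimpleGraph V) : Prop :=
  ∀ v, (G.neighborSet v).ncard = 3

/-- A set `S` of edges of `G` is a cycle-separating edge cut: after deleting `S`, there are two
cycles that lie in different connected components. -/
def IsCyclicEdgeCut {V : Type u} (G : SimpleGraph V) (S : Set (Sym2 V)) : Prop :=
  S ⊆ G.edgeSet ∧
    ∃ (u v : V) (p : (G.deleteEdges S).Walk u u) (q : (G.deleteEdges S).Walk v v),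
      p.IsCycle ∧ q.IsCycle ∧ ¬ (G.deleteEdges S).Reachable u v

/-- The cyclic edge-connectivity: the least size of a cycle-separating edge cut
(`⊤` if there is none). -/
noncomputable def cyclicEdgeConnectivity {V : Type u} (G : SimpleGraph V) : ℕ∞ :=
  ⨅ (S : Set (Sym2 V)) (_ : IsCyclicEdgeCut G S), S.encard

/-- A snark: a cyclically 4-edge-connected cubic graph with edge-chromatic number four and girth
at least five. (The edge-chromatic number is the chromatic number of the line graph.) -/
structure IsSnark {V : Type u} (G : SimpleGraph V) : Prop where
  cubic : IsCubic G
  cyclically_four_edge_connected : 4 ≤ cyclicEdgeConnectivity G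
  chromatic_index : G.lineGraph.chromaticNumber = 4
  girth : 5 ≤ G.egirth

/-! ### 2-factors -/

/-- `F` is (the edge set of) a 2-factor of `G`: a 2-regular spanning subgraph. -/
def IsTwoFactor {V : Type u} (G F : SimpleGraph V) : Prop :=
  F ≤ G ∧ ∀ v, (F.neighborSet v).ncard = 2

/-- All cycles of `F` have odd length. -/
def AllCyclesOdd {V : Type u} (F : SimpleGraph V) : Prop :=
  ∀ (v : V) (p : F.Walk v v), p.IsCycle → Odd p.length

/-- `G` is odd 2-factored: in every 2-factor of `G` every cycle is odd. -/
def IsOddTwoFactored {V : Type u} (G : SimpleGraph V) : Prop :=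
  ∀ F, IsTwoFactor G F → AllCyclesOdd F

/-! ### Bold-edges, gadget-pairs and the dot product -/

/-- The edge `xy` of `L` is a bold-edge. `L.induce {x}ᶜ` is the graph `L - x`. -/
structure IsBoldEdge {V : Type u} (L : SimpleGraph V) (x y : V) : Prop where
  adj : L.Adj x y
  odd_delete_left : IsOddTwoFactored (L.induce {x}ᶜ)
  odd_delete_right : IsOddTwoFactored (L.induce {y}ᶜ)
  odd_containing : ∀ F, IsTwoFactor L F → F.Adj x y → AllCyclesOdd F
  odd_avoiding : ∀ F, IsTwoFactor L F → ¬ F.Adj x y → AllCyclesOdd F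

/-- The four possible edges between `{a, b}` and `{c, d}`. -/
def crossEdges {V : Type u} (a b c d : V) : Set (Sym2 V) :=
  {s(a, c), s(a, d), s(b, c), s(b, d)}

/-- The graph `(R - {ab, cd}) ∪ {ac, ad, bc, bd}`. -/
def switchGraph {V : Type u} (R : SimpleGraph V) (a b c d : V) : SimpleGraph V :=
  R.deleteEdges {s(a, b), s(c, d)} ⊔ SimpleGraph.fromEdgeSet (crossEdges a b c d)

/-- The independent edges `ab` and `cd` of `R` form a gadget-pair. -/
structure IsGadgetPair {V : Type u} (R : SimpleGraph V) (a b c d : V) : Prop where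
  adj_left : R.Adj a b
  adj_right : R.Adj c d
  independent : a ≠ c ∧ a ≠ d ∧ b ≠ c ∧ b ≠ d
  /-- No 2-factor avoids both edges. -/
  not_avoiding : ∀ F, IsTwoFactor R F → F.Adj a b ∨ F.Adj c d
  /-- 2-factors containing exactly one of the two edges are odd. -/
  odd_one : ∀ F, IsTwoFactor R F → Xor (F.Adj a b) (F.Adj c d) → AllCyclesOdd F
  /-- 2-factors containing both edges are odd, -/
  odd_both : ∀ F, IsTwoFactor R F → F.Adj a b → F.Adj c d → AllCyclesOdd F
  /-- and the two edges lie in different cycles of such a 2-factor. -/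
  different_cycles : ∀ F, IsTwoFactor R F → F.Adj a b → F.Adj c d →
    ∀ (v : V) (p : F.Walk v v), p.IsCycle → ¬ (s(a, b) ∈ p.edges ∧ s(c, d) ∈ p.edges)
  /-- If a 2-factor of `(R - {ab, cd}) ∪ {ac, ad, bc, bd}` contains exactly one edge `e` of
  `{ac, ad, bc, bd}`, then its cycle through `e` is even and all its other cycles are odd. -/
  switch : ∀ F, IsTwoFactor (switchGraph R a b c d) F →
    ∀ e, F.edgeSet ∩ crossEdges a b c d = {e} →
      ∀ (v : V) (p : F.Walk v v), p.IsCycle →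
        (e ∈ p.edges → Even p.length) ∧ (e ∉ p.edges → Odd p.length)

/-- The dot product: delete the vertices `x`, `y` from `L` and the edges `ab`, `cd` from `R`, and
add the edges `ra`, `sb`, `tc`, `ud`. Here `{r, s}` and `{t, u}` are meant to be the remaining
neighbours of `x` and of `y`; every way to join `{r, s}` to one of the removed edges and `{t, u}`
to the other arises from some naming of the vertices. -/
def snarkDotProduct {V W : Type u} (L : SimpleGraph V) (x y r s t u : V)
    (R : SimpleGraph W) (a b c d : W) : SimpleGraph ({v : V // v ≠ x ∧ v ≠ y} ⊕ W) :=
  SimpleGraph.fromRel fun p q =>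
    match p, q with
    | .inl v, .inl v' => L.Adj v v'
    | .inr w, .inr w' => R.Adj w w' ∧ s(w, w') ≠ s(a, b) ∧ s(w, w') ≠ s(c, d)
    | .inl v, .inr w =>
        (v.1 = r ∧ w = a) ∨ (v.1 = s ∧ w = b) ∨ (v.1 = t ∧ w = c) ∨ (v.1 = u ∧ w = d)
    | .inr _, .inl _ => False

/-! ### The Petersen graph and the flower snarks -/

/-- The graph with vertices labelled `1, …, n` (the label of `i : Fin n` is `i + 1`) and the
listed edges. -/
def graphOfEdges (n : ℕ) (l : List (ℕ × ℕ)) : SimpleGraph (Fin n) :=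
  SimpleGraph.fromRel fun i j => (i.val + 1, j.val + 1) ∈ l

/-- The Petersen graph: pentagon `1 2 3 4 5`, pentagram `6 8 10 7 9`, and five spokes. -/
def petersen : SimpleGraph (Fin 10) :=
  graphOfEdges 10
   [(1, 2), (1, 5), (1, 6), (2, 3), (2, 7), (3, 4), (3, 8), (4, 5), (4, 9), (5, 10),
    (6, 8), (6, 9), (7, 9), (7, 10), (8, 10)]

/-- Vertices `hᵢ, uᵢ, vᵢ, wᵢ` of the flower snark; indices run through `0, …, t - 1`. -/
inductive FlowerVertex (t : ℕ) : Type
  | h (i : Fin t)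
  | u (i : Fin t)
  | v (i : Fin t)
  | w (i : Fin t)

/-- The flower snark `J(t)` (for odd `t ≥ 5`): hubs `hᵢ` joined to `uᵢ, vᵢ, wᵢ`; paths
`u₁ … u_t`, `v₁ … v_t`, `w₁ … w_t`; and the edges `u_t v₁`, `v_t u₁`, `w_t w₁`. -/
def flower (t : ℕ) : SimpleGraph (FlowerVertex t) :=
  SimpleGraph.fromRel fun p q =>
    match p, q with
    | .h i, .u j => i = j
    | .h i, .v j => i = j
    | .h i, .w j => i = j
    | .u i, .u j => i.val + 1 = j.val
    | .v i, .v j => i.val + 1 = j.val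
    | .w i, .w j => i.val + 1 = j.val ∨ (i.val + 1 = t ∧ j.val = 0)
    | .u i, .v j => i.val + 1 = t ∧ j.val = 0
    | .v i, .u j => i.val + 1 = t ∧ j.val = 0
    | _, _ => False

/-! ### Graphs obtained by iterating the construction -/

/-- The graphs that can be constructed (up to isomorphism) from the Petersen graph and the flower
snarks `J(t)`, `t ≥ 5` odd, by iterating the bold-gadget dot product, i.e. the dot product `L · R`
of snarks `L` and `R` formed at a bold-edge `xy` of `L` and a gadget-pair `ab, cd` of `R`. -/
inductive BoldGadgetConstructible : ∀ {V : Type u}, SimpleGraph V → Prop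
  | petersen {V : Type u} (G : SimpleGraph V) (e : G ≃g petersen) : BoldGadgetConstructible G
  | flower {V : Type u} (G : SimpleGraph V) (t : ℕ) (ht : 5 ≤ t) (hodd : Odd t)
      (e : G ≃g flower t) : BoldGadgetConstructible G
  | dot {V W X : Type u} (L : SimpleGraph V) (R : SimpleGraph W) (G : SimpleGraph X)
      (x y r s t u : V) (a b c d : W)
      (hL : BoldGadgetConstructible L) (hR : BoldGadgetConstructible R)
      (snarkL : IsSnark L) (snarkR : IsSnark R)
      (bold : IsBoldEdge L x y) (gadget : IsGadgetPair R a b c d)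
      (hx : L.neighborSet x \ {y} = {r, s}) (hy : L.neighborSet y \ {x} = {t, u})
      (e : G ≃g snarkDotProduct L x y r s t u R a b c d) : BoldGadgetConstructible G

/-! ### The snarks of order 18, 26 and 34 -/

/-- The snark `P₁₈` (the second Blanuša snark): the dot product of two Petersen graphs at a
bold-edge and a gadget-pair. -/
def P18 : SimpleGraph (Fin 18) :=
  graphOfEdges 18
   [(1, 2), (1, 4), (1, 9), (2, 3), (2, 6), (3, 8), (3, 11), (4, 5), (4, 8), (5, 6),
    (5, 15), (6, 7), (7, 8), (7, 17), (9, 10), (9, 14), (10, 11), (10, 12), (11, 18),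
    (12, 13), (12, 16), (13, 14), (13, 18), (14, 15), (15, 16), (16, 17), (17, 18)]

/-- The snark `P₂₆`: the dot product of `P₁₈` and the Petersen graph at a bold-edge and a
gadget-pair. -/
def P26 : SimpleGraph (Fin 26) :=
  graphOfEdges 26
   [(1, 2), (1, 7), (1, 19), (2, 3), (2, 5), (3, 13), (3, 17), (4, 5), (4, 9), (4, 23),
    (5, 6), (6, 15), (6, 25), (7, 8), (7, 12), (8, 9), (8, 10), (9, 16), (10, 11),
    (10, 14), (11, 12), (11, 16), (12, 13), (13, 14), (14, 15), (15, 16), (17, 18),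
    (17, 22), (18, 19), (18, 20), (19, 26), (20, 21), (20, 24), (21, 22), (21, 26),
    (22, 23), (23, 24), (24, 25), (25, 26)]

/-- The snark `P₃₄`: the dot product of `P₂₆` and the Petersen graph at a bold-edge and a
gadget-pair. -/
def P34 : SimpleGraph (Fin 34) :=
  graphOfEdges 34
   [(1, 5), (1, 17), (1, 25), (2, 7), (2, 21), (2, 33), (3, 13), (3, 23), (3, 27), (4, 11),
    (4, 15), (4, 31), (5, 6), (5, 10), (6, 7), (6, 8), (7, 14), (8, 9), (8, 12), (9, 10),
    (9, 14), (10, 11), (11, 12), (12, 13), (13, 14), (15, 16), (15, 20), (16, 17),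
    (16, 18), (17, 24), (18, 19), (18, 22), (19, 20), (19, 24), (20, 21), (21, 22),
    (22, 23), (23, 24), (25, 26), (25, 34), (26, 27), (26, 28), (27, 30), (28, 29),
    (28, 32), (29, 30), (29, 34), (30, 31), (31, 32), (32, 33), (33, 34)]

end BoldGadget

namespace BoldGadget

open SimpleGraph

/-! ### Cycles from lists and walks along isomorphisms -/

/-! The construction stops almost at once, because both of its ingredients are scarce. By induction
(`BoldGadgetConstructible.classification`) a constructible graph is the Petersen graph, a flower
snark, `P18`, `P26` or `P34`. In a step `L · R` only necessary conditions for a gadget-pair of `R`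
and a bold-edge of `L` are used, and each is refuted by an explicit 2-factor, encoded by the edges
it omits.

Right factor. In a cubic graph the complement of a perfect matching is a 2-factor, so no perfect
matching contains both edges of a gadget-pair. This disposes of most independent pairs of edges in a
flower snark, `P18`, `P26` or `P34`. For each remaining pair there is a 2-factor of the switched
graph whose cycle through its only new edge is odd. Hence none of these graphs has a gadget-pair
(`noGadgetPair_ring`, `noGadgetPair_P18`, `noGadgetPair_P26`, `noGadgetPair_P34`), and `R` is the
Petersen graph. There the independent pairs in no common perfect matching form one orbit of the
automorphism group, even with the naming of the ends taken into account (`isPetersenAut_pairFrame`).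

Left factor. If deleting a vertex leaves a graph with a 2-factor containing an even cycle, no
bold-edge ends at that vertex. In a flower snark every leaf is such a vertex and hubs are pairwise
nonadjacent, so there is no bold-edge. The same test rules out every edge of `P34`, all but one edge
of `P26` and all but two of `P18`; in the Petersen graph all edges are equivalent. Each surviving
choice gives one dot product up to isomorphism: the Petersen graph leads to `P18`, then `P26`, then
`P34`, and there the process ends.

Finally, the Petersen graph and the flower snarks have cyclic edge-connectivity at least five
(`fiveLeCuts_petersen`, `fiveLeCuts_ring`), so connectivity four leaves only the three graphs. -/

theorem exists_isCycle_of_isChain {V : Type*} {F : SimpleGraph V} {l : List V} {u w : V}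
    (hu : l.head? = some u) (hw : l.getLast? = some w) (hchain : l.IsChain F.Adj)
    (hnodup : l.Nodup) (hlen : 3 ≤ l.length) (hadj : F.Adj w u) :
    ∃ p : F.Walk w w, p.IsCycle ∧ p.length = l.length ∧ s(w, u) ∈ p.edges := by
  have hne : l ≠ [] := by rintro rfl; simp at hu
  obtain rfl : l.head hne = u := by
    rw [List.head?_eq_some_head hne] at hu; exact Option.some.inj hu
  obtain rfl : l.getLast hne = w := by
    rw [List.getLast?_eq_some_getLast hne] at hw; exact Option.some.inj hw
  have hp : (Walk.ofSupport l hne hchain).IsPath := by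
    rw [Walk.isPath_def, Walk.support_ofSupport]; exact hnodup
  have hl : (Walk.ofSupport l hne hchain).length = l.length - 1 := Walk.length_ofSupport ..
  refine ⟨Walk.cons hadj (Walk.ofSupport l hne hchain), ?_, ?_, ?_⟩
  · rw [Walk.cons_isCycle_iff]
    refine ⟨hp, fun h => ?_⟩
    rw [Sym2.eq_swap] at h
    have := hp.length_eq_one_of_mem_edges h
    omega
  · rw [Walk.length_cons]; omega
  · simp

/-! ### Removing a matching from a cubic graph -/

/-- `G` without the edges `v (m v)`. -/
def unmatched {V : Type*} (G : SimpleGraph V) (m : V → V) : SimpleGraph V where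
  Adj v w := G.Adj v w ∧ m v ≠ w ∧ m w ≠ v
  symm := ⟨fun _ _ h => ⟨h.1.symm, h.2.2, h.2.1⟩⟩
  loopless := ⟨fun _ h => h.1.ne rfl⟩

theorem IsCubic.ncard_diff {V : Type*} {G : SimpleGraph V} (hG : IsCubic G) {v w : V}
    (h : G.Adj v w) : (G.neighborSet v \ {w}).ncard = 2 := by
  have hf : (G.neighborSet v).Finite := Set.finite_of_ncard_ne_zero (by rw [hG v]; decide)
  rw [Set.ncard_sdiff_singleton_of_mem (show w ∈ G.neighborSet v from h), hG v]

/-- There is a perfect matching of `G` containing the edges `ab` and `cd`. -/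
def HasMatchingThrough {V : Type*} (G : SimpleGraph V) (a b c d : V) : Prop :=
  ∃ m : V → V, (∀ v, G.Adj v (m v)) ∧ (∀ v, m (m v) = v) ∧ m a = b ∧ m c = d

/-- Removing a perfect matching from a cubic graph leaves a 2-factor; if the matching contained `ab`
and `cd`, this 2-factor would avoid both. -/
theorem IsGadgetPair.not_hasMatchingThrough {V : Type*} {G : SimpleGraph V} (hG : IsCubic G)
    {a b c d : V} (h : IsGadgetPair G a b c d) : ¬ HasMatchingThrough G a b c d := by
  rintro ⟨m, hadj, hinv, rfl, rfl⟩
  have hF : IsTwoFactor G (unmatched G m) := by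
    refine ⟨fun _ _ h => h.1, fun v => ?_⟩
    rw [← hG.ncard_diff (hadj v)]
    congr 1
    ext w
    simp only [unmatched, mem_neighborSet, Set.mem_sdiff, Set.mem_singleton_iff]
    refine ⟨fun h => ⟨h.1, fun e => h.2.1 e.symm⟩, fun h => ⟨h.1, fun e => h.2 e.symm, ?_⟩⟩
    rintro rfl
    exact h.2 (hinv w).symm
  rcases h.not_avoiding _ hF with h | h
  · exact h.2.1 rfl
  · exact h.2.1 rfl

/-- `G - x` has a 2-factor with an even cycle. The 2-factor consists of the edges outside the
matching `m` of `G - x - N(x)`, and the vertices of the cycle are those of the list. -/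
def HasEvenDeletion {V : Type*} (G : SimpleGraph V) (x : V) : Prop :=
  ∃ (m : V → V) (l : List V) (u w : V),
    (∀ v, v ≠ x → G.Adj v (m v)) ∧ (∀ v, v ≠ x → m v ≠ x → m (m v) = v) ∧
    (∀ v, G.Adj v x → m v = x) ∧ l.head? = some u ∧ l.getLast? = some w ∧
    (unmatched G m).Adj w u ∧ l.IsChain (unmatched G m).Adj ∧ l.Nodup ∧ 3 ≤ l.length ∧
    Even l.length ∧ x ∉ l

/-- In `G - x` each neighbour of `x` has already lost one edge, and `m` takes exactly one edge from
every other vertex. What remains is 2-regular, and the listed cycle in it is even. -/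
theorem HasEvenDeletion.not_isOddTwoFactored {V : Type*} {G : SimpleGraph V} (hG : IsCubic G)
    {x : V} (h : HasEvenDeletion G x) : ¬ IsOddTwoFactored (G.induce {x}ᶜ) := by
  obtain ⟨m, l, u, w, hadj, hinv, hx, hu, hw, hwu, hchain, hnodup, hlen, heven, hxl⟩ := h
  intro hodd
  let f : ({x}ᶜ : Set V) → V := Subtype.val
  have hf : Function.Injective f := Subtype.val_injective
  have hF : IsTwoFactor (G.induce {x}ᶜ) ((unmatched G m).comap f) := by
    refine ⟨fun _ _ h => h.1, fun v => ?_⟩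
    have hv : v.1 ≠ x := v.2
    rw [← hG.ncard_diff (hadj v.1 hv), ← Set.ncard_image_of_injective _ hf]
    congr 1
    ext w
    simp only [unmatched, mem_neighborSet, Set.mem_sdiff, Set.mem_singleton_iff, Set.mem_image,
      comap_adj]
    constructor
    · rintro ⟨w, h, rfl⟩
      exact ⟨h.1, fun e => h.2.1 e.symm⟩
    · rintro ⟨h, hne⟩
      have hwx : w ≠ x := by
        rintro rfl
        exact hne (hx _ h).symm
      refine ⟨⟨w, hwx⟩, ⟨h, fun e => hne e.symm, fun e => hne ?_⟩, rfl⟩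
      have e' : m w = v.1 := e
      rw [← e', hinv w hwx (by rw [e']; exact hv)]
  -- As `x` is not on the cycle, the list lifts to the vertex type of `G - x`.
  obtain ⟨l', rfl⟩ : ∃ l' : List ({x}ᶜ : Set V), l'.map f = l := by
    refine ⟨l.attachWith _ fun v hv => ?_, ?_⟩
    · rintro rfl; exact hxl hv
    · simp [f]
  rw [List.isChain_map] at hchain
  rw [List.head?_map, Option.map_eq_some_iff] at hu
  rw [List.getLast?_map, Option.map_eq_some_iff] at hw
  obtain ⟨u, hu, rfl⟩ := hu
  obtain ⟨w, hw, rfl⟩ := hw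
  rw [List.length_map] at hlen heven
  obtain ⟨p, hp, hpl, -⟩ := exists_isCycle_of_isChain (F := (unmatched G m).comap f)
    hu hw hchain (hnodup.of_map) hlen hwu
  have := hodd _ hF w p hp
  rw [hpl] at this
  exact Nat.not_even_iff_odd.mpr this heven

/-- The graph `(G - {ab, cd}) ∪ {ac, ad, bc, bd}` has a 2-factor in which exactly one of the new
edges is contained, namely `ac`, and lies in an odd cycle. -/
def HasOddSwitch {V : Type*} (G : SimpleGraph V) (a b c d : V) : Prop :=
  (¬ G.Adj a c ∧ ¬ G.Adj a d ∧ ¬ G.Adj b c ∧ ¬ G.Adj b d) ∧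
  ∃ (m : V → V) (l : List V),
    (∀ v, G.Adj v (m v)) ∧ (∀ v, v ≠ b → v ≠ d → m (m v) = v) ∧
    m b = a ∧ m d = c ∧ m a ≠ b ∧ m c ≠ d ∧ l.head? = some a ∧ l.getLast? = some c ∧
    l.IsChain (unmatched G m).Adj ∧ l.Nodup ∧ 3 ≤ l.length ∧ Odd l.length

/-- The omitted edges cover every vertex once, except that `a` is covered by both `a (m a)` and
`ab`, and `c` by both `c (m c)` and `cd`. Adding `ac` restores degree two at `a` and `c`. The chain
from `a` to `c`, closed by `ac`, is then an odd cycle through the only new edge. -/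
theorem IsGadgetPair.not_hasOddSwitch {V : Type*} {G : SimpleGraph V} (hG : IsCubic G)
    {a b c d : V} (h : IsGadgetPair G a b c d) : ¬ HasOddSwitch G a b c d := by
  rintro ⟨⟨hac, had, hbc, hbd⟩, m, l, hadj, hinv, hmb, hmd, hma, hmc, hla, hlc, hchain, hnodup,
    hlen, hodd⟩
  obtain ⟨nac, nad, nbc, nbd⟩ := h.independent
  have hab := h.adj_left.ne
  have hcd := h.adj_right.ne
  set F : SimpleGraph V := unmatched G m ⊔ edge a c with hFdef
  have hFadj : ∀ v w, F.Adj v w ↔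
      (G.Adj v w ∧ m v ≠ w ∧ m w ≠ v) ∨ (v = a ∧ w = c) ∨ (v = c ∧ w = a) := by
    intro v w
    rw [hFdef, sup_adj, edge_adj]
    constructor
    · rintro (h | ⟨h | h, -⟩)
      · exact .inl h
      · exact .inr (.inl ⟨h.1, h.2⟩)
      · exact .inr (.inr ⟨h.1, h.2⟩)
    · rintro (h | h | h)
      · exact .inl h
      · exact .inr ⟨.inl h, by rw [h.1, h.2]; exact nac⟩
      · exact .inr ⟨.inr h, by rw [h.1, h.2]; exact nac.symm⟩
  have hF : IsTwoFactor (switchGraph G a b c d) F := by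
    constructor
    · intro v w h
      simp only [switchGraph, sup_adj, deleteEdges_adj, fromEdgeSet_adj, crossEdges,
        Set.mem_insert_iff, Set.mem_singleton_iff, Sym2.eq_iff]
      rcases (hFadj v w).1 h with h | ⟨rfl, rfl⟩ | ⟨rfl, rfl⟩
      · refine .inl ⟨h.1, ?_⟩
        rintro ((⟨rfl, rfl⟩ | ⟨rfl, rfl⟩) | (⟨rfl, rfl⟩ | ⟨rfl, rfl⟩)) <;> simp_all
      · exact .inr ⟨by simp, nac⟩
      · exact .inr ⟨by simp, nac.symm⟩
    · intro v
      -- The degree count common to `a` and `c`: three neighbours, less the partner and the other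
      -- end of the deleted edge, plus the new neighbour.
      have key : ∀ a b c : V, G.Adj a b → a ≠ c → m b = a → m a ≠ b → ¬ G.Adj a c →
          (∀ w, w ≠ b → m w = a → m a = w) →
          (∀ w, F.Adj a w ↔ (G.Adj a w ∧ m a ≠ w ∧ m w ≠ a) ∨ w = c) →
          (F.neighborSet a).ncard = 2 := by
        intro a b c hab hne hmb hma hac hinv hFa
        have e : F.neighborSet a = insert c ((G.neighborSet a \ {m a}) \ {b}) := by
          ext w
          simp only [mem_neighborSet, hFa, Set.mem_insert_iff, Set.mem_sdiff,
            Set.mem_singleton_iff]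
          constructor
          · rintro (⟨h1, h2, h3⟩ | h)
            · exact .inr ⟨⟨h1, fun e => h2 e.symm⟩, by rintro rfl; exact h3 hmb⟩
            · exact .inl h
          · rintro (h | ⟨⟨h1, h2⟩, h3⟩)
            · exact .inr h
            · exact .inl ⟨h1, fun e => h2 e.symm, fun e => h2 (hinv w h3 e).symm⟩
        have h2 := hG.ncard_diff (hadj a)
        have hfin : (G.neighborSet a \ {m a}).Finite :=
          Set.finite_of_ncard_ne_zero (by rw [h2]; decide)
        rw [e, Set.ncard_insert_of_notMem (fun h => hac h.1.1) (hfin.subset Set.sdiff_subset),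
          Set.ncard_sdiff_singleton_of_mem
            (show b ∈ G.neighborSet a \ {m a} from ⟨hab, fun e => hma e.symm⟩), h2]
      by_cases hva : v = a
      · subst hva
        refine key v b c h.adj_left nac hmb hma hac (fun w hw e => ?_) fun w => ?_
        · by_cases hwd : w = d
          · subst hwd; exact absurd (hmd.symm.trans e) nac.symm
          · rw [← e, hinv w hw hwd]
        · rw [hFadj]; simp [nac]
      by_cases hvc : v = c
      · subst hvc
        refine key v d a h.adj_right (Ne.symm nac) hmd hmc (fun h => hac h.symm)
          (fun w hw e => ?_) fun w => ?_
        · by_cases hwb : w = b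
          · subst hwb; exact absurd (hmb.symm.trans e) nac
          · rw [← e, hinv w hwb hw]
        · rw [hFadj]; simp [hva]
      rw [← hG.ncard_diff (hadj v)]
      congr 1
      ext w
      simp only [mem_neighborSet, hFadj, hva, hvc, false_and, or_false, Set.mem_sdiff,
        Set.mem_singleton_iff]
      refine ⟨fun h => ⟨h.1, fun e => h.2.1 e.symm⟩, fun h => ⟨h.1, fun e => h.2 e.symm, ?_⟩⟩
      intro e
      by_cases hwb : w = b
      · exact hva (by rw [← e, hwb, hmb])
      by_cases hwd : w = d
      · exact hvc (by rw [← e, hwd, hmd])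
      exact h.2 (by rw [← e, hinv w hwb hwd])
  -- The nonadjacency conditions matter here: a cross edge already present in `G` could survive in
  -- `F` and be a second cross edge.
  have hcross : F.edgeSet ∩ crossEdges a b c d = {s(a, c)} := by
    ext e
    simp only [crossEdges, Set.mem_inter_iff, Set.mem_insert_iff, Set.mem_singleton_iff]
    constructor
    · rintro ⟨he, rfl | rfl | rfl | rfl⟩
      · rfl
      all_goals
        rw [mem_edgeSet, hFadj] at he
        rcases he with h | h | h
        · exact absurd h.1 (by assumption)
        · exact absurd h (by simp [hcd.symm, hab.symm])
        · exact absurd h (by simp [nac, nbc])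
    · rintro rfl
      refine ⟨?_, .inl rfl⟩
      rw [mem_edgeSet, hFadj]
      exact .inr (.inl ⟨rfl, rfl⟩)
  obtain ⟨p, hp, hpl, hpe⟩ := exists_isCycle_of_isChain (F := F) hla hlc
    (hchain.imp fun _ _ h => (hFadj _ _).2 (.inl h)) hnodup hlen ((hFadj _ _).2 (by simp))
  have := (h.switch F hF _ hcross c p hp).1 (by rwa [Sym2.eq_swap])
  rw [hpl] at this
  exact Nat.not_even_iff_odd.mpr hodd this

/-! ### Symmetry of the certificates -/

theorem IsGadgetPair.swap_left {V : Type*} {G : SimpleGraph V} {a b c d : V}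
    (h : IsGadgetPair G a b c d) : IsGadgetPair G b a c d := by
  have hs : switchGraph G b a c d = switchGraph G a b c d := by
    ext v w
    simp only [switchGraph, sup_adj, deleteEdges_adj, fromEdgeSet_adj, crossEdges,
      Set.mem_insert_iff, Set.mem_singleton_iff, Sym2.eq_swap (a := b) (b := a)]
    tauto
  have hc : crossEdges b a c d = crossEdges a b c d := by
    ext e; simp only [crossEdges, Set.mem_insert_iff, Set.mem_singleton_iff]; tauto
  refine ⟨h.adj_left.symm, h.adj_right, ⟨h.independent.2.2.1, h.independent.2.2.2,
    h.independent.1, h.independent.2.1⟩, fun F hF => ?_, fun F hF => ?_, fun F hF => ?_,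
    fun F hF => ?_, ?_⟩
  · rw [F.adj_comm]; exact h.not_avoiding F hF
  · rw [F.adj_comm b a]; exact h.odd_one F hF
  · rw [F.adj_comm b a]; exact h.odd_both F hF
  · rw [F.adj_comm b a, Sym2.eq_swap]; exact h.different_cycles F hF
  · rw [hs, hc]; exact h.switch

theorem IsGadgetPair.swap {V : Type*} {G : SimpleGraph V} {a b c d : V}
    (h : IsGadgetPair G a b c d) : IsGadgetPair G c d a b := by
  have hc : crossEdges c d a b = crossEdges a b c d := by
    ext e
    simp only [crossEdges, Set.mem_insert_iff, Set.mem_singleton_iff, Sym2.eq_swap (a := c),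
      Sym2.eq_swap (a := d)]
    tauto
  have hs : switchGraph G c d a b = switchGraph G a b c d := by
    rw [switchGraph, switchGraph, hc, Set.pair_comm]
  obtain ⟨h1, h2, h3, h4⟩ := h.independent
  refine ⟨h.adj_right, h.adj_left, ⟨h1.symm, h3.symm, h2.symm, h4.symm⟩, fun F hF => ?_,
    fun F hF => ?_, fun F hF h1 h2 => ?_, fun F hF h1 h2 v p hp => ?_, ?_⟩
  · exact (h.not_avoiding F hF).symm
  · rw [xor_comm]; exact h.odd_one F hF
  · exact h.odd_both F hF h2 h1
  · rw [and_comm]; exact h.different_cycles F hF h2 h1 v p hp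
  · rw [hs, hc]; exact h.switch

theorem IsGadgetPair.swap_right {V : Type*} {G : SimpleGraph V} {a b c d : V}
    (h : IsGadgetPair G a b c d) : IsGadgetPair G a b d c :=
  h.swap.swap_left.swap

/-- The edges `e` and `f` are not a gadget-pair, for one of the two reasons used below. -/
def NotGadget {V : Type*} (G : SimpleGraph V) (e f : Sym2 V) : Prop :=
  ∃ a b c d, (e = s(a, b) ∧ f = s(c, d) ∨ e = s(c, d) ∧ f = s(a, b)) ∧
    (HasMatchingThrough G a b c d ∨ HasOddSwitch G a b c d)

theorem IsGadgetPair.of_sym2_eq {V : Type*} {G : SimpleGraph V} {a b c d a' b' c' d' : V}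
    (h : IsGadgetPair G a b c d) (h1 : s(a, b) = s(a', b')) (h2 : s(c, d) = s(c', d')) :
    IsGadgetPair G a' b' c' d' := by
  rw [Sym2.eq_iff] at h1 h2
  rcases h1 with ⟨rfl, rfl⟩ | ⟨rfl, rfl⟩ <;> rcases h2 with ⟨rfl, rfl⟩ | ⟨rfl, rfl⟩
  exacts [h, h.swap_right, h.swap_left, h.swap_left.swap_right]

theorem IsGadgetPair.not_notGadget {V : Type*} {G : SimpleGraph V} (hG : IsCubic G)
    {a b c d : V} (h : IsGadgetPair G a b c d) : ¬ NotGadget G s(a, b) s(c, d) := by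
  rintro ⟨a', b', c', d', he, hn⟩
  have h' : IsGadgetPair G a' b' c' d' := by
    rcases he with ⟨h1, h2⟩ | ⟨h1, h2⟩
    · exact h.of_sym2_eq h1 h2
    · exact (h.of_sym2_eq h1 h2).swap
  exact hn.elim (h'.not_hasMatchingThrough hG) (h'.not_hasOddSwitch hG)

/-! ### Transport along isomorphisms -/

theorem unmatched_adj_symm_apply {V W : Type*} {G : SimpleGraph V} {H : SimpleGraph W}
    (φ : G ≃g H) (m : W → W) {v w : W} :
    (unmatched G fun v => φ.symm (m (φ v))).Adj (φ.symm v) (φ.symm w) ↔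
      (unmatched H m).Adj v w := by
  simp only [unmatched, φ.symm.map_adj_iff, φ.apply_symm_apply, ne_eq,
    φ.symm.injective.eq_iff]

theorem adj_symm_apply {V W : Type*} {G : SimpleGraph V} {H : SimpleGraph W} (φ : G ≃g H)
    (v : V) (w : W) : G.Adj v (φ.symm w) ↔ H.Adj (φ v) w := by
  rw [← φ.map_adj_iff, φ.apply_symm_apply]

theorem HasEvenDeletion.of_iso {V W : Type*} {G : SimpleGraph V} {H : SimpleGraph W}
    (φ : G ≃g H) {x : V} (h : HasEvenDeletion H (φ x)) : HasEvenDeletion G x := by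
  obtain ⟨m, l, u, w, hadj, hinv, hx, hu, hw, hwu, hchain, hnodup, hlen, heven, hxl⟩ := h
  refine ⟨fun v => φ.symm (m (φ v)), l.map φ.symm, φ.symm u, φ.symm w, fun v hv => ?_,
    fun v hv hm => ?_, fun v hv => ?_, by simp [hu], by simp [hw],
    (unmatched_adj_symm_apply φ m).2 hwu, ?_, hnodup.map φ.symm.injective, by simpa, by simpa,
    ?_⟩
  · exact (adj_symm_apply φ _ _).2 (hadj _ (φ.injective.ne hv))
  · have h1 : m (φ v) ≠ φ x := fun e => hm (by simp only [e, φ.symm_apply_apply])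
    simp only [φ.apply_symm_apply, hinv _ (φ.injective.ne hv) h1, φ.symm_apply_apply]
  · simp only [hx _ (φ.map_adj_iff.2 hv), φ.symm_apply_apply]
  · rw [List.isChain_map]
    exact hchain.imp fun _ _ h => (unmatched_adj_symm_apply φ m).2 h
  · simp only [List.mem_map, not_exists, not_and]
    rintro v hv rfl
    rw [φ.apply_symm_apply] at hxl
    exact hxl hv

theorem HasMatchingThrough.of_iso {V W : Type*} {G : SimpleGraph V} {H : SimpleGraph W}
    (φ : G ≃g H) {a b c d : W} (h : HasMatchingThrough H a b c d) :
    HasMatchingThrough G (φ.symm a) (φ.symm b) (φ.symm c) (φ.symm d) := by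
  obtain ⟨m, hadj, hinv, rfl, rfl⟩ := h
  refine ⟨fun v => φ.symm (m (φ v)), fun v => (adj_symm_apply φ _ _).2 (hadj _), fun v => ?_,
    by simp, by simp⟩
  simp [hinv]

theorem HasOddSwitch.of_iso {V W : Type*} {G : SimpleGraph V} {H : SimpleGraph W}
    (φ : G ≃g H) {a b c d : W} (h : HasOddSwitch H a b c d) :
    HasOddSwitch G (φ.symm a) (φ.symm b) (φ.symm c) (φ.symm d) := by
  obtain ⟨hn, m, l, hadj, hinv, hmb, hmd, hma, hmc, hla, hlc, hchain, hnodup, hlen, hodd⟩ := h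
  refine ⟨by simpa only [φ.symm.map_adj_iff], fun v => φ.symm (m (φ v)), l.map φ.symm,
    fun v => (adj_symm_apply φ _ _).2 (hadj _), fun v h1 h2 => ?_, by simp [hmb], by simp [hmd],
    by simpa, by simpa, by simp [hla], by simp [hlc], ?_, hnodup.map φ.symm.injective, by simpa,
    by simpa⟩
  · have e1 : φ v ≠ b := fun h => h1 (by rw [← h, φ.symm_apply_apply])
    have e2 : φ v ≠ d := fun h => h2 (by rw [← h, φ.symm_apply_apply])
    simp only [φ.apply_symm_apply, hinv _ e1 e2, φ.symm_apply_apply]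
  · rw [List.isChain_map]
    exact hchain.imp fun _ _ h => (unmatched_adj_symm_apply φ m).2 h

theorem NotGadget.of_iso {V W : Type*} {G : SimpleGraph V} {H : SimpleGraph W}
    (φ : G ≃g H) {a b c d : V} (h : NotGadget H s(φ a, φ b) s(φ c, φ d)) :
    NotGadget G s(a, b) s(c, d) := by
  obtain ⟨a', b', c', d', he, hn⟩ := h
  refine ⟨φ.symm a', φ.symm b', φ.symm c', φ.symm d', ?_, hn.imp (·.of_iso φ) (·.of_iso φ)⟩
  have key : ∀ a b a' b', s(φ a, φ b) = s(a', b') → s(a, b) = s(φ.symm a', φ.symm b') := by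
    intro a b a' b' h
    have := congrArg (Sym2.map φ.symm) h
    simpa using this
  exact he.imp (.imp (key _ _ _ _) (key _ _ _ _)) (.imp (key _ _ _ _) (key _ _ _ _))

/-- No two independent edges of `G` are a gadget-pair. -/
def NoGadgetPair {V : Type*} (G : SimpleGraph V) : Prop :=
  ∀ a b c d, G.Adj a b → G.Adj c d → a ≠ c ∧ a ≠ d ∧ b ≠ c ∧ b ≠ d → NotGadget G s(a, b) s(c, d)

theorem NoGadgetPair.not_isGadgetPair {V W : Type*} {G : SimpleGraph V} {H : SimpleGraph W}
    (hH : NoGadgetPair H) (φ : G ≃g H) (hG : IsCubic G) {a b c d : V} :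
    ¬ IsGadgetPair G a b c d := by
  intro h
  refine h.not_notGadget hG (.of_iso φ (hH _ _ _ _ (φ.map_adj_iff.2 h.adj_left)
    (φ.map_adj_iff.2 h.adj_right) ?_))
  simpa only [ne_eq, φ.injective.eq_iff] using h.independent

/-- The only property of bold-edges that is used, apart from adjacency. It can be tested on one
vertex at a time. -/
theorem IsBoldEdge.not_hasEvenDeletion {V W : Type*} {G : SimpleGraph V} {H : SimpleGraph W}
    (φ : G ≃g H) (hG : IsCubic G) {x y : V} (h : IsBoldEdge G x y) :
    ¬ HasEvenDeletion H (φ x) ∧ ¬ HasEvenDeletion H (φ y) :=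
  ⟨fun h' => (h'.of_iso φ).not_isOddTwoFactored hG h.odd_delete_left,
    fun h' => (h'.of_iso φ).not_isOddTwoFactored hG h.odd_delete_right⟩

/-! ### The flower snark as a ring of claws -/

/-- The permutation of the rows of the flower snark at the place where the ring is closed. -/
def twist : Fin 4 ≃ Fin 4 := Equiv.swap 0 1

@[simp] theorem twist_twist (x : Fin 4) : twist (twist x) = x := by
  revert x; decide

@[simp] theorem twist_eq_three {x : Fin 4} : twist x = 3 ↔ x = 3 := by
  revert x; decide

/-- The edges of the ring: the vertex `(i, 3)` is the hub of the `i`-th claw, and its leaves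
`(i, x)`, `x ≠ 3`, are joined to those of the next claw. -/
def RingRel {t : ℕ} (p q : Fin t × Fin 4) : Prop :=
  (p.1 = q.1 ∧ p.2 = 3 ∧ q.2 ≠ 3) ∨
    (p.2 ≠ 3 ∧ ((p.1.val + 1 = q.1.val ∧ q.2 = p.2) ∨
      (p.1.val + 1 = t ∧ q.1.val = 0 ∧ q.2 = twist p.2)))

/-- A model of the flower snark. -/
def ring (t : ℕ) : SimpleGraph (Fin t × Fin 4) := SimpleGraph.fromRel RingRel

theorem RingRel.ne {t : ℕ} (ht : 2 ≤ t) {p q : Fin t × Fin 4} (h : RingRel p q) : p ≠ q := by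
  rintro rfl
  rcases h with h | ⟨-, h | h⟩
  · exact h.2.2 h.2.1
  · omega
  · omega

theorem ring_adj {t : ℕ} (ht : 2 ≤ t) {p q : Fin t × Fin 4} :
    (ring t).Adj p q ↔ RingRel p q ∨ RingRel q p := by
  rw [ring, fromRel_adj]
  refine ⟨fun h => h.2, fun h => ⟨?_, h⟩⟩
  exact h.elim (·.ne ht) fun h => (h.ne ht).symm

/-- The vertices of the flower snark as vertices of the ring. -/
def flowerEquiv (t : ℕ) : FlowerVertex t ≃ Fin t × Fin 4 where
  toFun
    | .u i => (i, 0)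
    | .v i => (i, 1)
    | .w i => (i, 2)
    | .h i => (i, 3)
  invFun
    | (i, 0) => .u i
    | (i, 1) => .v i
    | (i, 2) => .w i
    | (i, 3) => .h i
  left_inv := by rintro (i | i | i | i) <;> rfl
  right_inv := by rintro ⟨i, x⟩; fin_cases x <;> rfl

/-- The flower snark is isomorphic to the ring. -/
def flowerIso (t : ℕ) : flower t ≃g ring t where
  toEquiv := flowerEquiv t
  map_rel_iff' := by
    have h01 : twist 0 = 1 := rfl
    have h10 : twist 1 = 0 := rfl
    have h22 : twist 2 = 2 := rfl
    have h33 : twist 3 = 3 := rfl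
    rintro (i | i | i | i) (j | j | j | j) <;>
      simp [flower, ring, flowerEquiv, RingRel, h01, h10, h22, h33]

/-- Rotation of the ring by one claw. -/
def rot {t : ℕ} : Fin t × Fin 4 ≃ Fin t × Fin 4 where
  toFun v := if h : v.1.val + 1 < t then (⟨v.1.val + 1, h⟩, v.2)
    else (⟨0, v.1.pos⟩, twist v.2)
  invFun v := if v.1.val = 0 then (⟨t - 1, by have := v.1.pos; omega⟩, twist v.2)
    else (⟨v.1.val - 1, by omega⟩, v.2)
  left_inv := by
    rintro ⟨⟨i, hi⟩, x⟩
    by_cases h : i + 1 < t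
    · simp [h]
    · have : i = t - 1 := by omega
      subst this
      simp [h]
  right_inv := by
    rintro ⟨⟨i, hi⟩, x⟩
    by_cases h : i = 0
    · have : ¬ t - 1 + 1 < t := by omega
      subst h
      simp [this]
    · have h1 : i - 1 + 1 = i := by omega
      have h2 : i - 1 + 1 < t := by omega
      simp [h, h1, hi]

theorem rot_fst {t : ℕ} (v : Fin t × Fin 4) :
    (rot v).1.val = if v.1.val + 1 < t then v.1.val + 1 else 0 := by
  simp only [rot, Equiv.coe_fn_mk]; split_ifs <;> rfl

theorem rot_snd {t : ℕ} (v : Fin t × Fin 4) :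
    (rot v).2 = if v.1.val + 1 < t then v.2 else twist v.2 := by
  simp only [rot, Equiv.coe_fn_mk]; split_ifs <;> rfl

theorem rot_symm_fst {t : ℕ} (v : Fin t × Fin 4) :
    (rot.symm v).1.val = if v.1.val = 0 then t - 1 else v.1.val - 1 := by
  simp only [rot, Equiv.coe_fn_symm_mk]; split_ifs <;> rfl

theorem rot_symm_snd {t : ℕ} (v : Fin t × Fin 4) :
    (rot.symm v).2 = if v.1.val = 0 then twist v.2 else v.2 := by
  simp only [rot, Equiv.coe_fn_symm_mk]; split_ifs <;> rfl

@[simp] theorem rot_snd_eq_three {t : ℕ} (v : Fin t × Fin 4) : (rot v).2 = 3 ↔ v.2 = 3 := by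
  rw [rot_snd]; split_ifs <;> simp

@[simp] theorem rot_symm_snd_eq_three {t : ℕ} (v : Fin t × Fin 4) :
    (rot.symm v).2 = 3 ↔ v.2 = 3 := by
  rw [rot_symm_snd]; split_ifs <;> simp

/-- `rot` absorbs both the return to claw `0` and the twist there, so every link joins a leaf to its
image under `rot`, and the seam needs no separate case. -/
theorem ringRel_iff {t : ℕ} {p q : Fin t × Fin 4} :
    RingRel p q ↔ (p.1 = q.1 ∧ p.2 = 3 ∧ q.2 ≠ 3) ∨ (p.2 ≠ 3 ∧ q = rot p) := by
  refine or_congr_right (and_congr_right fun _ => ?_)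
  rw [Prod.ext_iff, Fin.ext_iff (a := q.1), rot_fst, rot_snd]
  have := q.1.isLt
  split_ifs with h
  · constructor
    · rintro (h1 | h1)
      · exact ⟨h1.1.symm, h1.2⟩
      · omega
    · rintro ⟨h1, h2⟩
      exact .inl ⟨h1.symm, h2⟩
  · constructor
    · rintro (h1 | h1)
      · omega
      · exact h1.2
    · rintro h1
      exact .inr ⟨by omega, h1⟩

theorem rot_fst_inj {t : ℕ} {p q : Fin t × Fin 4} : (rot p).1 = (rot q).1 ↔ p.1 = q.1 := by
  have := p.1.isLt
  have := q.1.isLt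
  rw [Fin.ext_iff, Fin.ext_iff (a := p.1), rot_fst, rot_fst]
  split_ifs <;> first | omega | (rw [false_iff]; omega)

theorem ringRel_rot {t : ℕ} {p q : Fin t × Fin 4} : RingRel (rot p) (rot q) ↔ RingRel p q := by
  simp [ringRel_iff, rot_fst_inj]

/-- Iterates of `rot`: the seam is not a distinguished place of the ring. The orientation `RingRel`
is preserved, not just adjacency, so an edge keeps its claw of origin in the normal forms below. -/
theorem exists_rotation {t : ℕ} (n : ℕ) : ∃ φ : ring t ≃g ring t,
    (∀ p q, RingRel (φ p) (φ q) ↔ RingRel p q) ∧ (∀ p, (φ p).2 = 3 ↔ p.2 = 3) ∧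
      ∀ p, (φ p).1.val = (p.1.val + n) % t := by
  induction n with
  | zero => exact ⟨Iso.refl, fun _ _ => Iff.rfl, fun _ => Iff.rfl,
      fun p => (Nat.mod_eq_of_lt p.1.isLt).symm⟩
  | succ n ih =>
    obtain ⟨φ, h1, hhub, h2⟩ := ih
    let ρ : ring t ≃g ring t := ⟨rot, by
      intro p q
      simp only [ring, fromRel_adj, ringRel_rot, ne_eq, rot.injective.eq_iff]⟩
    refine ⟨φ.trans ρ, fun p q => (ringRel_rot (p := φ p) (q := φ q)).trans (h1 p q),
      fun p => (rot_snd_eq_three (φ p)).trans (hhub p), fun p => ?_⟩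
    have h3 : ((φ.trans ρ) p).1.val = (rot (φ p)).1.val := rfl
    have ht := p.1.pos
    rw [h3, rot_fst, h2, ← Nat.add_assoc, Nat.add_mod _ 1]
    have := Nat.mod_lt (p.1.val + n) ht
    by_cases h1t : t = 1
    · subst h1t; simp [Nat.mod_one]
    rw [Nat.mod_eq_of_lt (a := 1) (by omega)]
    split_ifs with h
    · rw [Nat.mod_eq_of_lt h]
    · rw [show (p.1.val + n) % t + 1 = t by omega, Nat.mod_self]

/-! ### Matchings of the ring -/

/-- The partner function given by the directions `d` (`0`: towards the hub, `1`: to the next claw,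
`2`: to the previous claw) in which the leaves are matched, and the rows `r` of the leaves that
are matched with the hubs. -/
def ringPartner {t : ℕ} (r : ℕ → Fin 4) (d : ℕ → Fin 4 → Fin 3) (v : Fin t × Fin 4) :
    Fin t × Fin 4 :=
  if v.2 = 3 then (v.1, r v.1.val)
  else if d v.1.val v.2 = 1 then rot v
  else if d v.1.val v.2 = 2 then rot.symm v
  else (v.1, 3)

theorem ring_adj_rot {t : ℕ} (ht : 2 ≤ t) {v : Fin t × Fin 4} (hv : v.2 ≠ 3) :
    (ring t).Adj v (rot v) :=
  (ring_adj ht).2 (.inl (ringRel_iff.2 (.inr ⟨hv, rfl⟩)))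

theorem ring_adj_hub {t : ℕ} (ht : 2 ≤ t) {i : Fin t} {x : Fin 4} (hx : x ≠ 3) :
    (ring t).Adj (i, 3) (i, x) :=
  (ring_adj ht).2 (.inl (.inl ⟨rfl, rfl, hx⟩))

theorem ring_adj_ringPartner {t : ℕ} (ht : 2 ≤ t) {r : ℕ → Fin 4} (hr : ∀ i, r i ≠ 3)
    (d : ℕ → Fin 4 → Fin 3) (v : Fin t × Fin 4) : (ring t).Adj v (ringPartner r d v) := by
  unfold ringPartner
  split_ifs with h1 h2 h3
  · obtain ⟨i, x⟩ := v
    subst h1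
    exact ring_adj_hub ht (hr _)
  · exact ring_adj_rot ht h1
  · have := ring_adj_rot ht (v := rot.symm v) (by simpa using h1)
    rw [Equiv.apply_symm_apply] at this
    exact this.symm
  · exact (ring_adj_hub ht h1).symm

/-- Being an involution is a local condition: hub and leaf must choose each other, and so must the
two ends of a link. It is stated at one vertex because the certificates below violate it at a few
exceptional vertices. -/
theorem ringPartner_ringPartner {t : ℕ} {r : ℕ → Fin 4} {d : ℕ → Fin 4 → Fin 3}
    (hr : ∀ i, r i ≠ 3) {v : Fin t × Fin 4}
    (h3 : v.2 = 3 → d v.1.val (r v.1.val) = 0)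
    (h0 : v.2 ≠ 3 → d v.1.val v.2 = 0 → r v.1.val = v.2)
    (h1 : v.2 ≠ 3 → d v.1.val v.2 = 1 → d (rot v).1.val (rot v).2 = 2)
    (h2 : v.2 ≠ 3 → d v.1.val v.2 = 2 → d (rot.symm v).1.val (rot.symm v).2 = 1) :
    ringPartner r d (ringPartner r d v) = v := by
  by_cases hv : v.2 = 3
  · simp only [ringPartner, hv, if_true, hr, if_false, h3 hv]
    exact Prod.ext rfl hv.symm
  have h012 : d v.1.val v.2 = 0 ∨ d v.1.val v.2 = 1 ∨ d v.1.val v.2 = 2 := by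
    generalize d v.1.val v.2 = z; revert z; decide
  rcases h012 with h | h | h
  · have := h0 hv h
    simp [ringPartner, hv, h, this]
  · have := h1 hv h
    simp [ringPartner, hv, h, this]
  · have := h2 hv h
    simp [ringPartner, hv, h, this]

/-- The rows of the links in a perfect matching of the ring: `b i` and `b (i + 1)` are the rows
of the links from the `i`-th claw to the previous and to the next one. -/
theorem exists_matching_of_rows {t : ℕ} (ht : 2 ≤ t) {b : ℕ → Fin 4} (h3 : ∀ i, b i ≠ 3)
    (hne : ∀ i < t, b i ≠ b (i + 1)) (hclose : b 0 = twist (b t)) :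
    ∃ m : Fin t × Fin 4 → Fin t × Fin 4, (∀ v, (ring t).Adj v (m v)) ∧ (∀ v, m (m v) = v) ∧
      (∀ (i : Fin t) x, x ≠ 3 → x ≠ b i.val → x ≠ b (i.val + 1) → m (i, 3) = (i, x)) ∧
      (∀ i : Fin t, m (i, b (i.val + 1)) = rot (i, b (i.val + 1))) := by
  -- The rows `0`, `1`, `2` sum to `3`, so `3 - x - y` is the row different from `x` and `y`; the
  -- hub is matched with the leaf in that row.
  have hthird : ∀ x y : Fin 4, x ≠ 3 → y ≠ 3 → x ≠ y →
      3 - x - y ≠ 3 ∧ 3 - x - y ≠ x ∧ 3 - x - y ≠ y ∧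
        ∀ z, z ≠ 3 → z ≠ x → z ≠ y → 3 - x - y = z := by decide
  let r : ℕ → Fin 4 := fun i => if i < t then 3 - b i - b (i + 1) else 0
  let d : ℕ → Fin 4 → Fin 3 := fun i x => if x = b (i + 1) then 1 else if x = b i then 2 else 0
  have hr : ∀ i, r i ≠ 3 := by
    intro i
    by_cases h : i < t
    · simpa only [r, h, if_true] using (hthird _ _ (h3 i) (h3 (i + 1)) (hne i h)).1
    · simp only [r, h, if_false]; decide
  refine ⟨ringPartner r d, ring_adj_ringPartner ht hr d, fun v => ?_, fun i x hx h1 h2 => ?_,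
    fun i => ?_⟩
  · have hv := v.1.isLt
    obtain ⟨-, e1, e2, e3⟩ := hthird _ _ (h3 v.1.val) (h3 (v.1.val + 1)) (hne _ hv)
    apply ringPartner_ringPartner hr
    · intro _
      simp only [r, d, hv, if_true, e1, e2, if_false]
    · intro hx h
      simp only [r, hv, if_true]
      simp only [d] at h
      split_ifs at h with h1 h2
      · exact absurd h (by decide)
      · exact absurd h (by decide)
      · exact e3 _ hx h2 h1
    · intro hx h
      have h1 : v.2 = b (v.1.val + 1) := by
        by_contra h1
        simp only [d, h1, if_false] at h
        split_ifs at h <;> exact absurd h (by decide)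
      have e : (rot v).2 = b (rot v).1.val := by
        rw [rot_snd, rot_fst, h1]
        split_ifs with h
        · rfl
        · rw [hclose, show v.1.val + 1 = t by omega]
      simp only [d, e, if_true, hne _ (rot v).1.isLt, if_false]
    · intro hx h
      have h1 : v.2 = b v.1.val := by
        by_contra h1
        simp only [d, h1, if_false] at h
        split_ifs at h <;> exact absurd h (by decide)
      have e : (rot.symm v).2 = b ((rot.symm v).1.val + 1) := by
        rw [rot_symm_snd, rot_symm_fst, h1]
        split_ifs with h
        · rw [h, hclose, twist_twist, Nat.sub_add_cancel (by omega)]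
        · rw [Nat.sub_add_cancel (by omega)]
      simp only [d, e, if_true]
  · obtain ⟨-, e1, e2, e3⟩ := hthird _ _ (h3 i.val) (h3 (i.val + 1)) (hne _ i.isLt)
    simp only [ringPartner, if_true, r, i.isLt]
    rw [e3 x hx h1 h2]
  · simp only [ringPartner, h3, if_false, d, if_true]

/-- There is a sequence of `n + 1` rows from `x` to `y` with different consecutive terms. -/
def Joined (n : ℕ) (x y : Fin 4) : Prop :=
  (n = 0 → x = y) ∧ (n = 1 → x ≠ y)

/-- These are walks in the triangle on the three rows. Only lengths `0` and `1` constrain the ends: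
a longer walk can always step to a row different from both. -/
theorem Joined.exists_rows {n : ℕ} : ∀ {x y : Fin 4}, x ≠ 3 → y ≠ 3 → Joined n x y →
    ∃ c : ℕ → Fin 4, c 0 = x ∧ c n = y ∧ (∀ i, c i ≠ 3) ∧ ∀ i < n, c i ≠ c (i + 1) := by
  induction n with
  | zero =>
    intro x y hx hy h
    exact ⟨fun _ => x, rfl, h.1 rfl, fun _ => hx, by simp⟩
  | succ n ih =>
    intro x y hx hy h
    obtain ⟨z, hz, hxz, hzy⟩ : ∃ z, z ≠ 3 ∧ x ≠ z ∧ Joined n z y := by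
      have h1 : ∀ x y : Fin 4, x ≠ 3 → y ≠ 3 → ∃ z, z ≠ 3 ∧ x ≠ z ∧ z ≠ y := by decide
      by_cases hn : n = 0
      · subst hn
        exact ⟨y, hy, h.2 rfl, fun _ => rfl, by simp⟩
      · obtain ⟨z, hz, hxz, hzy⟩ := h1 x y hx hy
        exact ⟨z, hz, hxz, fun h => absurd h hn, fun _ => hzy⟩
    obtain ⟨c, h0, hn, h3, hc⟩ := ih hz hy hzy
    refine ⟨fun i => Nat.casesOn i x c, rfl, hn, ?_, ?_⟩
    · rintro (_ | i)
      · exact hx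
      · exact h3 i
    · rintro (_ | i) hi
      · change x ≠ c 0
        rwa [h0]
      · exact hc i (by omega)

/-- The edge from `p` to `q` belongs to the matching if `x` and `y` are the rows of the links
from the claw of `p` to the previous and to the next one. -/
def Compatible (p q x y : Fin 4) : Prop :=
  (p = 3 → q ≠ x ∧ q ≠ y) ∧ (p ≠ 3 → p = y)

instance (p q x y : Fin 4) : Decidable (Compatible p q x y) := by
  unfold Compatible; infer_instance

instance (n : ℕ) (x y : Fin 4) : Decidable (Joined n x y) := by
  unfold Joined; infer_instance

theorem eq_of_compatible {t : ℕ} {m : Fin t × Fin 4 → Fin t × Fin 4} {b : ℕ → Fin 4}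
    (hm1 : ∀ (i : Fin t) x, x ≠ 3 → x ≠ b i.val → x ≠ b (i.val + 1) → m (i, 3) = (i, x))
    (hm2 : ∀ i : Fin t, m (i, b (i.val + 1)) = rot (i, b (i.val + 1)))
    {p q : Fin t × Fin 4} (h : RingRel p q)
    (hc : Compatible p.2 q.2 (b p.1.val) (b (p.1.val + 1))) : m p = q := by
  obtain ⟨i, x⟩ := p
  obtain ⟨j, y⟩ := q
  rcases ringRel_iff.1 h with ⟨h1, h2, h3⟩ | ⟨h1, h2⟩
  · dsimp only at h1 h2 h3 hc
    subst h1 h2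
    exact hm1 _ _ h3 (hc.1 rfl).1 (hc.1 rfl).2
  · have := hc.2 h1
    dsimp only at this
    rw [h2, this, hm2]

/-- Each edge fixes the rows of the two links at its own claw. The two arcs of the ring between
these claws are then filled by walks of rows, of lengths `j - 2` and `t - j`, where `j` is the claw
of `p'`. -/
theorem hasMatchingThrough_of_joined {t : ℕ} {p q p' q' : Fin t × Fin 4}
    (h : RingRel p q) (h' : RingRel p' q') (hp : p.1.val = 1) (hp' : 2 ≤ p'.1.val)
    {x y x' y' : Fin 4} (hx : x ≠ 3) (hy : y ≠ 3) (hx' : x' ≠ 3) (hy' : y' ≠ 3)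
    (hxy : x ≠ y) (hxy' : x' ≠ y') (hc : Compatible p.2 q.2 x y)
    (hc' : Compatible p'.2 q'.2 x' y') (hj : Joined (p'.1.val - 2) y x')
    (hj' : Joined (t - p'.1.val) y' (twist x)) : HasMatchingThrough (ring t) p q p' q' := by
  obtain ⟨c, hc0, hc1, hc3, hcne⟩ := hj.exists_rows hy hx'
  obtain ⟨e, he0, he1, he3, hene⟩ := hj'.exists_rows hy' (by simpa)
  have hlt := p'.1.isLt
  set j := p'.1.val with hjdef
  -- The second walk is continued past the seam without untwisting, so it ends in `twist x`. Its
  -- term before that is the row `b t` of the link across the seam, and `b 0` is the twist of this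
  -- row.
  let b : ℕ → Fin 4 := fun i =>
    if i = 0 then twist (e (t - j - 1)) else if i = 1 then x else if i ≤ j then c (i - 2)
    else e (i - j - 1)
  have b1 : b 1 = x := rfl
  have b2 : b 2 = y := by
    simp only [b]
    rw [if_neg (by omega), if_neg (by omega), if_pos hp', hc0]
  have bj : b j = x' := by
    simp only [b]
    rw [if_neg (by omega), if_neg (by omega), if_pos le_rfl, hc1]
  have bj1 : b (j + 1) = y' := by
    simp only [b]
    rw [if_neg (by omega), if_neg (by omega), if_neg (by omega),
      show j + 1 - j - 1 = 0 by omega, he0]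
  have hlast : e (t - j - 1) ≠ twist x := by
    have := hene (t - j - 1) (by omega)
    rwa [show t - j - 1 + 1 = t - j by omega, he1] at this
  obtain ⟨m, m1, m2, m3, m4⟩ := exists_matching_of_rows (t := t) (by omega) (b := b)
    (fun i => by
      simp only [b]
      split_ifs
      · simpa using he3 _
      · exact hx
      · exact hc3 _
      · exact he3 _)
    (fun i hi => by
      by_cases h0 : i = 0
      · subst h0
        intro h
        apply hlast
        rw [zero_add, b1] at h
        rw [← h]
        simp [b]
      by_cases h1 : i = 1
      · subst h1; rw [b1, b2]; exact hxy
      by_cases h2 : i < j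
      · have := hcne (i - 2) (by omega)
        simp only [b]
        rwa [if_neg h0, if_neg h1, if_pos (by omega), if_neg (by omega), if_neg (by omega),
          if_pos (by omega), show i + 1 - 2 = i - 2 + 1 by omega]
      by_cases h3 : i = j
      · rw [h3, bj, bj1]; exact hxy'
      · have := hene (i - j - 1) (by omega)
        simp only [b]
        rwa [if_neg h0, if_neg h1, if_neg (by omega), if_neg (by omega), if_neg (by omega),
          if_neg (by omega), show i + 1 - j - 1 = i - j - 1 + 1 by omega])
    (by
      change twist _ = _
      simp only [b]
      rw [if_neg (by omega), if_neg (by omega), if_neg (by omega)])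
  refine ⟨m, m1, m2, eq_of_compatible m3 m4 h ?_, eq_of_compatible m3 m4 h' ?_⟩
  · rw [hp, b1, b2]; exact hc
  · rw [← hjdef, bj, bj1]; exact hc'

/-- Here one arc, of length `t - 1 ≥ 2`, has to be filled, and a walk of such a length joins any two
rows. -/
theorem hasMatchingThrough_of_same_claw {t : ℕ} (ht : 3 ≤ t) {p q p' q' : Fin t × Fin 4}
    (h : RingRel p q) (h' : RingRel p' q') (hp : p.1.val = 1) (hp' : p'.1.val = 1)
    {x y : Fin 4} (hx : x ≠ 3) (hy : y ≠ 3) (hxy : x ≠ y) (hc : Compatible p.2 q.2 x y)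
    (hc' : Compatible p'.2 q'.2 x y) : HasMatchingThrough (ring t) p q p' q' := by
  obtain ⟨e, he0, he1, he3, hene⟩ := Joined.exists_rows (n := t - 1) hy
    (y := twist x) (by simpa) ⟨by omega, by omega⟩
  let b : ℕ → Fin 4 := fun i =>
    if i = 0 then twist (e (t - 2)) else if i = 1 then x else e (i - 2)
  have b1 : b 1 = x := rfl
  have b2 : b 2 = y := he0
  have hlast : e (t - 2) ≠ twist x := by
    have := hene (t - 2) (by omega)
    rwa [show t - 2 + 1 = t - 1 by omega, he1] at this
  obtain ⟨m, m1, m2, m3, m4⟩ := exists_matching_of_rows (t := t) (by omega) (b := b)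
    (fun i => by
      simp only [b]
      split_ifs
      · simpa using he3 _
      · exact hx
      · exact he3 _)
    (fun i hi => by
      by_cases h0 : i = 0
      · subst h0
        intro h
        apply hlast
        rw [zero_add, b1] at h
        rw [← h]
        simp [b]
      by_cases h1 : i = 1
      · subst h1; rw [b1, b2]; exact hxy
      · have := hene (i - 2) (by omega)
        simp only [b]
        rwa [if_neg h0, if_neg h1, if_neg (by omega), if_neg (by omega),
          show i + 1 - 2 = i - 2 + 1 by omega])
    (by
      change twist _ = _
      simp only [b]
      rw [if_neg (by omega), if_neg (by omega)])
  refine ⟨m, m1, m2, eq_of_compatible m3 m4 h ?_, eq_of_compatible m3 m4 h' ?_⟩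
  · rw [hp, b1, b2]; exact hc
  · rw [hp', b1, b2]; exact hc'

/-! ### Gadget-pairs in flower snarks -/

theorem exists_third_row : ∀ x y : Fin 4, x ≠ 3 → y ≠ 3 → x ≠ y →
    ∃ z, z ≠ 3 ∧ z ≠ x ∧ z ≠ y ∧ ∀ w, w = x ∨ w = y ∨ w = z ∨ w = 3 := by decide

/-- Two links in the same gap lie in no common perfect matching when `t` is odd: each claw has two
leaves matched by links, so the numbers of matched links in successive gaps would alternate between
`2` and `0`. A switch is used instead. Each hub is matched with its leaf in the third row `z`, and
the new edge closes the path through the hub of claw `1` to a triangle. -/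
theorem hasOddSwitch_ring {t : ℕ} (ht : 5 ≤ t) (hodd : Odd t) {x y : Fin 4} (hx : x ≠ 3)
    (hy : y ≠ 3) (hxy : x ≠ y) (i j : Fin t) (hi : i.val = 1) (hj : j.val = 2) :
    HasOddSwitch (ring t) (i, x) (j, x) (i, y) (j, y) := by
  obtain ⟨z, hz, hzx, hzy, hall⟩ := exists_third_row x y hx hy hxy
  rw [Nat.odd_iff] at hodd
  have hij : i ≠ j := by rintro rfl; omega
  let r : ℕ → Fin 4 := fun _ => z
  -- In rows `x` and `y` the claws are paired as `0, 1`, then `3, 4`, and so on up to `t - 2, t -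
  -- 1`, which needs `t` odd. Claw `2` points back to claw `1` without being answered, as the switch
  -- requires.
  let d : ℕ → Fin 4 → Fin 3 := fun i w =>
    if w = z then 0 else if i = 0 ∨ i % 2 = 1 ∧ i ≠ 1 then 1 else 2
  have hr : ∀ i, r i ≠ 3 := fun _ => hz
  have dz : ∀ i, d i z = 0 := fun i => by simp only [d, if_true]
  have d1 : ∀ i w, d i w = 1 ↔ w ≠ z ∧ (i = 0 ∨ i % 2 = 1 ∧ i ≠ 1) := by
    intro i w; simp only [d]; split_ifs <;> simp_all
  have d2 : ∀ i w, d i w = 2 ↔ w ≠ z ∧ ¬ (i = 0 ∨ i % 2 = 1 ∧ i ≠ 1) := by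
    intro i w; simp only [d]; split_ifs <;> simp_all
  have d0 : ∀ i w, d i w = 0 → z = w := by
    intro i w; simp only [d]; split_ifs <;> simp_all
  have hdown : ∀ (k : Fin t) w, w ≠ 3 → w ≠ z → k.val = 1 ∨ k.val = 2 →
      ringPartner r d (k, w) = rot.symm (k, w) := by
    intro k w h3 hwz hk
    have h : d k.val w = 2 := (d2 _ _).2 ⟨hwz, by omega⟩
    simp [ringPartner, h3, h]
  have hjx : ∀ w, w ≠ 3 → w ≠ z → ringPartner r d (j, w) = (i, w) := by
    intro w h3 hwz
    rw [hdown j w h3 hwz (.inr hj), Prod.ext_iff, Fin.ext_iff, rot_symm_fst, rot_symm_snd]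
    simp [hj, hi]
  have hix : ∀ w, w ≠ 3 → w ≠ z → (ringPartner r d (i, w)).1.val = 0 := by
    intro w h3 hwz
    rw [hdown i w h3 hwz (.inl hi), rot_symm_fst]
    simp [hi]
  have hii : ringPartner r d (i, 3) = (i, z) := by simp [ringPartner, r]
  refine ⟨?_, ringPartner r d, [(i, x), (i, 3), (i, y)],
    ring_adj_ringPartner (by omega) hr d, fun v hvx hvy => ?_, hjx x hx hzx.symm,
    hjx y hy hzy.symm, fun h => ?_, fun h => ?_, rfl, rfl, ?_, ?_, by simp, ⟨1, rfl⟩⟩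
  · simp only [ring_adj (t := t) (by omega), RingRel]
    simp [hx, hy, hxy, hxy.symm, hi, hj]
  · have := v.1.isLt
    apply ringPartner_ringPartner hr
    · exact fun _ => dz _
    · exact fun _ h => d0 _ _ h
    · intro _ h
      obtain ⟨h1, h2⟩ := (d1 _ _).1 h
      rw [d2, rot_snd, rot_fst, if_pos (by omega), if_pos (by omega)]
      exact ⟨h1, by omega⟩
    · intro h3 h
      obtain ⟨h1, h2⟩ := (d2 _ _).1 h
      have hv2 : v.1.val ≠ 2 := by
        intro e
        have e1 : v.1 = j := Fin.ext (e.trans hj.symm)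
        rcases hall v.2 with h | h | h | h
        · exact hvx (Prod.ext e1 h)
        · exact hvy (Prod.ext e1 h)
        · exact h1 h
        · exact h3 h
      rw [d1, rot_symm_snd, rot_symm_fst, if_neg (by omega), if_neg (by omega)]
      exact ⟨h1, by omega⟩
  · have := congrArg (fun v => v.1.val) h
    dsimp only at this
    rw [hix x hx hzx.symm] at this; omega
  · have := congrArg (fun v => v.1.val) h
    dsimp only at this
    rw [hix y hy hzy.symm] at this; omega
  · have key : ∀ w, w ≠ 3 → w ≠ z → (unmatched (ring t) (ringPartner r d)).Adj (i, 3) (i, w) := by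
      intro w h3 hwz
      refine ⟨ring_adj_hub (by omega) h3, ?_, fun h => ?_⟩
      · rw [hii]; simpa using hwz.symm
      · have := congrArg (fun v => v.1.val) h
        dsimp only at this
        rw [hix w h3 hwz] at this; omega
    simp only [List.isChain_cons_cons, List.isChain_singleton, and_true]
    exact ⟨(key x hx hzx.symm).symm, key y hy hzy.symm⟩
  · simp [hx, hxy, hy.symm]

/-- The last hypothesis says that at least one of the edges is a hub edge; two links leaving the
same claw are left to `hasOddSwitch_ring`. -/
theorem exists_compatible_same_claw : ∀ p q p' q' : Fin 4, (p = 3 → q ≠ 3) → (p ≠ 3 → q = p) →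
    (p' = 3 → q' ≠ 3) → (p' ≠ 3 → q' = p') → p ≠ p' → (p = 3 → q ≠ p') → (p' = 3 → p ≠ q') →
    p = 3 ∨ p' = 3 →
    ∃ x y : Fin 4, x ≠ 3 ∧ y ≠ 3 ∧ x ≠ y ∧ Compatible p q x y ∧ Compatible p' q' x y := by
  decide +kernel

-- The flags `a`, `b`, `c` mark the cases in which the second edge starts in claw `2`, `3` or `t -
-- 1`. Exactly then an arc between the two claws has length `0` or `1` and constrains the rows at
-- its ends. They exclude each other because `t ≥ 5`.
set_option synthInstance.maxSize 1000 in
set_option synthInstance.maxHeartbeats 400000 in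
theorem exists_compatible : ∀ (a b c : Bool) (p q p' q' : Fin 4), (a → ¬ b) → (a → ¬ c) →
    (b → ¬ c) → (p = 3 → q ≠ 3) → (p ≠ 3 → q = p) → (p' = 3 → q' ≠ 3) → (p' ≠ 3 → q' = p') →
    (a → p ≠ 3 → q ≠ p' ∧ q ≠ q') →
    ∃ x y x' y' : Fin 4, x ≠ 3 ∧ y ≠ 3 ∧ x' ≠ 3 ∧ y' ≠ 3 ∧ x ≠ y ∧ x' ≠ y' ∧
      Compatible p q x y ∧ Compatible p' q' x' y' ∧ (a → y = x') ∧ (b → y ≠ x') ∧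
      (c → y' ≠ twist x) := by
  decide +kernel

/-- A perfect matching through both edges always exists, except for two links in the same gap. The
first edge starts in claw `1`, and the second must not start in claw `0`, so that it comes later in
the order in which the rows are chosen. -/
theorem notGadget_ring {t : ℕ} (ht : 5 ≤ t) (hodd : Odd t) {p q p' q' : Fin t × Fin 4}
    (h : RingRel p q) (h' : RingRel p' q') (hp : p.1.val = 1) (hp' : 1 ≤ p'.1.val)
    (hind : p ≠ p' ∧ p ≠ q' ∧ q ≠ p' ∧ q ≠ q') : NotGadget (ring t) s(p, q) s(p', q') := by
  obtain ⟨h1, h2, h3, h4⟩ := hind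
  have hr := ringRel_iff.1 h
  have hr' := ringRel_iff.1 h'
  have hlt := p'.1.isLt
  have hrow : ∀ {p q : Fin t × Fin 4}, RingRel p q → p.2 = 3 → q.2 ≠ 3 ∧ p.1 = q.1 := by
    intro p q h h3
    rcases ringRel_iff.1 h with h | h
    · exact ⟨h.2.2, h.1⟩
    · exact absurd h3 h.1
  have hrow' : ∀ {p q : Fin t × Fin 4}, RingRel p q → p.2 ≠ 3 → q = rot p := by
    intro p q h h3
    rcases ringRel_iff.1 h with h | h
    · exact absurd h.2.1 h3
    · exact h.2
  by_cases hj : p'.1.val = 1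
  · have e : p.1 = p'.1 := Fin.ext (hp.trans hj.symm)
    have hne : p.2 ≠ p'.2 := fun e' => h1 (Prod.ext e e')
    by_cases hh : p.2 = 3 ∨ p'.2 = 3
    · have hsame : ∀ {p q : Fin t × Fin 4}, RingRel p q → p.1.val = 1 → p.2 ≠ 3 → q.2 = p.2 := by
        intro p q h hp h3
        rw [hrow' h h3, rot_snd, if_pos (by omega)]
      obtain ⟨x, y, hx, hy, hxy, hc, hc'⟩ := exists_compatible_same_claw p.2 q.2 p'.2 q'.2
        (fun e => (hrow h e).1) (hsame h hp) (fun e => (hrow h' e).1) (hsame h' hj) hne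
        (fun e3 e' => h3 (Prod.ext ((hrow h e3).2.symm.trans e) e'))
        (fun e3 e' => h2 (Prod.ext (e.trans (hrow h' e3).2) e')) hh
      exact ⟨p, q, p', q', .inl ⟨rfl, rfl⟩, .inl
        (hasMatchingThrough_of_same_claw (by omega) h h' hp hj hx hy hxy hc hc')⟩
    · push Not at hh
      have hq : ∀ {p q : Fin t × Fin 4}, RingRel p q → p.1.val = 1 → p.2 ≠ 3 →
          q = (⟨2, by omega⟩, p.2) := by
        intro p q h hp h3
        rw [hrow' h h3, Prod.ext_iff, Fin.ext_iff, rot_snd, rot_fst, if_pos (by omega),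
          if_pos (by omega), hp]
        exact ⟨rfl, rfl⟩
      have hs := hasOddSwitch_ring ht hodd hh.1 hh.2 hne p.1 ⟨2, by omega⟩ hp rfl
      rw [← hq h hp hh.1, e, ← hq h' hj hh.2, ← e] at hs
      refine ⟨_, _, _, _, .inl ⟨rfl, rfl⟩, .inr ?_⟩
      convert hs using 1
      exact Prod.ext e.symm rfl
  · by_cases hlast : p'.1.val + 1 < t ∨ p'.2 = 3
    all_goals
      have hq : p.2 ≠ 3 → q.1.val = 2 ∧ q.2 = p.2 := by
        intro h3
        rw [hrow' h h3, rot_snd, rot_fst, if_pos (by omega), if_pos (by omega), hp]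
        exact ⟨rfl, rfl⟩
    · have hq' : p'.2 ≠ 3 → q'.2 = p'.2 := by
        intro h3
        rw [hrow' h' h3, rot_snd, if_pos (hlast.resolve_right h3)]
      obtain ⟨x, y, x', y', hx, hy, hx', hy', hxy, hxy', hc, hc', ha, hb, hcc⟩ :=
        exists_compatible (decide (p'.1.val = 2)) (decide (p'.1.val = 3))
          (decide (p'.1.val + 1 = t)) p.2 q.2 p'.2 q'.2 (by simp; omega) (by simp; omega)
          (by simp; omega) (fun e => (hrow h e).1) (fun e => (hq e).2)
          (fun e => (hrow h' e).1) hq' (by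
            simp only [decide_eq_true_eq]
            intro e2 e3
            have e4 : q.1 = p'.1 := Fin.ext ((hq e3).1.trans e2.symm)
            have e5 : q.2 ≠ p'.2 := fun e5 => h3 (Prod.ext e4 e5)
            refine ⟨e5, fun e6 => ?_⟩
            by_cases e7 : p'.2 = 3
            · exact h4 (Prod.ext (e4.trans (hrow h' e7).2) e6)
            · exact e5 (e6.trans (hq' e7)))
      simp only [decide_eq_true_eq] at ha hb hcc
      exact ⟨p, q, p', q', .inl ⟨rfl, rfl⟩, .inl
        (hasMatchingThrough_of_joined h h' hp (by omega) hx hy hx' hy' hxy hxy' hc hc'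
          ⟨fun e => ha (by omega), fun e => hb (by omega)⟩
          ⟨fun e => absurd e (by omega), fun e => hcc (by omega)⟩)⟩
    · push Not at hlast
      -- The second edge is the link across the seam, whose far end lies in the twisted row. For a
      -- link `Compatible` ignores the far end, so the row of `p'` is put in its place. Its claw is
      -- `t - 1 ≥ 4`, hence only the last flag is set.
      obtain ⟨x, y, x', y', hx, hy, hx', hy', hxy, hxy', hc, hc', ha, hb, hcc⟩ :=
        exists_compatible false false true p.2 q.2 p'.2 p'.2 (by simp) (by simp)
          (by simp) (fun e => (hrow h e).1) (fun e => (hq e).2)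
          (fun e => absurd e hlast.2) (fun _ => rfl) (by simp)
      exact ⟨p, q, p', q', .inl ⟨rfl, rfl⟩, .inl
        (hasMatchingThrough_of_joined h h' hp (by omega) hx hy hx' hy' hxy hxy' hc
          ⟨fun e => absurd e hlast.2, hc'.2⟩
          ⟨fun e => absurd e (by omega), fun e => absurd e (by omega)⟩
          ⟨fun e => absurd e (by omega), fun _ => hcc rfl⟩)⟩

/-- Rotation by `t + 1 - i`. The last clause identifies the claw sent to `0` as the predecessor of
claw `i`. -/
theorem exists_rotation_fst {t : ℕ} (ht : 2 ≤ t) (i : Fin t) : ∃ φ : ring t ≃g ring t,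
    (∀ p q, RingRel (φ p) (φ q) ↔ RingRel p q) ∧ (∀ p, (φ p).2 = 3 ↔ p.2 = 3) ∧
      (∀ p, p.1 = i → (φ p).1.val = 1) ∧ ∀ p, (φ p).1.val = 0 → p.1.val + 1 = i.val ∨ p.1.val + 1 = t ∧ i.val = 0 := by
  obtain ⟨φ, h1, hhub, h2⟩ := exists_rotation (t := t) (t + 1 - i.val)
  have hi := i.isLt
  refine ⟨φ, h1, hhub, ?_, fun p hp => ?_⟩
  · rintro p rfl
    rw [h2, show p.1.val + (t + 1 - p.1.val) = 1 + t by omega, Nat.add_mod_right,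
      Nat.mod_eq_of_lt (by omega)]
  · rw [h2] at hp
    have := p.1.isLt
    obtain ⟨k, hk⟩ := Nat.dvd_of_mod_eq_zero hp
    have h3 : k = 1 ∨ k = 2 := by
      have : 0 < k := Nat.pos_of_ne_zero (by rintro rfl; omega)
      have : k < 3 := by
        by_contra h
        have : t * 3 ≤ t * k := Nat.mul_le_mul_left t (by omega)
        omega
      omega
    rcases h3 with rfl | rfl <;> omega

theorem NotGadget.symm {V : Type*} {G : SimpleGraph V} {e f : Sym2 V} (h : NotGadget G e f) :
    NotGadget G f e := by
  obtain ⟨a, b, c, d, he, hn⟩ := h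
  exact ⟨a, b, c, d, he.symm.imp And.symm And.symm, hn⟩

theorem noGadgetPair_ring {t : ℕ} (ht : 5 ≤ t) (hodd : Odd t) : NoGadgetPair (ring t) := by
  have key : ∀ p q p' q', RingRel p q → RingRel p' q' →
      p ≠ p' ∧ p ≠ q' ∧ q ≠ p' ∧ q ≠ q' → NotGadget (ring t) s(p, q) s(p', q') := by
    intro p q p' q' h h' hind
    obtain ⟨φ, h1, -, h2, h3⟩ := exists_rotation_fst (by omega) p.1
    obtain ⟨ψ, h1', -, h2', h3'⟩ := exists_rotation_fst (by omega) p'.1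
    -- If the second edge would start in claw `0`, its claw directly precedes that of the first
    -- edge. The roles are then exchanged, since on a ring of at least five claws two claws cannot
    -- precede each other.
    by_cases h0 : (φ p').1.val = 0
    · refine .symm (.of_iso ψ (notGadget_ring ht hodd ((h1' _ _).2 h') ((h1' _ _).2 h)
        (h2' _ rfl) (Nat.pos_of_ne_zero fun h0' => ?_) ?_))
      · have := h3 _ h0
        have := h3' _ h0'
        omega
      · simp only [ne_eq, ψ.injective.eq_iff]
        exact ⟨hind.1.symm, hind.2.2.1.symm, hind.2.1.symm, hind.2.2.2.symm⟩
    · refine .of_iso φ (notGadget_ring ht hodd ((h1 _ _).2 h) ((h1 _ _).2 h')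
        (h2 _ rfl) (Nat.pos_of_ne_zero h0) ?_)
      simpa only [ne_eq, φ.injective.eq_iff] using hind
  intro a b c d hab hcd ⟨h1, h2, h3, h4⟩
  rcases (ring_adj (by omega)).1 hab with hab | hab <;>
    rcases (ring_adj (by omega)).1 hcd with hcd | hcd
  · exact key _ _ _ _ hab hcd ⟨h1, h2, h3, h4⟩
  · rw [Sym2.eq_swap (a := c)]; exact key _ _ _ _ hab hcd ⟨h2, h1, h4, h3⟩
  · rw [Sym2.eq_swap (a := a)]; exact key _ _ _ _ hab hcd ⟨h3, h4, h1, h2⟩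
  · rw [Sym2.eq_swap (a := a), Sym2.eq_swap (a := c)]
    exact key _ _ _ _ hab hcd ⟨h4, h3, h2, h1⟩

/-! ### Even cycles after the deletion of a leaf -/

/-- The three neighbours of the deleted leaf are pointed at it, and the rest is matched so that no
link between claws `2` and `3` in rows `x` and `y` is used. With the hubs of these claws matched in
row `z`, these two links and the two hubs form a hexagon of unmatched edges. -/
theorem hasEvenDeletion_ring_of_fst_eq_one {t : ℕ} (ht : 5 ≤ t) (hodd : Odd t)
    {v : Fin t × Fin 4} (hv1 : v.1.val = 1) (hv3 : v.2 ≠ 3) : HasEvenDeletion (ring t) v := by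
  obtain ⟨k, x⟩ := v
  dsimp only at hv1 hv3
  obtain ⟨y, hy, hxy⟩ : ∃ y : Fin 4, y ≠ 3 ∧ x ≠ y := by
    revert x; decide
  obtain ⟨z, hz, hzx, hzy, hall⟩ := exists_third_row x y hv3 hy hxy
  rw [Nat.odd_iff] at hodd
  -- Hub `0` takes row `y`, hub `1` points at the deleted leaf, and all other hubs take row `z`. The
  -- link in row `z` joins claws `0` and `1`, the one in row `y` joins claws `1` and `2`; the claws
  -- from `3` on are paired as `3, 4`, …, `t - 2, t - 1`, with `t` odd.
  let r : ℕ → Fin 4 := fun i => if i = 0 then y else if i = 1 then x else z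
  let d : ℕ → Fin 4 → Fin 3 := fun i w =>
    if i = 0 then (if w = y then 0 else 1)
    else if i = 1 then (if w = x then 0 else if w = y then 1 else 2)
    else if w = z then 0 else if i = 2 then 2 else if i % 2 = 1 then 1 else 2
  have hr : ∀ i, r i ≠ 3 := by
    intro i; simp only [r]; split_ifs <;> assumption
  have d1 : ∀ i w, d i w = 1 ↔ i = 0 ∧ w ≠ y ∨ i = 1 ∧ w = y ∨ 3 ≤ i ∧ i % 2 = 1 ∧ w ≠ z := by
    intro i w; simp only [d]; grind
  have d2 : ∀ i w, d i w = 2 ↔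
      i = 1 ∧ w ≠ x ∧ w ≠ y ∨ i = 2 ∧ w ≠ z ∨ 4 ≤ i ∧ i % 2 = 0 ∧ w ≠ z := by
    intro i w; simp only [d]; grind
  have d0 : ∀ i w, d i w = 0 ↔ w = r i := by
    intro i w; simp only [d, r]; grind
  have hup : ∀ u : Fin t × Fin 4, u.2 ≠ 3 → d u.1.val u.2 = 1 → ringPartner r d u = rot u := by
    intro u h3 h; simp [ringPartner, h3, h]
  have hdown : ∀ u : Fin t × Fin 4, u.2 ≠ 3 → d u.1.val u.2 = 2 →
      ringPartner r d u = rot.symm u := by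
    intro u h3 h; simp [ringPartner, h3, h]
  have hhub : ∀ i : Fin t, ringPartner r d (i, 3) = (i, r i.val) := by
    intro i; simp [ringPartner]
  have h2t : 2 < t := by omega
  have h3t : 3 < t := by omega
  have m2 : ∀ w, w ≠ 3 → w ≠ z → (ringPartner r d (⟨2, h2t⟩, w)).1.val = 1 := by
    intro w hw hwz
    rw [hdown _ hw ((d2 _ _).2 (.inr (.inl ⟨rfl, hwz⟩))), rot_symm_fst]
    rfl
  have m3 : ∀ w, w ≠ 3 → w ≠ z → (ringPartner r d (⟨3, h3t⟩, w)).1.val = 4 := by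
    intro w hw hwz
    rw [hup _ hw ((d1 _ _).2 (.inr (.inr ⟨le_rfl, by simp, hwz⟩))), rot_fst]
    exact if_pos ht
  have hne : ∀ {u v : Fin t × Fin 4}, u.1.val ≠ v.1.val → u ≠ v := by
    rintro u _ h rfl; exact h rfl
  have e2 : ∀ w, w ≠ 3 → w ≠ z → (unmatched (ring t) (ringPartner r d)).Adj
      (⟨2, h2t⟩, 3) (⟨2, h2t⟩, w) := fun w hw hwz =>
    ⟨ring_adj_hub (by omega) hw, by rw [hhub]; simpa [r] using hwz.symm,
      hne (by rw [m2 w hw hwz]; simp)⟩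
  have e3 : ∀ w, w ≠ 3 → w ≠ z → (unmatched (ring t) (ringPartner r d)).Adj
      (⟨3, h3t⟩, 3) (⟨3, h3t⟩, w) := fun w hw hwz =>
    ⟨ring_adj_hub (by omega) hw, by rw [hhub]; simpa [r] using hwz.symm,
      hne (by rw [m3 w hw hwz]; simp)⟩
  have e23 : ∀ w, w ≠ 3 → w ≠ z → (unmatched (ring t) (ringPartner r d)).Adj
      (⟨2, h2t⟩, w) (⟨3, h3t⟩, w) := fun w hw hwz =>
    ⟨(ring_adj (by omega)).2 (.inl (.inr ⟨hw, .inl ⟨rfl, rfl⟩⟩)),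
      hne (by rw [m2 w hw hwz]; simp), hne (by rw [m3 w hw hwz]; simp)⟩
  refine ⟨ringPartner r d, [(⟨2, by omega⟩, 3), (⟨2, by omega⟩, y), (⟨3, by omega⟩, y),
    (⟨3, by omega⟩, 3), (⟨3, by omega⟩, x), (⟨2, by omega⟩, x)], _, _,
    fun v _ => ring_adj_ringPartner (by omega) hr d v, fun u hu hmu => ?_, fun u hu => ?_,
    rfl, rfl, ?_, ?_, ?_, by simp, ⟨3, rfl⟩, ?_⟩
  · have hult := u.1.isLt
    apply ringPartner_ringPartner hr
    · exact fun _ => (d0 _ _).2 rfl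
    · exact fun _ h => ((d0 _ _).1 h).symm
    · intro h3 h
      rw [hup u h3 h] at hmu
      have h' := (d1 _ _).1 h
      rw [d2, rot_snd, rot_fst, if_pos (by omega), if_pos (by omega)]
      rcases h' with ⟨h1, h2⟩ | ⟨h1, h2⟩ | ⟨h1, h2, h4⟩
      · refine .inl ⟨by omega, fun e => hmu ?_, h2⟩
        rw [Prod.ext_iff, Fin.ext_iff, rot_fst, rot_snd, if_pos (by omega), if_pos (by omega)]
        exact ⟨by dsimp only; omega, e⟩
      · exact .inr (.inl ⟨by omega, h2 ▸ hzy.symm⟩)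
      · exact .inr (.inr ⟨by omega, by omega, h4⟩)
    · intro h3 h
      rw [hdown u h3 h] at hmu
      have h' := (d2 _ _).1 h
      rw [d1, rot_symm_snd, rot_symm_fst, if_neg (by omega), if_neg (by omega)]
      rcases h' with ⟨h1, h2, h4⟩ | ⟨h1, h2⟩ | ⟨h1, h2, h4⟩
      · exact .inl ⟨by omega, h4⟩
      · refine .inr (.inl ⟨by omega, ?_⟩)
        rcases hall u.2 with e | e | e | e
        · refine absurd ?_ hmu
          rw [Prod.ext_iff, Fin.ext_iff, rot_symm_fst, rot_symm_snd, if_neg (by omega),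
            if_neg (by omega)]
          exact ⟨by dsimp only; omega, e⟩
        · exact e
        · exact absurd e h2
        · exact absurd e h3
      · exact .inr (.inr ⟨by omega, by omega, h4⟩)
  · rcases (ring_adj (by omega)).1 hu with h | h
    · rcases ringRel_iff.1 h with ⟨h1, h2, -⟩ | ⟨h1, h2⟩
      · obtain ⟨i, w⟩ := u
        dsimp only at h1 h2
        subst h1 h2
        rw [hhub]
        simp [r, hv1]
      · rw [h2]
        have e := h2
        rw [Prod.ext_iff, Fin.ext_iff, rot_fst, rot_snd] at e
        dsimp only at e
        split_ifs at e with h3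
        · refine hup u h1 ((d1 _ _).2 (.inl ⟨by omega, ?_⟩))
          rw [← e.2]; exact hxy
        · omega
    · rcases ringRel_iff.1 h with ⟨-, h2, -⟩ | ⟨-, h2⟩
      · exact absurd h2 hv3
      · have e := h2
        rw [Prod.ext_iff, Fin.ext_iff, rot_fst, rot_snd] at e
        dsimp only at e
        rw [if_pos (by omega), if_pos (by omega)] at e
        rw [hdown u (by rw [e.2]; exact hv3)
          ((d2 _ _).2 (.inr (.inl ⟨by omega, by rw [e.2]; exact hzx.symm⟩))), h2,
          Equiv.symm_apply_apply]
  · exact (e2 x hv3 hzx.symm).symm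
  · simp only [List.isChain_cons_cons, List.isChain_singleton, and_true]
    exact ⟨e2 y hy hzy.symm, e23 y hy hzy.symm, (e3 y hy hzy.symm).symm, e3 x hv3 hzx.symm,
      (e23 x hv3 hzx.symm).symm⟩
  · simp [hv3.symm, hy, hxy.symm, hy.symm]
  · simp [Fin.ext_iff, hv1]

theorem hasEvenDeletion_ring {t : ℕ} (ht : 5 ≤ t) (hodd : Odd t) {v : Fin t × Fin 4}
    (hv : v.2 ≠ 3) : HasEvenDeletion (ring t) v := by
  obtain ⟨φ, -, hhub, h, -⟩ := exists_rotation_fst (by omega) v.1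
  exact .of_iso φ (hasEvenDeletion_ring_of_fst_eq_one ht hodd (h v rfl) ((hhub v).not.2 hv))

/-! ### Lower bounds for the cyclic edge-connectivity -/

/-- The edges of `G` with exactly one end in `A`. -/
def crossing {V : Type*} (G : SimpleGraph V) (A : Set V) : Set (Sym2 V) :=
  {e | ∃ v w, v ∈ A ∧ w ∉ A ∧ G.Adj v w ∧ e = s(v, w)}

theorem mem_crossing {V : Type*} {G : SimpleGraph V} {A : Set V} {v w : V} (h : G.Adj v w)
    (hvw : ¬ (v ∈ A ↔ w ∈ A)) : s(v, w) ∈ crossing G A := by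
  by_cases hv : v ∈ A
  · exact ⟨v, w, hv, by tauto, h, rfl⟩
  · exact ⟨w, v, by tauto, hv, h.symm, Sym2.eq_swap⟩

theorem crossing_compl {V : Type*} (G : SimpleGraph V) (A : Set V) :
    crossing G Aᶜ = crossing G A := by
  ext e
  constructor
  · rintro ⟨v, w, hv, hw, h, rfl⟩
    exact mem_crossing h (by simp only [Set.mem_compl_iff] at hv hw; tauto)
  · rintro ⟨v, w, hv, hw, h, rfl⟩
    exact mem_crossing h (by simp only [Set.mem_compl_iff]; tauto)

/-- `A` contains the vertices of a subgraph of minimum degree at least two. -/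
def HasCore {V : Type*} (G : SimpleGraph V) (A : Set V) : Prop :=
  ∃ C ⊆ A, C.Nonempty ∧ ∀ v ∈ C, ∃ w₁ ∈ C, ∃ w₂ ∈ C, w₁ ≠ w₂ ∧ G.Adj v w₁ ∧ G.Adj v w₂

theorem HasCore.preimage {V W : Type*} {G : SimpleGraph V} {H : SimpleGraph W} (φ : G ≃g H)
    {A : Set V} (h : HasCore G A) : HasCore H (φ.symm ⁻¹' A) := by
  obtain ⟨C, hCA, ⟨v, hv⟩, hC⟩ := h
  refine ⟨φ.symm ⁻¹' C, Set.preimage_mono hCA, ⟨φ v, by simpa⟩, fun w hw => ?_⟩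
  obtain ⟨w₁, h₁, w₂, h₂, hne, ha₁, ha₂⟩ := hC _ hw
  refine ⟨φ w₁, by simpa, φ w₂, by simpa, φ.injective.ne hne, ?_, ?_⟩
  · rw [← φ.map_adj_iff, φ.apply_symm_apply] at ha₁; exact ha₁
  · rw [← φ.map_adj_iff, φ.apply_symm_apply] at ha₂; exact ha₂

theorem encard_crossing_preimage_le {V W : Type*} {G : SimpleGraph V} {H : SimpleGraph W}
    (φ : G ≃g H) (A : Set V) : (crossing H (φ.symm ⁻¹' A)).encard ≤ (crossing G A).encard := by
  rw [← (Sym2.map.injective φ.symm.injective).encard_image]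
  apply Set.encard_le_encard
  rintro _ ⟨_, ⟨v, w, hv, hw, h, rfl⟩, rfl⟩
  exact ⟨_, _, hv, hw, φ.symm.map_adj_iff.2 h, by simp⟩

/-- Every edge cut of `G` between two subgraphs of minimum degree at least two has at least five
edges. -/
def FiveLeCuts {V : Type*} (G : SimpleGraph V) : Prop :=
  ∀ A : Set V, HasCore G A → HasCore G Aᶜ → 5 ≤ (crossing G A).encard

theorem FiveLeCuts.of_iso {V W : Type*} {G : SimpleGraph V} {H : SimpleGraph W} (φ : G ≃g H)
    (hH : FiveLeCuts H) : FiveLeCuts G := by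
  intro A h₁ h₂
  exact (hH _ (h₁.preimage φ) (h₂.preimage φ)).trans (encard_crossing_preimage_le φ A)

/-- Each vertex of a cycle has two neighbours on it. Passing to vertex sets of minimum degree two
removes walks from all the cut estimates. -/
theorem hasCore_of_isCycle {V : Type*} {G H : SimpleGraph V} (hHG : H ≤ G) {A : Set V} {u : V}
    {p : H.Walk u u} (hp : p.IsCycle) (hA : ∀ v ∈ p.support, v ∈ A) : HasCore G A := by
  refine ⟨{v | v ∈ p.support}, hA, ⟨u, p.start_mem_support⟩, fun v hv => ?_⟩
  have h2 := hp.ncard_neighborSet_toSubgraph_eq_two hv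
  obtain ⟨w₁, w₂, hne, he⟩ := Set.ncard_eq_two.1 h2
  have key : ∀ w ∈ p.toSubgraph.neighborSet v, w ∈ p.support ∧ G.Adj v w := fun w hw =>
    ⟨p.mem_verts_toSubgraph.1 hw.snd_mem, hHG hw.adj_sub⟩
  have k₁ := key w₁ (by rw [he]; simp)
  have k₂ := key w₂ (by rw [he]; simp)
  exact ⟨w₁, k₁.1, w₂, k₂.1, hne, k₁.2, k₂.2⟩

/-- Take for `A` the component of one of the separated cycles in `G - S`: every edge leaving `A`
belongs to `S`. -/
theorem FiveLeCuts.five_le_cyclicEdgeConnectivity {V : Type*} {G : SimpleGraph V}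
    (hG : FiveLeCuts G) : 5 ≤ cyclicEdgeConnectivity G := by
  refine le_iInf₂ fun S ⟨hS, u, v, p, q, hp, hq, hne⟩ => ?_
  let A : Set V := {w | (G.deleteEdges S).Reachable u w}
  have hle : G.deleteEdges S ≤ G := deleteEdges_le S
  refine (hG A (hasCore_of_isCycle hle hp fun w hw => ?_)
    (hasCore_of_isCycle hle hq fun w hw h => ?_)).trans (Set.encard_le_encard ?_)
  · classical exact ⟨p.takeUntil w hw⟩
  · classical exact hne (h.trans ⟨(q.takeUntil w hw).reverse⟩)
  · rintro _ ⟨w, x, hw, hx, hadj, rfl⟩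
    by_contra hS'
    exact hx (hw.trans (Adj.reachable (deleteEdges_adj.2 ⟨hadj, hS'⟩)))

theorem length_le_encard {α : Type*} {s : Set α} {l : List α} (hl : l.Nodup)
    (h : ∀ a ∈ l, a ∈ s) : (l.length : ℕ∞) ≤ s.encard := by
  classical
  rw [← List.toFinset_card_of_nodup hl, ← Set.encard_coe_eq_coe_finsetCard]
  exact Set.encard_le_encard fun a ha => h a (by simpa using ha)

/-! ### Cuts of flower snarks -/

theorem rot_rot_ne {t : ℕ} (ht : 3 ≤ t) (v : Fin t × Fin 4) : rot (rot v) ≠ v := by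
  intro h
  have := congrArg (fun v => v.1.val) h
  have hv := v.1.isLt
  simp only [rot_fst] at this
  split_ifs at this <;> omega

theorem link_eq_link {t : ℕ} (ht : 3 ≤ t) {v w : Fin t × Fin 4} :
    s(v, rot v) = s(w, rot w) ↔ v = w := by
  refine ⟨fun h => ?_, fun h => by rw [h]⟩
  rcases Sym2.eq_iff.1 h with h | ⟨h1, h2⟩
  · exact h.1
  · rw [h1] at h2; exact absurd h2 (rot_rot_ne ht w)

/-- The core outside `A` contains a hub and two of its leaves, in rows `x` and `y`. Followed from
there in either direction, each of these rows reaches claw `0`, which lies in `A`, so it is cut once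
on each side: four links. The third leaf gives a fifth edge. If it lies in `A`, its hub edge is cut;
otherwise its own row is cut as well. -/
theorem five_le_encard_crossing_ring {t : ℕ} (ht : 5 ≤ t) {A : Set (Fin t × Fin 4)}
    (h0 : ∀ v : Fin t × Fin 4, v.1.val = 0 → v ∈ A) (hcore : HasCore (ring t) Aᶜ) :
    5 ≤ (crossing (ring t) A).encard := by
  obtain ⟨C, hCA, ⟨v₀, hv₀⟩, hC⟩ := hcore
  obtain ⟨i, x, y, hx, hy, hxy, hiC, hxC, hyC⟩ : ∃ (i : Fin t) (x y : Fin 4), x ≠ 3 ∧ y ≠ 3 ∧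
      x ≠ y ∧ (i, 3) ∈ C ∧ (i, x) ∈ C ∧ (i, y) ∈ C := by
    have hhub : ∀ i : Fin t, (i, 3) ∈ C → ∃ (i : Fin t) (x y : Fin 4), x ≠ 3 ∧ y ≠ 3 ∧
        x ≠ y ∧ (i, 3) ∈ C ∧ (i, x) ∈ C ∧ (i, y) ∈ C := by
      intro i hi
      have hn : ∀ w, (ring t).Adj (i, 3) w → w.2 ≠ 3 ∧ w = (i, w.2) := by
        intro w hw
        rcases (ring_adj (by omega)).1 hw with h | h
        · rcases ringRel_iff.1 h with h | h
          · exact ⟨h.2.2, Prod.ext h.1.symm rfl⟩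
          · exact absurd rfl h.1
        · rcases ringRel_iff.1 h with h | h
          · exact absurd rfl h.2.2
          · have := (rot_snd_eq_three w).1 (by rw [← h.2])
            exact absurd this h.1
      obtain ⟨w₁, h₁, w₂, h₂, hne, ha₁, ha₂⟩ := hC _ hi
      obtain ⟨k₁, e₁⟩ := hn _ ha₁
      obtain ⟨k₂, e₂⟩ := hn _ ha₂
      refine ⟨i, w₁.2, w₂.2, k₁, k₂, fun e => hne ?_, hi, e₁ ▸ h₁, e₂ ▸ h₂⟩
      rw [e₁, e₂, e]
    -- A leaf of the core in a claw of least index has no earlier neighbour in the core. Having two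
    -- neighbours there, it is joined to its hub.
    obtain ⟨v, hv, hmin⟩ := (measure fun v : Fin t × Fin 4 => v.1.val).wf.has_min C ⟨v₀, hv₀⟩
    by_cases h3 : v.2 = 3
    · exact hhub v.1 (by rw [← h3]; exact hv)
    · have hn : ∀ w ∈ C, (ring t).Adj v w → w = (v.1, 3) ∨ w = rot v := by
        intro w hw hvw
        rcases (ring_adj (by omega)).1 hvw with h | h
        · rcases ringRel_iff.1 h with h | h
          · exact absurd h.2.1 h3
          · exact .inr h.2
        · rcases ringRel_iff.1 h with h | h
          · exact .inl (Prod.ext h.1 h.2.1)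
          · refine absurd ?_ (hmin w hw)
            have hv0 : v.1.val ≠ 0 := fun h => hCA hv (h0 v h)
            have e := congrArg (fun v => v.1.val) h.2
            simp only [rot_fst] at e
            change w.1.val < v.1.val
            split_ifs at e <;> omega
      obtain ⟨w₁, h₁, w₂, h₂, hne, ha₁, ha₂⟩ := hC _ hv
      rcases hn _ h₁ ha₁ with e₁ | e₁
      · exact hhub v.1 (e₁ ▸ h₁)
      · rcases hn _ h₂ ha₂ with e₂ | e₂
        · exact hhub v.1 (e₂ ▸ h₂)
        · exact absurd (e₁.trans e₂.symm) hne
  have hi0 : i.val ≠ 0 := fun h => hCA hiC (h0 _ h)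
  have hleft : ∀ x, x ≠ 3 → (i, x) ∉ A →
      ∃ k : Fin t, k.val < i.val ∧ s((k, x), rot (k, x)) ∈ crossing (ring t) A := by
    intro x hx hxA
    by_contra! hcon
    have : ∀ n (h : n < t), n ≤ i.val → ((⟨n, h⟩, x) : Fin t × Fin 4) ∈ A := by
      intro n
      induction n with
      | zero => exact fun h _ => h0 _ rfl
      | succ n ih =>
        intro h hn
        by_contra hA
        refine hcon ⟨n, by omega⟩ hn (mem_crossing (ring_adj_rot (by omega) hx) fun hiff => hA ?_)
        have := hiff.1 (ih (by omega) (by omega))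
        convert this using 1
        rw [Prod.ext_iff, Fin.ext_iff, rot_fst, rot_snd, if_pos h, if_pos h]
        exact ⟨rfl, rfl⟩
    exact hxA (this i.val i.isLt le_rfl)
  have hright : ∀ x, x ≠ 3 → (i, x) ∉ A →
      ∃ k : Fin t, i.val ≤ k.val ∧ s((k, x), rot (k, x)) ∈ crossing (ring t) A := by
    intro x hx hxA
    by_contra! hcon
    have : ∀ n, i.val ≤ n → ∀ h : n < t, ((⟨n, h⟩, x) : Fin t × Fin 4) ∉ A := by
      intro n hn
      induction n, hn using Nat.le_induction with
      | base => exact fun _ => hxA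
      | succ n hn ih =>
        intro h hA
        refine hcon ⟨n, by omega⟩ hn (mem_crossing (ring_adj_rot (by omega) hx) fun hiff =>
          ih (by omega) (hiff.2 ?_))
        convert hA using 1
        rw [Prod.ext_iff, Fin.ext_iff, rot_fst, rot_snd, if_pos h, if_pos h]
        exact ⟨rfl, rfl⟩
    -- If row `x` avoids `A` up to claw `t - 1`, the link across the seam is cut. The twist does no
    -- harm, since all of claw `0` lies in `A`.
    refine hcon ⟨t - 1, by omega⟩ (by have := i.isLt; dsimp only; omega)
      (mem_crossing (ring_adj_rot (by omega) hx) fun hiff =>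
        this (t - 1) (by have := i.isLt; omega) (by omega) (hiff.2 (h0 _ ?_)))
    rw [rot_fst, if_neg (by dsimp only; omega)]
  obtain ⟨k₁, hk₁, c₁⟩ := hleft x hx (hCA hxC)
  obtain ⟨k₂, hk₂, c₂⟩ := hright x hx (hCA hxC)
  obtain ⟨k₃, hk₃, c₃⟩ := hleft y hy (hCA hyC)
  obtain ⟨k₄, hk₄, c₄⟩ := hright y hy (hCA hyC)
  obtain ⟨z, hz, hzx, hzy, -⟩ := exists_third_row x y hx hy hxy
  have h12 : k₁ ≠ k₂ := by rintro rfl; omega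
  have h34 : k₃ ≠ k₄ := by rintro rfl; omega
  have hl := fun v w : Fin t × Fin 4 => link_eq_link (t := t) (v := v) (w := w) (by omega)
  by_cases hzA : (i, z) ∈ A
  · have hstar : ∀ (k : Fin t) w, w ≠ 3 → s((k, w), rot (k, w)) ≠ s((i, 3), (i, z)) := by
      intro k w hv h
      rcases Sym2.eq_iff.1 h with h | h
      · exact hv (congrArg Prod.snd h.1)
      · exact hv ((rot_snd_eq_three (k, w)).1 (congrArg Prod.snd h.2))
    refine length_le_encard (l := [s((k₁, x), rot (k₁, x)), s((k₂, x), rot (k₂, x)),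
      s((k₃, y), rot (k₃, y)), s((k₄, y), rot (k₄, y)), s((i, 3), (i, z))]) ?_ ?_
    · simp only [List.nodup_cons, List.mem_cons, hl, hstar _ _ hx, hstar _ _ hy, Prod.mk.injEq]
      simp [h12, h34, hxy]
    · have := mem_crossing (A := A) (ring_adj_hub (by omega) hz : (ring t).Adj (i, 3) (i, z))
        (fun h => hCA hiC (h.2 hzA))
      simp only [List.mem_cons, List.not_mem_nil, or_false]
      rintro _ (rfl | rfl | rfl | rfl | rfl) <;> assumption
  · obtain ⟨k₅, -, c₅⟩ := hleft z hz hzA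
    refine length_le_encard (l := [s((k₁, x), rot (k₁, x)), s((k₂, x), rot (k₂, x)),
      s((k₃, y), rot (k₃, y)), s((k₄, y), rot (k₄, y)), s((k₅, z), rot (k₅, z))]) ?_ ?_
    · simp only [List.nodup_cons, List.mem_cons, hl, Prod.mk.injEq]
      simp [h12, h34, hxy, hzx.symm, hzy.symm]
    · simp only [List.mem_cons, List.not_mem_nil, or_false]
      rintro _ (rfl | rfl | rfl | rfl | rfl) <;> assumption

/-- If one side contains a whole claw, it is rotated to claw `0` and the previous bound applies.
Otherwise every claw meets both sides, and each of the `t ≥ 5` claws contributes a hub edge. -/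
theorem fiveLeCuts_ring {t : ℕ} (ht : 5 ≤ t) : FiveLeCuts (ring t) := by
  have key : ∀ (A : Set (Fin t × Fin 4)) (i : Fin t), (∀ x, (i, x) ∈ A) →
      HasCore (ring t) Aᶜ → 5 ≤ (crossing (ring t) A).encard := by
    intro A i hi hcore
    obtain ⟨φ, -, -, hφ⟩ := exists_rotation (t := t) (t - i.val)
    refine (five_le_encard_crossing_ring ht (fun v hv => ?_) (hcore.preimage φ)).trans
      (encard_crossing_preimage_le φ A)
    have h := hφ (φ.symm v)
    rw [φ.apply_symm_apply, hv] at h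
    have hlt := (φ.symm v).1.isLt
    have hilt := i.isLt
    have h' : (φ.symm v).1.val = i.val := by
      obtain ⟨k, hk⟩ := Nat.dvd_of_mod_eq_zero h.symm
      have : k = 1 := by
        have : 0 < k := Nat.pos_of_ne_zero (by rintro rfl; omega)
        have : k < 2 := by
          by_contra h
          have : t * 2 ≤ t * k := Nat.mul_le_mul_left t (by omega)
          omega
        omega
      subst this
      omega
    have := hi (φ.symm v).2
    rwa [← Fin.ext h'] at this
  intro A h₁ h₂
  by_cases hA : ∃ i : Fin t, ∀ x, (i, x) ∈ A
  · obtain ⟨i, hi⟩ := hA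
    exact key A i hi h₂
  by_cases hA' : ∃ i : Fin t, ∀ x, (i, x) ∉ A
  · obtain ⟨i, hi⟩ := hA'
    rw [← crossing_compl]
    exact key Aᶜ i hi (by rwa [compl_compl])
  push Not at hA hA'
  have hstar : ∀ i : Fin t, ∃ x, x ≠ 3 ∧ s((i, 3), (i, x)) ∈ crossing (ring t) A := by
    intro i
    obtain ⟨x, hx, hmix⟩ : ∃ x, x ≠ 3 ∧ ¬ ((i, 3) ∈ A ↔ (i, x) ∈ A) := by
      by_contra! hcon
      obtain ⟨x, hx⟩ := hA i
      obtain ⟨y, hy⟩ := hA' i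
      by_cases h3 : (i, (3 : Fin 4)) ∈ A
      · refine hx ((hcon x ?_).1 h3)
        rintro rfl; exact hx h3
      · refine h3 ((hcon y ?_).2 hy)
        rintro rfl; exact h3 hy
    exact ⟨x, hx, mem_crossing (ring_adj_hub (by omega) hx) hmix⟩
  choose f hf hcross using hstar
  have hinj : Function.Injective fun i => s((i, (3 : Fin 4)), (i, f i)) := by
    intro i j h
    rcases Sym2.eq_iff.1 h with h | h
    · exact congrArg Prod.fst h.1
    · exact congrArg Prod.fst h.1
  have := length_le_encard ((List.nodup_finRange t).map hinj) (s := crossing (ring t) A)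
    (by simpa using hcross)
  rw [List.length_map, List.length_finRange] at this
  exact le_trans (by exact_mod_cast ht) this

/-! ### Cuts of the Petersen graph -/

instance (n : ℕ) (l : List (ℕ × ℕ)) : DecidableRel (graphOfEdges n l).Adj := fun i j =>
  inferInstanceAs (Decidable (i ≠ j ∧
    ((i.val + 1, j.val + 1) ∈ l ∨ (j.val + 1, i.val + 1) ∈ l)))

/-- The adjacency matrix of the Petersen graph, as a binary number. -/
def petersenBits : ℕ := 257617904308990774908043727922

/-- Reading adjacency off one bit of a numeral keeps the later exhaustive checks cheap; the same
device serves the larger graphs. -/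
theorem petersen_adj_iff (i j : Fin 10) :
    petersen.Adj i j ↔ petersenBits.testBit (10 * i.val + j.val) = true := by
  revert i j
  unfold petersen
  decide +kernel

instance : DecidableRel petersen.Adj := fun i j => decidable_of_iff _ (petersen_adj_iff i j).symm

/-- Minimum degree two forces a cycle, and the girth is five. -/
theorem five_le_card_of_core_petersen : ∀ C : Finset (Fin 10), C.Nonempty →
    (∀ v ∈ C, 2 ≤ (C.filter fun w => petersen.Adj v w).card) → 5 ≤ C.card := by
  decide +kernel

/-- Five vertices have degree sum `15` and, by the girth, span at most five edges; so at least `15 -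
10` edges leave. -/
theorem five_le_card_crossing_petersen : ∀ A : Finset (Fin 10), A.card = 5 →
    5 ≤ ((A ×ˢ Aᶜ).filter fun e => petersen.Adj e.1 e.2).card := by
  decide +kernel

/-- Both sides of such a cut have at least five of the ten vertices, hence exactly five. -/
theorem fiveLeCuts_petersen : FiveLeCuts petersen := by
  classical
  have hcard : ∀ A : Set (Fin 10), HasCore petersen A → 5 ≤ A.toFinset.card := by
    rintro A ⟨C, hCA, hne, hC⟩
    refine (five_le_card_of_core_petersen C.toFinset (by simpa) fun v hv => ?_).trans
      (Finset.card_le_card (Set.toFinset_mono hCA))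
    obtain ⟨w₁, h₁, w₂, h₂, hne, ha₁, ha₂⟩ := hC v (by simpa using hv)
    rw [← Finset.card_pair hne]
    refine Finset.card_le_card ?_
    intro w hw
    simp only [Finset.mem_insert, Finset.mem_singleton] at hw
    rcases hw with rfl | rfl <;> simp [*]
  intro A h₁ h₂
  have c₁ := hcard _ h₁
  have c₂ := hcard _ h₂
  rw [Set.toFinset_compl, Finset.card_compl, Fintype.card_fin] at c₂
  have h5 := five_le_card_crossing_petersen A.toFinset (by omega)
  have himg : ((fun e : Fin 10 × Fin 10 => s(e.1, e.2)) '' {e | e.1 ∈ A ∧ e.2 ∉ A ∧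
      petersen.Adj e.1 e.2}) ⊆ crossing petersen A := by
    rintro _ ⟨e, ⟨h1, h2, h3⟩, rfl⟩
    exact ⟨_, _, h1, h2, h3, rfl⟩
  refine le_trans ?_ (Set.encard_le_encard himg)
  rw [Set.InjOn.encard_image]
  · refine le_trans (b := ((((A.toFinset ×ˢ A.toFinsetᶜ).filter
      fun e => petersen.Adj e.1 e.2 : Finset _) : Set (Fin 10 × Fin 10)).encard)) ?_
      (Set.encard_le_encard ?_)
    · rw [Set.encard_coe_eq_coe_finsetCard]; exact_mod_cast h5
    · intro e he
      simpa [and_assoc] using he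
  · rintro e ⟨h1, h2, -⟩ f ⟨-, hf, -⟩ h
    rcases Sym2.eq_iff.1 h with h | h
    · exact Prod.ext h.1 h.2
    · rw [h.1] at h1; exact absurd h1 hf

/-! ### Dot products of isomorphic snarks -/

theorem snarkDotProduct_adj {V W : Type u} {L : SimpleGraph V} {x y r s t u : V}
    {R : SimpleGraph W} {a b c d : W} (p q : {v : V // v ≠ x ∧ v ≠ y} ⊕ W) :
    (snarkDotProduct L x y r s t u R a b c d).Adj p q ↔
      match p, q with
      | .inl v, .inl v' => L.Adj v v'
      | .inr w, .inr w' => R.Adj w w' ∧ s(w, w') ≠ s(a, b) ∧ s(w, w') ≠ s(c, d)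
      | .inl v, .inr w =>
          (v.1 = r ∧ w = a) ∨ (v.1 = s ∧ w = b) ∨ (v.1 = t ∧ w = c) ∨ (v.1 = u ∧ w = d)
      | .inr w, .inl v =>
          (v.1 = r ∧ w = a) ∨ (v.1 = s ∧ w = b) ∨ (v.1 = t ∧ w = c) ∨ (v.1 = u ∧ w = d) := by
  rw [snarkDotProduct, fromRel_adj]
  rcases p with v | w <;> rcases q with v' | w'
  · simp only [ne_eq, Sum.inl.injEq, L.adj_comm v'.1 v.1, or_self]
    exact ⟨fun h => h.2, fun h => ⟨fun e => h.ne (congrArg _ e), h⟩⟩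
  · simp
  · simp
  · simp only [ne_eq, Sum.inr.injEq, R.adj_comm w' w, Sym2.eq_swap (a := w') (b := w), or_self]
    exact ⟨fun h => h.2, fun h => ⟨h.1.ne, h⟩⟩

/-- The dot products of isomorphic snarks are isomorphic. -/
def snarkDotProductIso.{v} {V W : Type u} {V' W' : Type v} {L : SimpleGraph V} {L' : SimpleGraph V'}
    {R : SimpleGraph W} {R' : SimpleGraph W'} (φ : L ≃g L') (ψ : R ≃g R') (x y r s t u : V)
    (a b c d : W) : snarkDotProduct L x y r s t u R a b c d ≃g
      snarkDotProduct L' (φ x) (φ y) (φ r) (φ s) (φ t) (φ u) R' (ψ a) (ψ b) (ψ c) (ψ d) where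
  toEquiv := Equiv.sumCongr (φ.toEquiv.subtypeEquiv fun v => by simp) ψ.toEquiv
  map_rel_iff' := by
    have h : ∀ a b c d : W, s(ψ a, ψ b) = s(ψ c, ψ d) ↔ s(a, b) = s(c, d) := by simp
    rintro (v | w) (v' | w') <;> rw [snarkDotProduct_adj, snarkDotProduct_adj] <;>
      simp [h, φ.map_adj_iff, ψ.map_adj_iff]

/-! ### Unmatchable pairs and dot products with the Petersen graph -/

theorem HasMatchingThrough.swap_left {V : Type*} {G : SimpleGraph V} {a b c d : V}
    (h : HasMatchingThrough G a b c d) : HasMatchingThrough G b a c d := by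
  obtain ⟨m, hadj, hinv, rfl, rfl⟩ := h
  exact ⟨m, hadj, hinv, hinv a, rfl⟩

theorem HasMatchingThrough.swap {V : Type*} {G : SimpleGraph V} {a b c d : V}
    (h : HasMatchingThrough G a b c d) : HasMatchingThrough G c d a b := by
  obtain ⟨m, hadj, hinv, h1, h2⟩ := h
  exact ⟨m, hadj, hinv, h2, h1⟩

/-- The edges `ab` and `cd` are independent and no perfect matching contains both. -/
def IsUnmatchablePair {V : Type*} (G : SimpleGraph V) (a b c d : V) : Prop :=
  G.Adj a b ∧ G.Adj c d ∧ (a ≠ c ∧ a ≠ d ∧ b ≠ c ∧ b ≠ d) ∧ ¬ HasMatchingThrough G a b c d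

theorem IsUnmatchablePair.swap_left {V : Type*} {G : SimpleGraph V} {a b c d : V}
    (h : IsUnmatchablePair G a b c d) : IsUnmatchablePair G b a c d :=
  ⟨h.1.symm, h.2.1, ⟨h.2.2.1.2.2.1, h.2.2.1.2.2.2, h.2.2.1.1, h.2.2.1.2.1⟩,
    fun h' => h.2.2.2 h'.swap_left⟩

theorem IsUnmatchablePair.swap {V : Type*} {G : SimpleGraph V} {a b c d : V}
    (h : IsUnmatchablePair G a b c d) : IsUnmatchablePair G c d a b :=
  ⟨h.2.1, h.1, ⟨h.2.2.1.1.symm, h.2.2.1.2.2.1.symm, h.2.2.1.2.1.symm, h.2.2.1.2.2.2.symm⟩,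
    fun h' => h.2.2.2 h'.swap⟩

/-- In the Petersen graph this consequence of being a gadget-pair already determines the pair up to
symmetry. -/
theorem IsGadgetPair.isUnmatchablePair {V W : Type*} {G : SimpleGraph V} {H : SimpleGraph W}
    (φ : G ≃g H) (hG : IsCubic G) {a b c d : V} (h : IsGadgetPair G a b c d) :
    IsUnmatchablePair H (φ a) (φ b) (φ c) (φ d) := by
  refine ⟨φ.map_adj_iff.2 h.adj_left, φ.map_adj_iff.2 h.adj_right, ?_, fun h' => ?_⟩
  · simpa only [ne_eq, φ.injective.eq_iff] using h.independent
  · have := h'.of_iso φ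
    simp only [φ.symm_apply_apply] at this
    exact h.not_hasMatchingThrough hG this

/-- Every dot product of `L` at `xy` with the Petersen graph at an unmatchable pair, with `r`,
`s`, `t` and `u` used in this order, is isomorphic to `H`. -/
def PetersenDotsIso {V : Type} {X : Type*} (L : SimpleGraph V) (H : SimpleGraph X)
    (x y r s t u : V) : Prop :=
  ∀ a b c d, IsUnmatchablePair petersen a b c d →
    Nonempty (snarkDotProduct L x y r s t u petersen a b c d ≃g H)

theorem PetersenDotsIso.swap_left {V : Type} {X : Type*} {L : SimpleGraph V} {H : SimpleGraph X}
    {x y r s t u : V} (h : PetersenDotsIso L H x y r s t u) :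
    PetersenDotsIso L H x y s r t u := by
  intro a b c d hg
  obtain ⟨e⟩ := h b a c d hg.swap_left
  have : snarkDotProduct L x y s r t u petersen a b c d =
      snarkDotProduct L x y r s t u petersen b a c d := by
    ext p q
    rw [snarkDotProduct_adj, snarkDotProduct_adj]
    rcases p with v | w <;> rcases q with v' | w' <;>
      simp only [Sym2.eq_swap (a := a) (b := b)] <;> tauto
  exact ⟨this ▸ e⟩

/-- Exchanging `x` with `y` is compensated by exchanging the edges `ab` and `cd`, and the quantifier
over all unmatchable pairs is symmetric in these edges. -/
theorem PetersenDotsIso.swap {V : Type} {X : Type*} {L : SimpleGraph V} {H : SimpleGraph X}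
    {x y r s t u : V} (h : PetersenDotsIso L H x y r s t u) :
    PetersenDotsIso L H y x t u r s := by
  intro a b c d hg
  obtain ⟨e⟩ := h c d a b hg.swap
  refine ⟨RelIso.trans ⟨Equiv.sumCongr (Equiv.subtypeEquivRight fun v => and_comm)
    (Equiv.refl (Fin 10)), ?_⟩ e⟩
  rintro (v | w) (v' | w') <;> rw [snarkDotProduct_adj, snarkDotProduct_adj] <;> simp <;> tauto

theorem PetersenDotsIso.swap_right {V : Type} {X : Type*} {L : SimpleGraph V}
    {H : SimpleGraph X} {x y r s t u : V} (h : PetersenDotsIso L H x y r s t u) :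
    PetersenDotsIso L H x y r s u t :=
  h.swap.swap_left.swap

/-- The construction knows the remaining neighbours of `x` and `y` only as unordered pairs. -/
theorem PetersenDotsIso.of_pair_eq {V : Type} {X : Type*} {L : SimpleGraph V}
    {H : SimpleGraph X} {x y r s t u r' s' t' u' : V} (h : PetersenDotsIso L H x y r s t u)
    (hr : ({r', s'} : Set V) = {r, s}) (ht : ({t', u'} : Set V) = {t, u}) :
    PetersenDotsIso L H x y r' s' t' u' := by
  rw [Set.pair_eq_pair_iff] at hr ht
  rcases hr with ⟨rfl, rfl⟩ | ⟨rfl, rfl⟩ <;> rcases ht with ⟨rfl, rfl⟩ | ⟨rfl, rfl⟩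
  exacts [h, h.swap_right, h.swap_left, h.swap_left.swap_right]

theorem PetersenDotsIso.map {V V' : Type} {X : Type*} {L : SimpleGraph V} {L' : SimpleGraph V'}
    {H : SimpleGraph X} (φ : L ≃g L') {x y r s t u : V} (h : PetersenDotsIso L H x y r s t u) :
    PetersenDotsIso L' H (φ x) (φ y) (φ r) (φ s) (φ t) (φ u) := by
  intro a b c d hg
  obtain ⟨e⟩ := h a b c d hg
  exact ⟨(snarkDotProductIso φ Iso.refl x y r s t u a b c d).symm.trans e⟩

theorem neighborSet_diff_image {V W : Type*} {G : SimpleGraph V} {H : SimpleGraph W} (φ : G ≃g H)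
    {x y r s : V} (h : G.neighborSet x \ {y} = {r, s}) :
    H.neighborSet (φ x) \ {φ y} = {φ r, φ s} := by
  ext w
  obtain ⟨v, rfl⟩ := φ.surjective w
  have := Set.ext_iff.1 h v
  simpa [φ.injective.eq_iff, φ.map_adj_iff] using this

/-! ### Symmetries of the Petersen graph -/

/-- A common neighbour of `v` and `w` in the Petersen graph. -/
def petersenMid (v w : Fin 10) : Fin 10 :=
  ((List.finRange 10).find? fun z => petersen.Adj v z ∧ petersen.Adj w z).getD 0

/-- The map of the Petersen graph that takes the neighbourhood of the edge `12` to that of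
`xy`. -/
def petersenEdgeFrame (x y r s t u : Fin 10) (i : Fin 10) : Fin 10 :=
  [x, y, t, petersenMid r t, r, s, u, petersenMid s t, petersenMid s u,
    petersenMid r u].getD i.val 0

/-- The map of the Petersen graph that takes the edges `12` and `49` to `ab` and `cd`. -/
def petersenPairFrame (a b c d : Fin 10) (i : Fin 10) : Fin 10 :=
  [a, b, petersenMid b c, c, petersenMid a c, petersenMid a d, petersenMid b d,
    petersenMid (petersenMid a d) (petersenMid b c), d,
    petersenMid (petersenMid a c) (petersenMid b d)].getD i.val 0

/-- `f` is an automorphism of the Petersen graph. -/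
def IsPetersenAut (f : Fin 10 → Fin 10) : Prop :=
  (∀ i j, f i = f j → i = j) ∧ ∀ i j, petersen.Adj (f i) (f j) ↔ petersen.Adj i j

instance (f : Fin 10 → Fin 10) : Decidable (IsPetersenAut f) := by
  unfold IsPetersenAut; infer_instance

theorem IsPetersenAut.exists_iso {f : Fin 10 → Fin 10} (hf : IsPetersenAut f) :
    ∃ φ : petersen ≃g petersen, ⇑φ = f :=
  ⟨⟨Equiv.ofBijective f (Finite.injective_iff_bijective.1 fun i j => hf.1 i j), hf.2 _ _⟩, rfl⟩

-- There are `15 · 2 · 2 · 2 = 120` choices of an oriented edge with ordered remaining neighbours,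
-- one for each automorphism of the Petersen graph.
set_option synthInstance.maxSize 1000 in
set_option synthInstance.maxHeartbeats 400000 in
theorem isPetersenAut_edgeFrame : ∀ x y, petersen.Adj x y → ∀ r, petersen.Adj x r ∧ r ≠ y →
    ∀ s, petersen.Adj x s ∧ s ≠ y ∧ r ≠ s → ∀ t, petersen.Adj y t ∧ t ≠ x →
    ∀ u, petersen.Adj y u ∧ u ≠ x ∧ t ≠ u → IsPetersenAut (petersenEdgeFrame x y r s t u) := by
  decide +kernel

/-! ### Certificates given by lists of labels -/

/-- The vertex with label `k`. -/
def vertexOf (n : ℕ) [NeZero n] (k : ℕ) : Fin n := Fin.ofNat n (k - 1)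

theorem vertexOf_succ {n : ℕ} [NeZero n] (i : Fin n) : vertexOf n (i.val + 1) = i := by
  simp [vertexOf]

/-- The partner function given by a list of labels (with an irrelevant first entry). -/
def partnerOf (n : ℕ) [NeZero n] (l : List ℕ) (i : Fin n) : Fin n :=
  vertexOf n (l.getD (i.val + 1) 0)

instance {V : Type*} [DecidableEq V] (G : SimpleGraph V) [DecidableRel G.Adj] (m : V → V) :
    DecidableRel (unmatched G m).Adj := fun v w =>
  inferInstanceAs (Decidable (G.Adj v w ∧ m v ≠ w ∧ m w ≠ v))

/-- The list `l` describes a perfect matching. -/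
def IsMatchingList {n : ℕ} [NeZero n] (G : SimpleGraph (Fin n)) (l : List ℕ) : Prop :=
  ∀ i, G.Adj i (partnerOf n l i) ∧ partnerOf n l (partnerOf n l i) = i

instance {n : ℕ} [NeZero n] (G : SimpleGraph (Fin n)) [DecidableRel G.Adj] (l : List ℕ) :
    Decidable (IsMatchingList G l) := by
  unfold IsMatchingList; infer_instance

/-- The partner list `m` and the list `c` of the vertices of an even cycle certify
`HasEvenDeletion`. -/
def IsDeletionCertificate {n : ℕ} [NeZero n] (G : SimpleGraph (Fin n)) (x : Fin n)
    (m : List ℕ) (c : List (Fin n)) : Prop :=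
  (∀ v, v ≠ x → G.Adj v (partnerOf n m v) ∧
    (partnerOf n m v ≠ x → partnerOf n m (partnerOf n m v) = v)) ∧
  (∀ v, G.Adj v x → partnerOf n m v = x) ∧ 3 ≤ c.length ∧ c.length % 2 = 0 ∧
  (unmatched G (partnerOf n m)).Adj (c.getLastD 0) (c.headD 0) ∧
  c.IsChain (unmatched G (partnerOf n m)).Adj ∧ c.Nodup ∧ x ∉ c

instance {n : ℕ} [NeZero n] (G : SimpleGraph (Fin n)) [DecidableRel G.Adj] (x : Fin n)
    (m : List ℕ) (c : List (Fin n)) : Decidable (IsDeletionCertificate G x m c) := by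
  unfold IsDeletionCertificate; infer_instance

theorem IsDeletionCertificate.hasEvenDeletion {n : ℕ} [NeZero n] {G : SimpleGraph (Fin n)}
    {x : Fin n} {m : List ℕ} {c : List (Fin n)} (h : IsDeletionCertificate G x m c) :
    HasEvenDeletion G x := by
  obtain ⟨h1, h2, h3, h4, h5, h6, h7, h8⟩ := h
  have hne : c ≠ [] := by rintro rfl; simp at h3
  refine ⟨partnerOf n m, c, _, _, fun v hv => (h1 v hv).1, fun v hv => (h1 v hv).2, h2, ?_, ?_,
    h5, h6, h7, h3, Nat.even_iff.2 h4, h8⟩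
  · rw [List.head?_eq_some_head hne, List.headD_eq_head?_getD, List.head?_eq_some_head hne]; rfl
  · rw [List.getLastD_eq_getLast?, List.getLast?_eq_some_getLast hne]; rfl

/-- The partner list `m` and the list `l` of the vertices of an odd cycle certify
`HasOddSwitch`. -/
def IsSwitchCertificate {n : ℕ} [NeZero n] (G : SimpleGraph (Fin n)) (a b c d : Fin n)
    (m : List ℕ) (l : List (Fin n)) : Prop :=
  (¬ G.Adj a c ∧ ¬ G.Adj a d ∧ ¬ G.Adj b c ∧ ¬ G.Adj b d) ∧
  (∀ v, G.Adj v (partnerOf n m v) ∧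
    (v ≠ b → v ≠ d → partnerOf n m (partnerOf n m v) = v)) ∧
  (partnerOf n m b = a ∧ partnerOf n m d = c ∧ partnerOf n m a ≠ b ∧ partnerOf n m c ≠ d) ∧
  l.head? = some a ∧ l.getLast? = some c ∧
  l.IsChain (unmatched G (partnerOf n m)).Adj ∧ l.Nodup ∧ 3 ≤ l.length ∧ l.length % 2 = 1

instance {n : ℕ} [NeZero n] (G : SimpleGraph (Fin n)) [DecidableRel G.Adj] (a b c d : Fin n)
    (m : List ℕ) (l : List (Fin n)) : Decidable (IsSwitchCertificate G a b c d m l) := by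
  unfold IsSwitchCertificate; infer_instance

theorem IsSwitchCertificate.hasOddSwitch {n : ℕ} [NeZero n] {G : SimpleGraph (Fin n)}
    {a b c d : Fin n} {m : List ℕ} {l : List (Fin n)} (h : IsSwitchCertificate G a b c d m l) :
    HasOddSwitch G a b c d := by
  obtain ⟨h1, h2, ⟨h3, h4, h5, h6⟩, h7, h8, h9, h10, h11, h12⟩ := h
  exact ⟨h1, partnerOf n m, l, fun v => (h2 v).1, fun v => (h2 v).2, h3, h4, h5, h6, h7, h8, h9,
    h10, h11, Nat.odd_iff.2 h12⟩

/-- The labelled edges `e` and `f` are the edges `ab` and `cd`. -/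
def SameEdge (e : ℕ × ℕ) (a b : ℕ) : Prop := e.1 = a ∧ e.2 = b ∨ e.1 = b ∧ e.2 = a

instance (e : ℕ × ℕ) (a b : ℕ) : Decidable (SameEdge e a b) := by
  unfold SameEdge; infer_instance

theorem SameEdge.sym2_eq {n : ℕ} [NeZero n] {e : ℕ × ℕ} {a b : ℕ} (h : SameEdge e a b) :
    s(vertexOf n e.1, vertexOf n e.2) = s(vertexOf n a, vertexOf n b) := by
  rcases h with ⟨rfl, rfl⟩ | ⟨rfl, rfl⟩
  · rfl
  · exact Sym2.eq_swap

theorem graphOfEdges_adj {n : ℕ} [NeZero n] {E : List (ℕ × ℕ)} {v w : Fin n}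
    (h : (graphOfEdges n E).Adj v w) : ∃ e ∈ E, s(v, w) = s(vertexOf n e.1, vertexOf n e.2) ∧
      SameEdge e (v.val + 1) (w.val + 1) := by
  rcases h.2 with h | h
  · exact ⟨_, h, by simp only [vertexOf_succ], .inl ⟨rfl, rfl⟩⟩
  · exact ⟨_, h, by simp only [vertexOf_succ]; exact Sym2.eq_swap, .inr ⟨rfl, rfl⟩⟩

/-- Each independent pair of listed edges must lie in a matching of `M` or be one of the switched
pairs of `S`. The condition `hE` says that the first labels of the edges are in range, where
`vertexOf` does not wrap around. -/
theorem noGadgetPair_of_lists {n : ℕ} [NeZero n] {G : SimpleGraph (Fin n)} (E : List (ℕ × ℕ))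
    (hG : G = graphOfEdges n E) (M : List (List ℕ))
    (S : List ((ℕ × ℕ × ℕ × ℕ) × List ℕ × List ℕ))
    (hM : ∀ l ∈ M, IsMatchingList G l)
    (hS : ∀ s ∈ S, IsSwitchCertificate G (vertexOf n s.1.1)
      (vertexOf n s.1.2.1) (vertexOf n s.1.2.2.1) (vertexOf n s.1.2.2.2) s.2.1
      (s.2.2.map (vertexOf n)))
    (hcov : ∀ e ∈ E, ∀ f ∈ E, e.1 ≠ f.1 ∧ e.1 ≠ f.2 ∧ e.2 ≠ f.1 ∧ e.2 ≠ f.2 →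
      (∃ l ∈ M, l.getD e.1 0 = e.2 ∧ l.getD f.1 0 = f.2) ∨
      ∃ s ∈ S, SameEdge e s.1.1 s.1.2.1 ∧ SameEdge f s.1.2.2.1 s.1.2.2.2 ∨
        SameEdge e s.1.2.2.1 s.1.2.2.2 ∧ SameEdge f s.1.1 s.1.2.1)
    (hE : ∀ e ∈ E, (vertexOf n e.1).val + 1 = e.1) : NoGadgetPair G := by
  subst hG
  intro a b c d hab hcd hind
  obtain ⟨e, he, hes, hee⟩ := graphOfEdges_adj hab
  obtain ⟨f, hf, hfs, hff⟩ := graphOfEdges_adj hcd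
  rw [hes, hfs]
  have hne : e.1 ≠ f.1 ∧ e.1 ≠ f.2 ∧ e.2 ≠ f.1 ∧ e.2 ≠ f.2 := by
    simp only [ne_eq, Fin.ext_iff] at hind
    rcases hee with ⟨h1, h2⟩ | ⟨h1, h2⟩ <;> rcases hff with ⟨h3, h4⟩ | ⟨h3, h4⟩ <;> omega
  rcases hcov e he f hf hne with ⟨l, hl, h1, h2⟩ | ⟨s, hs, h⟩
  · refine ⟨_, _, _, _, .inl ⟨rfl, rfl⟩, .inl ⟨partnerOf n l, fun v => (hM l hl v).1,
      fun v => (hM l hl v).2, ?_, ?_⟩⟩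
    · rw [partnerOf, hE e he, h1]
    · rw [partnerOf, hE f hf, h2]
  · refine ⟨_, _, _, _, ?_, .inr (hS s hs).hasOddSwitch⟩
    exact h.imp (fun h => ⟨h.1.sym2_eq, h.2.sym2_eq⟩) fun h => ⟨h.1.sym2_eq, h.2.sym2_eq⟩

/-- The vertices in `D` cannot be ends of a bold-edge, and they meet every edge outside `B`. The
edges in `B` are only candidates; nothing is claimed about their being bold. -/
theorem sameEdge_of_lists {n : ℕ} [NeZero n] {G : SimpleGraph (Fin n)} (E : List (ℕ × ℕ))
    (hG : G = graphOfEdges n E) (B : List (ℕ × ℕ))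
    (D : List (ℕ × List ℕ × List ℕ))
    (hD : ∀ x ∈ D, IsDeletionCertificate G (vertexOf n x.1) x.2.1
      (x.2.2.map (vertexOf n)))
    (hcov : ∀ e ∈ E, (∃ x ∈ D, x.1 = e.1 ∨ x.1 = e.2) ∨ e ∈ B) {x y : Fin n}
    (hxy : G.Adj x y) (hx : ¬ HasEvenDeletion G x)
    (hy : ¬ HasEvenDeletion G y) :
    ∃ e ∈ B, SameEdge e (x.val + 1) (y.val + 1) := by
  subst hG
  obtain ⟨e, he, -, hee⟩ := graphOfEdges_adj hxy
  rcases hcov e he with ⟨z, hz, h⟩ | h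
  · have hdel := (hD z hz).hasEvenDeletion
    have : z.1 = x.val + 1 ∨ z.1 = y.val + 1 := by
      rcases hee with ⟨h1, h2⟩ | ⟨h1, h2⟩ <;> omega
    rcases this with h | h
    · rw [h, vertexOf_succ] at hdel
      exact absurd hdel hx
    · rw [h, vertexOf_succ] at hdel
      exact absurd hdel hy
  · exact ⟨e, h, hee⟩

/-- The map to `Fin k` given by a list of labels. -/
def labelMap {n : ℕ} (k : ℕ) [NeZero k] (l : List ℕ) (v : Fin n) : Fin k :=
  vertexOf k (l.getD v.val 0)

/-- The lists `f` and `g` of labels describe an isomorphism to `H` from a dot product of `L` and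
the Petersen graph. -/
def IsDotCertificate {n k : ℕ} [NeZero k] (L : SimpleGraph (Fin n)) (H : SimpleGraph (Fin k))
    (x y r s t u : Fin n) (a b c d : Fin 10) (f g : List ℕ) : Prop :=
  (∀ v, v ≠ x ∧ v ≠ y → ∀ w, w ≠ x ∧ w ≠ y →
    (labelMap k f v = labelMap k f w → v = w) ∧
    (H.Adj (labelMap k f v) (labelMap k f w) ↔ L.Adj v w)) ∧
  (∀ v w : Fin 10, (labelMap k g v = labelMap k g w → v = w) ∧
    (H.Adj (labelMap k g v) (labelMap k g w) ↔
      petersen.Adj v w ∧ s(v, w) ≠ s(a, b) ∧ s(v, w) ≠ s(c, d))) ∧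
  (∀ v, v ≠ x ∧ v ≠ y → ∀ w : Fin 10, labelMap k f v ≠ labelMap k g w ∧
    (H.Adj (labelMap k f v) (labelMap k g w) ↔
      (v = r ∧ w = a) ∨ (v = s ∧ w = b) ∨ (v = t ∧ w = c) ∨ (v = u ∧ w = d)))

set_option synthInstance.maxSize 1000 in
set_option synthInstance.maxHeartbeats 400000 in
instance {n k : ℕ} [NeZero k] (L : SimpleGraph (Fin n)) [DecidableRel L.Adj]
    (H : SimpleGraph (Fin k)) [DecidableRel H.Adj] (x y r s t u : Fin n) (a b c d : Fin 10)
    (f g : List ℕ) : Decidable (IsDotCertificate L H x y r s t u a b c d f g) := by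
  unfold IsDotCertificate; infer_instance

theorem IsDotCertificate.nonempty_iso {n k : ℕ} [NeZero k] {L : SimpleGraph (Fin n)}
    {H : SimpleGraph (Fin k)} {x y r s t u : Fin n} {a b c d : Fin 10} {f g : List ℕ}
    (h : IsDotCertificate L H x y r s t u a b c d f g) (hxy : x ≠ y) (hk : k = n + 8) :
    Nonempty (snarkDotProduct L x y r s t u petersen a b c d ≃g H) := by
  obtain ⟨h1, h2, h3⟩ := h
  let F : {v : Fin n // v ≠ x ∧ v ≠ y} ⊕ Fin 10 → Fin k :=
    Sum.elim (fun v => labelMap k f v.1) fun w => labelMap k g w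
  have hF : Function.Injective F := by
    rintro (v | v) (w | w) h
    · exact congrArg _ (Subtype.ext ((h1 _ v.2 _ w.2).1 h))
    · exact absurd h (h3 _ v.2 w).1
    · exact absurd h.symm (h3 _ w.2 v).1
    · exact congrArg _ ((h2 v w).1 h)
  -- The dot product has `(n - 2) + 10` vertices, so an injective map to `Fin k` is bijective.
  have hcard : Fintype.card ({v : Fin n // v ≠ x ∧ v ≠ y} ⊕ Fin 10) = Fintype.card (Fin k) := by
    have hset : (Finset.univ.filter fun v : Fin n => v ≠ x ∧ v ≠ y) = {x, y}ᶜ := by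
      ext v; simp
    have h2n : ({x, y} : Finset (Fin n)).card ≤ n := by
      simpa using Finset.card_le_univ ({x, y} : Finset (Fin n))
    rw [Finset.card_pair hxy] at h2n
    rw [Fintype.card_sum, Fintype.card_subtype, hset, Finset.card_compl, Finset.card_pair hxy,
      Fintype.card_fin, Fintype.card_fin, Fintype.card_fin]
    omega
  refine ⟨⟨Equiv.ofBijective F ((Fintype.bijective_iff_injective_and_card F).2 ⟨hF, hcard⟩), ?_⟩⟩
  rintro (v | v) (w | w) <;> rw [snarkDotProduct_adj]
  · exact (h1 _ v.2 _ w.2).2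
  · exact (h3 _ v.2 w).2
  · exact (H.adj_comm _ _).trans (h3 _ w.2 v).2
  · exact (h2 v w).2

/-! ### The concrete graphs -/

/-- Perfect matchings of `petersen`: lists of the partners of the vertices. -/
def petersenMatchings : List (List ℕ) :=
  [[0, 6, 7, 8, 9, 10, 1, 2, 3, 4, 5], [0, 6, 3, 2, 5, 4, 1, 9, 10, 7, 8], [0, 5, 7, 4, 3, 1,
   9, 2, 10, 6, 8], [0, 5, 3, 2, 9, 1, 8, 10, 6, 4, 7], [0, 2, 1, 8, 5, 4, 9, 10, 3, 6, 7], [0,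
   2, 1, 4, 3, 10, 8, 9, 6, 7, 5]]

/-- The edges of `P18`. -/
def P18Edges : List (ℕ × ℕ) :=
  [(1, 2), (1, 4), (1, 9), (2, 3), (2, 6), (3, 8), (3, 11), (4, 5), (4, 8), (5, 6), (5, 15),
   (6, 7), (7, 8), (7, 17), (9, 10), (9, 14), (10, 11), (10, 12), (11, 18), (12, 13), (12, 16),
   (13, 14), (13, 18), (14, 15), (15, 16), (16, 17), (17, 18)]

/-- Perfect matchings of `P18`: lists of the partners of the vertices. -/
def P18Matchings : List (List ℕ) :=
  [[0, 9, 6, 11, 5, 4, 2, 8, 7, 1, 12, 3, 10, 18, 15, 14, 17, 16, 13], [0, 9, 3, 2, 8, 15, 7,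
   6, 4, 1, 11, 10, 16, 14, 13, 5, 12, 18, 17], [0, 4, 6, 8, 1, 15, 2, 17, 3, 10, 9, 18, 16,
   14, 13, 5, 12, 7, 11], [0, 4, 3, 2, 1, 6, 5, 8, 7, 14, 11, 10, 13, 12, 9, 16, 15, 18, 17],
   [0, 2, 1, 11, 8, 6, 5, 17, 4, 14, 12, 3, 10, 18, 9, 16, 15, 7, 13], [0, 2, 1, 8, 5, 4, 7, 6,
   3, 10, 9, 18, 13, 12, 15, 14, 17, 16, 11], [0, 9, 6, 8, 5, 4, 2, 17, 3, 1, 12, 18, 10, 14,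
   13, 16, 15, 7, 11], [0, 9, 3, 2, 8, 6, 5, 17, 4, 1, 11, 10, 16, 18, 15, 14, 12, 7, 13], [0,
   4, 6, 11, 1, 15, 2, 8, 7, 14, 12, 3, 10, 18, 9, 5, 17, 16, 13], [0, 2, 1, 11, 8, 15, 7, 6,
   4, 10, 9, 3, 16, 14, 13, 5, 12, 18, 17], [0, 4, 3, 2, 1, 6, 5, 8, 7, 10, 9, 18, 13, 12, 15,
   14, 17, 16, 11], [0, 2, 1, 8, 5, 4, 7, 6, 3, 14, 11, 10, 13, 12, 9, 16, 15, 18, 17], [0, 9,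
   3, 2, 8, 15, 7, 6, 4, 1, 12, 18, 10, 14, 13, 5, 17, 16, 11], [0, 9, 6, 11, 5, 4, 2, 8, 7, 1,
   12, 3, 10, 14, 13, 16, 15, 18, 17], [0, 9, 6, 8, 5, 4, 2, 17, 3, 1, 11, 10, 16, 18, 15, 14,
   12, 7, 13], [0, 9, 3, 2, 8, 6, 5, 17, 4, 1, 12, 18, 10, 14, 13, 16, 15, 7, 11], [0, 4, 6,
   11, 1, 15, 2, 8, 7, 10, 9, 3, 16, 14, 13, 5, 12, 18, 17], [0, 4, 6, 8, 1, 15, 2, 17, 3, 14,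
   11, 10, 16, 18, 9, 5, 12, 7, 13], [0, 2, 1, 11, 8, 15, 7, 6, 4, 14, 12, 3, 10, 18, 9, 5, 17,
   16, 13], [0, 2, 1, 11, 8, 6, 5, 17, 4, 10, 9, 3, 16, 18, 15, 14, 12, 7, 13]]

/-- 2-factors of vertex-deleted subgraphs of `P18` with an even cycle. -/
def P18Deletions : List (ℕ × List ℕ × List ℕ) :=
  [(1, [0, 1, 1, 8, 1, 6, 5, 17, 3, 1, 12, 18, 10, 14, 13, 16, 15, 7, 11], [10, 11, 3, 2, 6, 7,
   8, 4, 5, 15, 14, 9]), (3, [0, 4, 3, 3, 1, 15, 7, 6, 3, 14, 12, 3, 10, 18, 9, 5, 17, 16, 13],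
   [1, 2, 6, 5, 4, 8, 7, 17, 18, 11, 10, 9]), (5, [0, 2, 1, 11, 5, 5, 5, 8, 7, 14, 12, 3, 10,
   18, 9, 5, 17, 16, 13], [10, 11, 18, 17, 7, 6, 2, 3, 8, 4, 1, 9]), (7, [0, 9, 3, 2, 5, 4, 7,
   7, 7, 1, 12, 18, 10, 14, 13, 16, 15, 7, 11], [1, 2, 6, 5, 15, 14, 9, 10, 11, 3, 8, 4]), (9,
   [0, 9, 6, 11, 8, 15, 2, 17, 4, 9, 9, 3, 16, 18, 9, 5, 12, 7, 13], [1, 2, 3, 8, 7, 6, 5, 4]),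
   (11, [0, 9, 6, 11, 8, 15, 2, 17, 4, 1, 11, 11, 16, 14, 13, 5, 12, 7, 11], [1, 2, 3, 8, 7, 6,
   5, 4]), (12, [0, 4, 6, 8, 1, 15, 2, 17, 3, 14, 12, 18, 12, 12, 9, 5, 12, 7, 11], [1, 2, 3,
   11, 10, 9]), (13, [0, 2, 1, 11, 8, 6, 5, 17, 4, 10, 9, 3, 13, 13, 13, 16, 15, 7, 13], [10,
   11, 18, 17, 16, 12]), (15, [0, 9, 6, 11, 8, 15, 2, 17, 4, 1, 12, 3, 10, 18, 15, 15, 15, 7,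
   13], [1, 2, 3, 8, 7, 6, 5, 4]), (17, [0, 9, 6, 11, 8, 15, 2, 17, 4, 1, 12, 3, 10, 14, 13, 5,
   17, 17, 17], [1, 2, 3, 8, 7, 6, 5, 4])]

/-- 2-factors of switched graphs of `P18` in which the cycle through the new edge is odd. -/
def P18Switches : List ((ℕ × ℕ × ℕ × ℕ) × List ℕ × List ℕ) :=
  [((2, 1, 8, 7), [0, 2, 6, 11, 8, 15, 2, 8, 4, 14, 12, 3, 10, 18, 9, 5, 17, 16, 13], [2, 3,
   8]), ((4, 1, 6, 7), [0, 4, 6, 11, 8, 15, 2, 6, 4, 14, 12, 3, 10, 18, 9, 5, 17, 16, 13], [4,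
   5, 6]), ((9, 1, 12, 13), [0, 9, 3, 2, 8, 15, 7, 6, 4, 14, 11, 10, 16, 12, 9, 5, 12, 18, 17],
   [9, 10, 12]), ((2, 3, 4, 5), [0, 9, 6, 2, 8, 4, 2, 17, 4, 1, 12, 18, 10, 14, 13, 16, 15, 7,
   11], [2, 1, 4]), ((2, 6, 4, 8), [0, 9, 3, 2, 5, 4, 2, 17, 4, 1, 12, 18, 10, 14, 13, 16, 15,
   7, 11], [2, 1, 4]), ((2, 6, 12, 13), [0, 4, 3, 2, 1, 15, 2, 8, 7, 14, 11, 10, 16, 12, 9, 5,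
   12, 18, 17], [2, 1, 9, 10, 12]), ((8, 3, 6, 5), [0, 9, 6, 8, 8, 6, 2, 17, 4, 1, 12, 18, 10,
   14, 13, 16, 15, 7, 11], [8, 7, 6]), ((11, 3, 12, 13), [0, 2, 1, 11, 8, 6, 5, 17, 4, 10, 9,
   18, 16, 12, 15, 14, 12, 7, 11], [11, 10, 12]), ((4, 8, 13, 12), [0, 2, 1, 11, 5, 4, 7, 6, 4,
   10, 9, 3, 13, 18, 15, 14, 17, 16, 13], [4, 1, 9, 14, 13]), ((15, 5, 12, 13), [0, 9, 3, 2, 8,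
   15, 7, 6, 4, 1, 12, 18, 10, 12, 15, 14, 17, 16, 11], [15, 16, 12]), ((17, 7, 12, 13), [0, 2,
   1, 11, 8, 6, 5, 17, 4, 14, 12, 3, 10, 12, 9, 16, 15, 18, 17], [17, 16, 12]), ((9, 10, 15,
   16), [0, 4, 6, 8, 1, 15, 2, 17, 3, 14, 9, 18, 13, 12, 9, 5, 15, 7, 11], [9, 1, 2, 3, 11, 10,
   12, 16, 17, 18, 13, 14, 15]), ((9, 14, 11, 18), [0, 9, 3, 2, 8, 15, 7, 6, 4, 1, 11, 10, 13,
   12, 9, 5, 17, 16, 11], [9, 10, 12, 16, 15, 14, 13, 18, 17, 7, 8, 3, 11]), ((10, 11, 17, 16),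
   [0, 9, 3, 2, 8, 15, 7, 6, 4, 1, 12, 10, 10, 14, 13, 5, 17, 18, 17], [10, 9, 14, 15, 16, 12,
   13, 18, 11, 3, 8, 7, 17]), ((14, 15, 17, 18), [0, 9, 6, 11, 5, 4, 2, 8, 7, 1, 12, 3, 10, 14,
   13, 14, 17, 16, 17], [14, 9, 10, 11, 18, 13, 12, 16, 15, 5, 6, 7, 17])]

/-- The adjacency matrix of `P18`, as a binary number. -/
def P18Bits : ℕ := 9211525605835964385704949737541259879092641989161146936867435246795828785594438423307815864238346

theorem P18_adj_iff (i j : Fin 18) :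
    P18.Adj i j ↔ P18Bits.testBit (18 * i.val + j.val) = true := by
  revert i j
  unfold P18
  decide +kernel

instance : DecidableRel P18.Adj := fun i j => decidable_of_iff _ (P18_adj_iff i j).symm

theorem noGadgetPair_P18 : NoGadgetPair P18 :=
  noGadgetPair_of_lists P18Edges rfl P18Matchings P18Switches (by decide +kernel)
    (by decide +kernel) (by decide +kernel) (by decide +kernel)

/-- The edges of `P26`. -/
def P26Edges : List (ℕ × ℕ) :=
  [(1, 2), (1, 7), (1, 19), (2, 3), (2, 5), (3, 13), (3, 17), (4, 5), (4, 9), (4, 23), (5, 6),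
   (6, 15), (6, 25), (7, 8), (7, 12), (8, 9), (8, 10), (9, 16), (10, 11), (10, 14), (11, 12),
   (11, 16), (12, 13), (13, 14), (14, 15), (15, 16), (17, 18), (17, 22), (18, 19), (18, 20),
   (19, 26), (20, 21), (20, 24), (21, 22), (21, 26), (22, 23), (23, 24), (24, 25), (25, 26)]

/-- Perfect matchings of `P26`: lists of the partners of the vertices. -/
def P26Matchings : List (List ℕ) :=
  [[0, 19, 5, 17, 9, 2, 15, 12, 10, 4, 8, 16, 7, 14, 13, 6, 11, 3, 20, 1, 18, 26, 23, 22, 25,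
   24, 21], [0, 19, 3, 2, 23, 6, 5, 8, 7, 16, 11, 10, 13, 12, 15, 14, 9, 18, 17, 1, 24, 22, 21,
   4, 20, 26, 25], [0, 7, 5, 13, 23, 2, 25, 1, 9, 8, 14, 12, 11, 3, 10, 16, 15, 22, 19, 18, 24,
   26, 17, 4, 20, 6, 21], [0, 2, 1, 13, 5, 4, 15, 8, 7, 16, 14, 12, 11, 3, 10, 6, 9, 18, 17,
   26, 21, 20, 23, 22, 25, 24, 19], [0, 2, 1, 17, 5, 4, 25, 12, 9, 8, 11, 10, 7, 14, 13, 16,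
   15, 3, 20, 26, 18, 22, 21, 24, 23, 6, 19], [0, 7, 3, 2, 9, 6, 5, 1, 10, 4, 8, 16, 13, 12,
   15, 14, 11, 22, 19, 18, 21, 20, 17, 24, 23, 26, 25], [0, 7, 5, 17, 23, 2, 15, 1, 10, 16, 8,
   12, 11, 14, 13, 6, 9, 3, 19, 18, 24, 22, 21, 4, 20, 26, 25], [0, 19, 3, 2, 5, 4, 25, 8, 7,
   16, 11, 10, 13, 12, 15, 14, 9, 22, 20, 1, 18, 26, 17, 24, 23, 6, 21], [0, 7, 3, 2, 9, 6, 5,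
   1, 10, 4, 8, 12, 11, 14, 13, 16, 15, 18, 17, 26, 21, 20, 23, 22, 25, 24, 19], [0, 2, 1, 13,
   5, 4, 15, 12, 9, 8, 14, 16, 7, 3, 10, 6, 11, 22, 19, 18, 21, 20, 17, 24, 23, 26, 25], [0,
   19, 5, 13, 9, 2, 25, 12, 10, 4, 8, 16, 7, 3, 15, 14, 11, 18, 17, 1, 24, 26, 23, 22, 20, 6,
   21], [0, 7, 5, 17, 23, 2, 15, 1, 9, 8, 14, 16, 13, 12, 10, 6, 11, 3, 20, 26, 18, 22, 21, 4,
   25, 24, 19], [0, 19, 3, 2, 23, 6, 5, 12, 9, 8, 11, 10, 7, 14, 13, 16, 15, 22, 20, 1, 18, 26,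
   17, 4, 25, 24, 21], [0, 2, 1, 17, 5, 4, 25, 8, 7, 16, 11, 10, 13, 12, 15, 14, 9, 3, 19, 18,
   24, 26, 23, 22, 20, 6, 21], [0, 19, 5, 13, 9, 2, 25, 8, 7, 4, 14, 12, 11, 3, 10, 16, 15, 22,
   20, 1, 18, 26, 17, 24, 23, 6, 21], [0, 2, 1, 13, 9, 6, 5, 12, 10, 4, 8, 16, 7, 3, 15, 14,
   11, 18, 17, 26, 21, 20, 23, 22, 25, 24, 19], [0, 7, 3, 2, 5, 4, 15, 1, 9, 8, 14, 16, 13, 12,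
   10, 6, 11, 18, 17, 26, 21, 20, 23, 22, 25, 24, 19], [0, 19, 5, 17, 9, 2, 15, 8, 7, 4, 14,
   16, 13, 12, 10, 6, 11, 3, 20, 1, 18, 22, 21, 24, 23, 26, 25], [0, 7, 5, 13, 23, 2, 25, 1,
   10, 16, 8, 12, 11, 3, 15, 14, 9, 18, 17, 26, 24, 22, 21, 4, 20, 6, 19], [0, 2, 1, 17, 23, 6,
   5, 12, 9, 8, 11, 10, 7, 14, 13, 16, 15, 3, 19, 18, 24, 22, 21, 4, 20, 26, 25], [0, 7, 3, 2,
   5, 4, 15, 1, 10, 16, 8, 12, 11, 14, 13, 6, 9, 22, 19, 18, 21, 20, 17, 24, 23, 26, 25], [0,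
   2, 1, 13, 9, 6, 5, 8, 7, 4, 14, 12, 11, 3, 10, 16, 15, 22, 19, 18, 21, 20, 17, 24, 23, 26,
   25]]

/-- 2-factors of vertex-deleted subgraphs of `P26` with an even cycle. -/
def P26Deletions : List (ℕ × List ℕ × List ℕ) :=
  [(1, [0, 1, 1, 17, 5, 4, 15, 1, 10, 16, 8, 12, 11, 14, 13, 6, 9, 3, 20, 1, 18, 26, 23, 22,
   25, 24, 21], [23, 24, 20, 21, 22, 17, 18, 19, 26, 25, 6, 5, 2, 3, 13, 12, 7, 8, 9, 4]), (3,
   [0, 19, 3, 3, 9, 6, 5, 12, 10, 4, 8, 16, 7, 3, 15, 14, 11, 3, 20, 1, 18, 26, 23, 22, 25, 24,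
   21], [4, 5, 2, 1, 7, 8, 9, 16, 15, 6, 25, 26, 19, 18, 17, 22, 21, 20, 24, 23]), (4, [0, 19,
   3, 2, 4, 4, 15, 12, 10, 4, 8, 16, 7, 14, 13, 6, 11, 22, 20, 1, 18, 26, 17, 4, 25, 24, 21],
   [18, 19, 26, 25, 6, 5, 2, 1, 7, 8, 9, 16, 15, 14, 10, 11, 12, 13, 3, 17]), (6, [0, 7, 3, 2,
   23, 6, 6, 1, 10, 16, 8, 12, 11, 14, 13, 6, 9, 22, 19, 18, 24, 26, 17, 4, 20, 6, 21], [4, 5,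
   2, 1, 19, 26, 25, 24, 23, 22, 21, 20, 18, 17, 3, 13, 12, 7, 8, 9]), (8, [0, 19, 3, 2, 23, 6,
   5, 8, 8, 8, 8, 16, 13, 12, 15, 14, 11, 22, 20, 1, 18, 26, 17, 4, 25, 24, 21], [4, 5, 2, 1,
   7, 12, 11, 10, 14, 13, 3, 17, 18, 19, 26, 25, 6, 15, 16, 9]), (11, [0, 19, 5, 17, 9, 2, 15,
   8, 7, 4, 11, 11, 11, 14, 13, 6, 11, 3, 20, 1, 18, 26, 23, 22, 25, 24, 21], [9, 16, 15, 14,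
   10, 8]), (12, [0, 19, 3, 2, 23, 6, 5, 12, 9, 8, 14, 12, 12, 12, 10, 16, 15, 22, 20, 1, 18,
   26, 17, 4, 25, 24, 21], [4, 5, 2, 1, 7, 8, 10, 11, 16, 9]), (14, [0, 2, 1, 17, 5, 4, 25, 12,
   9, 8, 14, 16, 7, 14, 14, 14, 11, 3, 20, 26, 18, 22, 21, 24, 23, 6, 19], [22, 23, 4, 9, 16,
   15, 6, 5, 2, 3, 13, 12, 11, 10, 8, 7, 1, 19, 18, 17]), (16, [0, 19, 3, 2, 23, 6, 5, 8, 7,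
   16, 14, 16, 13, 12, 10, 16, 16, 22, 20, 1, 18, 26, 17, 4, 25, 24, 21], [4, 5, 2, 1, 7, 12,
   11, 10, 8, 9]), (18, [0, 7, 3, 2, 5, 4, 15, 1, 10, 16, 8, 12, 11, 14, 13, 6, 9, 18, 18, 18,
   18, 22, 21, 24, 23, 26, 25], [22, 23, 4, 9, 8, 7, 12, 13, 3, 17]), (20, [0, 7, 5, 13, 23, 2,
   25, 1, 10, 16, 8, 12, 11, 3, 15, 14, 9, 22, 20, 26, 20, 20, 17, 4, 20, 6, 19], [22, 23, 24,
   25, 26, 21]), (22, [0, 2, 1, 13, 9, 6, 5, 12, 10, 4, 8, 16, 7, 3, 15, 14, 11, 22, 20, 26,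
   18, 22, 22, 22, 25, 24, 19], [4, 5, 2, 3, 17, 18, 19, 1, 7, 8, 9, 16, 15, 6, 25, 26, 21, 20,
   24, 23]), (24, [0, 2, 1, 13, 9, 6, 5, 12, 10, 4, 8, 16, 7, 3, 15, 14, 11, 22, 19, 18, 24,
   26, 17, 24, 24, 24, 21], [4, 5, 2, 3, 17, 18, 20, 21, 22, 23]), (26, [0, 7, 3, 2, 5, 4, 15,
   1, 10, 16, 8, 12, 11, 14, 13, 6, 9, 22, 20, 26, 18, 26, 17, 24, 23, 26, 26], [22, 23, 4, 9,
   8, 7, 12, 13, 3, 17, 18, 19, 1, 2, 5, 6, 25, 24, 20, 21])]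

/-- 2-factors of switched graphs of `P26` in which the cycle through the new edge is odd. -/
def P26Switches : List ((ℕ × ℕ × ℕ × ℕ) × List ℕ × List ℕ) :=
  [((7, 1, 10, 11), [0, 7, 5, 13, 23, 2, 25, 12, 9, 8, 14, 10, 7, 3, 10, 16, 15, 22, 19, 18,
   24, 26, 17, 4, 20, 6, 21], [7, 8, 10]), ((19, 1, 20, 21), [0, 19, 5, 13, 9, 2, 25, 12, 10,
   4, 8, 16, 7, 3, 15, 14, 11, 18, 17, 26, 24, 20, 23, 22, 20, 6, 19], [19, 18, 20]), ((2, 5,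
   11, 10), [0, 2, 1, 17, 23, 2, 15, 12, 9, 8, 11, 16, 7, 14, 13, 6, 11, 3, 20, 26, 18, 22, 21,
   4, 25, 24, 19], [2, 3, 13, 12, 11]), ((2, 5, 20, 21), [0, 2, 1, 13, 23, 2, 15, 12, 9, 8, 14,
   16, 7, 3, 10, 6, 11, 22, 19, 18, 24, 20, 17, 4, 20, 26, 25], [2, 3, 17, 18, 20]), ((13, 3,
   10, 11), [0, 7, 5, 13, 23, 2, 25, 1, 10, 16, 8, 10, 13, 12, 15, 14, 9, 22, 19, 18, 24, 26,
   17, 4, 20, 6, 21], [13, 14, 10]), ((17, 3, 20, 21), [0, 7, 5, 17, 23, 2, 15, 1, 10, 16, 8,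
   12, 11, 14, 13, 6, 9, 22, 19, 18, 24, 20, 17, 4, 20, 26, 25], [17, 18, 20]), ((9, 4, 10,
   11), [0, 19, 5, 17, 9, 2, 15, 8, 7, 16, 14, 10, 13, 12, 10, 6, 9, 3, 20, 1, 18, 26, 23, 22,
   25, 24, 21], [9, 8, 10]), ((23, 4, 20, 21), [0, 2, 1, 17, 23, 6, 5, 12, 9, 8, 11, 10, 7, 14,
   13, 16, 15, 3, 20, 26, 18, 20, 23, 22, 25, 24, 19], [23, 24, 20]), ((15, 6, 10, 11), [0, 19,
   5, 17, 9, 2, 15, 12, 10, 4, 8, 10, 7, 14, 13, 16, 15, 3, 20, 1, 18, 26, 23, 22, 25, 24, 21],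
   [15, 14, 10]), ((25, 6, 20, 21), [0, 19, 3, 2, 5, 4, 25, 12, 9, 8, 11, 10, 7, 14, 13, 16,
   15, 22, 20, 1, 18, 20, 17, 24, 23, 26, 25], [25, 24, 20]), ((7, 8, 14, 13), [0, 19, 3, 2,
   23, 6, 5, 12, 7, 16, 11, 10, 7, 14, 15, 14, 9, 22, 20, 1, 18, 26, 17, 4, 25, 24, 21], [7, 1,
   2, 5, 4, 9, 8, 10, 14]), ((12, 7, 16, 9), [0, 2, 1, 17, 5, 4, 25, 12, 10, 16, 8, 16, 13, 12,
   15, 14, 11, 3, 20, 26, 18, 22, 21, 24, 23, 6, 19], [12, 11, 10, 14, 13, 3, 2, 5, 6, 15,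
   16]), ((8, 9, 15, 14), [0, 2, 1, 17, 5, 4, 25, 8, 7, 8, 11, 10, 13, 12, 15, 16, 15, 3, 20,
   26, 18, 22, 21, 24, 23, 6, 19], [8, 10, 14, 13, 3, 2, 5, 6, 15]), ((10, 11, 20, 21), [0, 2,
   1, 17, 5, 4, 15, 8, 7, 16, 14, 10, 13, 12, 10, 6, 9, 3, 20, 26, 18, 20, 23, 22, 25, 24, 19],
   [10, 8, 9, 4, 23, 24, 20]), ((12, 13, 16, 15), [0, 19, 3, 2, 23, 6, 5, 12, 9, 8, 14, 16, 7,
   12, 10, 16, 11, 22, 20, 1, 18, 26, 17, 4, 25, 24, 21], [12, 11, 10, 8, 7, 1, 2, 5, 4, 9,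
   16]), ((18, 17, 24, 23), [0, 7, 3, 2, 5, 4, 15, 1, 10, 16, 8, 12, 11, 14, 13, 6, 9, 18, 20,
   26, 18, 22, 21, 24, 25, 24, 19], [18, 19, 1, 2, 5, 6, 25, 26, 21, 20, 24]), ((17, 22, 26,
   19), [0, 2, 1, 13, 9, 6, 5, 12, 10, 4, 8, 16, 7, 3, 15, 14, 11, 18, 17, 26, 21, 20, 17, 24,
   23, 26, 25], [17, 3, 2, 5, 4, 23, 22, 21, 26]), ((18, 19, 24, 25), [0, 2, 1, 13, 9, 6, 5,
   12, 10, 4, 8, 16, 7, 3, 15, 14, 11, 22, 20, 18, 18, 26, 17, 24, 23, 24, 21], [18, 17, 3, 2,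
   5, 4, 23, 22, 21, 20, 24]), ((22, 23, 25, 26), [0, 7, 3, 2, 5, 4, 15, 1, 10, 16, 8, 12, 11,
   14, 13, 6, 9, 22, 19, 18, 21, 20, 17, 22, 25, 24, 25], [22, 21, 26, 19, 1, 2, 5, 6, 25])]

/-- The adjacency matrix of `P26`, as a binary number. -/
def P26Bits : ℕ := 84505740028803402369060835201763881722913112284689095493182545155812398993042092188482356550927475265513864801477286897153856030077945866254126990005049911569663761058527570700927182979895829289362522178

theorem P26_adj_iff (i j : Fin 26) :
    P26.Adj i j ↔ P26Bits.testBit (26 * i.val + j.val) = true := by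
  revert i j
  unfold P26
  decide +kernel

instance : DecidableRel P26.Adj := fun i j => decidable_of_iff _ (P26_adj_iff i j).symm

theorem noGadgetPair_P26 : NoGadgetPair P26 :=
  noGadgetPair_of_lists P26Edges rfl P26Matchings P26Switches (by decide +kernel)
    (by decide +kernel) (by decide +kernel) (by decide +kernel)

/-- The edges of `P34`. -/
def P34Edges : List (ℕ × ℕ) :=
  [(1, 5), (1, 17), (1, 25), (2, 7), (2, 21), (2, 33), (3, 13), (3, 23), (3, 27), (4, 11), (4,
   15), (4, 31), (5, 6), (5, 10), (6, 7), (6, 8), (7, 14), (8, 9), (8, 12), (9, 10), (9, 14),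
   (10, 11), (11, 12), (12, 13), (13, 14), (15, 16), (15, 20), (16, 17), (16, 18), (17, 24),
   (18, 19), (18, 22), (19, 20), (19, 24), (20, 21), (21, 22), (22, 23), (23, 24), (25, 26),
   (25, 34), (26, 27), (26, 28), (27, 30), (28, 29), (28, 32), (29, 30), (29, 34), (30, 31),
   (31, 32), (32, 33), (33, 34)]

/-- Perfect matchings of `P34`: lists of the partners of the vertices. -/
def P34Matchings : List (List ℕ) :=
  [[0, 25, 7, 13, 31, 10, 8, 2, 6, 14, 5, 12, 11, 3, 9, 20, 17, 16, 19, 18, 15, 22, 21, 24, 23,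
   1, 28, 30, 26, 34, 27, 4, 33, 32, 29], [0, 17, 33, 27, 15, 6, 5, 14, 9, 8, 11, 10, 13, 12,
   7, 4, 18, 1, 16, 24, 21, 20, 23, 22, 19, 34, 28, 3, 26, 30, 29, 32, 31, 2, 25], [0, 5, 21,
   23, 11, 1, 7, 6, 12, 10, 9, 4, 8, 14, 13, 16, 15, 24, 22, 20, 19, 2, 18, 3, 17, 34, 27, 26,
   29, 28, 31, 30, 33, 32, 25], [0, 5, 7, 27, 31, 1, 8, 2, 6, 10, 9, 12, 11, 14, 13, 16, 15,
   24, 19, 18, 21, 20, 23, 22, 17, 26, 25, 3, 32, 30, 29, 4, 28, 34, 33], [0, 17, 21, 13, 11,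
   10, 7, 6, 12, 14, 5, 4, 8, 3, 9, 20, 18, 1, 16, 24, 15, 2, 23, 22, 19, 26, 25, 30, 29, 28,
   27, 32, 31, 34, 33], [0, 25, 33, 23, 15, 6, 5, 14, 9, 8, 11, 10, 13, 12, 7, 4, 18, 24, 16,
   20, 19, 22, 21, 3, 17, 1, 27, 26, 32, 34, 31, 30, 28, 2, 29], [0, 25, 21, 27, 15, 10, 7, 6,
   9, 8, 5, 12, 11, 14, 13, 4, 17, 16, 22, 20, 19, 2, 18, 24, 23, 1, 28, 3, 26, 30, 29, 32, 31,
   34, 33], [0, 5, 7, 23, 15, 1, 8, 2, 6, 14, 11, 10, 13, 12, 9, 4, 17, 16, 22, 24, 21, 20, 18,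
   3, 19, 34, 27, 26, 29, 28, 31, 30, 33, 32, 25], [0, 25, 33, 13, 11, 6, 5, 14, 12, 10, 9, 4,
   8, 3, 7, 20, 17, 16, 19, 18, 15, 22, 21, 24, 23, 1, 27, 26, 32, 34, 31, 30, 28, 2, 29], [0,
   17, 33, 23, 31, 10, 7, 6, 9, 8, 5, 12, 11, 14, 13, 16, 15, 1, 22, 24, 21, 20, 18, 3, 19, 26,
   25, 30, 32, 34, 27, 4, 28, 2, 29], [0, 17, 7, 13, 15, 6, 5, 2, 12, 14, 11, 10, 8, 3, 9, 4,
   18, 1, 16, 20, 19, 22, 21, 24, 23, 26, 25, 30, 29, 28, 27, 32, 31, 34, 33], [0, 5, 33, 27,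
   11, 1, 8, 14, 6, 10, 9, 4, 13, 12, 7, 20, 17, 16, 19, 18, 15, 22, 21, 24, 23, 34, 28, 3, 26,
   30, 29, 32, 31, 2, 25], [0, 25, 21, 23, 31, 6, 5, 14, 9, 8, 11, 10, 13, 12, 7, 16, 15, 24,
   22, 20, 19, 2, 18, 3, 17, 1, 28, 30, 26, 34, 27, 4, 33, 32, 29], [0, 5, 33, 13, 31, 1, 7, 6,
   12, 14, 11, 10, 8, 3, 9, 16, 15, 24, 19, 18, 21, 20, 23, 22, 17, 34, 27, 26, 32, 30, 29, 4,
   28, 2, 25], [0, 5, 21, 13, 15, 1, 8, 14, 6, 10, 9, 12, 11, 3, 7, 4, 18, 24, 16, 20, 19, 2,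
   23, 22, 17, 34, 27, 26, 29, 28, 31, 30, 33, 32, 25], [0, 25, 7, 27, 11, 10, 8, 2, 6, 14, 5,
   4, 13, 12, 9, 16, 15, 24, 19, 18, 21, 20, 23, 22, 17, 1, 28, 3, 26, 34, 31, 30, 33, 32, 29],
   [0, 17, 33, 23, 31, 10, 7, 6, 9, 8, 5, 12, 11, 14, 13, 20, 18, 1, 16, 24, 15, 22, 21, 3, 19,
   34, 27, 26, 32, 30, 29, 4, 28, 2, 25], [0, 5, 21, 23, 11, 1, 8, 14, 6, 10, 9, 4, 13, 12, 7,
   20, 17, 16, 22, 24, 15, 2, 18, 3, 19, 26, 25, 30, 29, 28, 27, 32, 31, 34, 33], [0, 25, 7,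
   27, 11, 6, 5, 2, 12, 10, 9, 4, 8, 14, 13, 16, 15, 24, 19, 18, 21, 20, 23, 22, 17, 1, 28, 3,
   26, 30, 29, 32, 31, 34, 33], [0, 17, 21, 13, 11, 6, 5, 14, 12, 10, 9, 4, 8, 3, 7, 16, 15, 1,
   22, 20, 19, 2, 18, 24, 23, 34, 27, 26, 29, 28, 31, 30, 33, 32, 25], [0, 25, 21, 23, 31, 6,
   5, 14, 9, 8, 11, 10, 13, 12, 7, 20, 17, 16, 22, 24, 15, 2, 18, 3, 19, 1, 27, 26, 32, 30, 29,
   4, 28, 34, 33], [0, 5, 33, 27, 11, 1, 8, 14, 6, 10, 9, 4, 13, 12, 7, 20, 17, 16, 19, 18, 15,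
   22, 21, 24, 23, 26, 25, 3, 32, 34, 31, 30, 28, 2, 29], [0, 25, 33, 13, 11, 10, 7, 6, 12, 14,
   5, 4, 8, 3, 9, 20, 17, 16, 19, 18, 15, 22, 21, 24, 23, 1, 28, 30, 26, 34, 27, 32, 31, 2,
   29], [0, 17, 7, 13, 15, 10, 8, 2, 6, 14, 5, 12, 11, 3, 9, 4, 18, 1, 16, 24, 21, 20, 23, 22,
   19, 34, 27, 26, 29, 28, 31, 30, 33, 32, 25], [0, 17, 21, 27, 31, 10, 7, 6, 9, 8, 5, 12, 11,
   14, 13, 20, 18, 1, 16, 24, 15, 2, 23, 22, 19, 34, 28, 3, 26, 30, 29, 4, 33, 32, 25]]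

/-- 2-factors of vertex-deleted subgraphs of `P34` with an even cycle. -/
def P34Deletions : List (ℕ × List ℕ × List ℕ) :=
  [(5, [0, 5, 21, 23, 11, 5, 5, 14, 9, 8, 5, 4, 13, 12, 7, 20, 17, 16, 22, 24, 15, 2, 18, 3,
   19, 34, 27, 26, 29, 28, 31, 30, 33, 32, 25], [13, 14, 9, 10, 11, 12, 8, 6, 7, 2, 33, 34, 29,
   30, 27, 3]), (7, [0, 17, 7, 13, 15, 10, 7, 7, 9, 8, 5, 12, 11, 3, 7, 4, 18, 1, 16, 24, 21,
   20, 23, 22, 19, 34, 27, 26, 29, 28, 31, 30, 33, 32, 25], [13, 14, 9, 10, 11, 4, 31, 32, 28,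
   26, 25, 1, 5, 6, 8, 12]), (8, [0, 25, 33, 13, 11, 10, 8, 14, 8, 8, 5, 4, 8, 3, 7, 20, 17,
   16, 19, 18, 15, 22, 21, 24, 23, 1, 28, 30, 26, 34, 27, 32, 31, 2, 29], [13, 14, 9, 10, 11,
   12]), (9, [0, 25, 7, 13, 31, 6, 5, 2, 9, 9, 9, 12, 11, 3, 9, 20, 17, 16, 19, 18, 15, 22, 21,
   24, 23, 1, 28, 30, 26, 34, 27, 4, 33, 32, 29], [13, 14, 7, 6, 8, 12]), (11, [0, 25, 33, 13,
   11, 6, 5, 14, 9, 8, 11, 11, 11, 3, 7, 20, 17, 16, 19, 18, 15, 22, 21, 24, 23, 1, 28, 30, 26,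
   34, 27, 32, 31, 2, 29], [19, 24, 17, 1, 5, 10, 9, 14, 13, 12, 8, 6, 7, 2, 21, 20]), (13, [0,
   25, 33, 13, 11, 10, 7, 6, 9, 8, 5, 4, 13, 13, 13, 20, 17, 16, 19, 18, 15, 22, 21, 24, 23, 1,
   28, 30, 26, 34, 27, 32, 31, 2, 29], [19, 24, 17, 1, 5, 6, 8, 12, 11, 10, 9, 14, 7, 2, 21,
   20]), (15, [0, 25, 21, 27, 15, 10, 7, 6, 9, 8, 5, 12, 11, 14, 13, 15, 15, 24, 19, 18, 15, 2,
   23, 22, 17, 1, 28, 3, 26, 34, 31, 30, 33, 32, 29], [19, 24, 23, 3, 13, 12, 8, 6, 5, 1, 17,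
   16, 18, 22, 21, 20]), (17, [0, 17, 7, 13, 15, 10, 8, 2, 6, 14, 5, 12, 11, 3, 9, 4, 17, 17,
   19, 18, 21, 20, 23, 22, 17, 34, 27, 26, 29, 28, 31, 30, 33, 32, 25], [19, 24, 23, 3, 27, 30,
   29, 34, 33, 2, 21, 22, 18, 16, 15, 20]), (18, [0, 25, 21, 23, 31, 6, 5, 14, 9, 8, 11, 10,
   13, 12, 7, 20, 18, 24, 18, 18, 15, 2, 18, 3, 17, 1, 28, 30, 26, 34, 27, 4, 33, 32, 29], [19,
   24, 23, 22, 21, 20]), (19, [0, 17, 33, 23, 31, 10, 7, 6, 9, 8, 5, 12, 11, 14, 13, 16, 15, 1,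
   19, 19, 19, 22, 21, 3, 19, 34, 27, 26, 32, 30, 29, 4, 28, 2, 25], [22, 23, 24, 17, 16, 18]),
   (21, [0, 5, 21, 23, 11, 1, 8, 14, 6, 10, 9, 4, 13, 12, 7, 16, 15, 24, 19, 18, 21, 21, 21, 3,
   17, 34, 27, 26, 29, 28, 31, 30, 33, 32, 25], [19, 24, 23, 22, 18, 16, 17, 1, 25, 26, 28, 32,
   31, 4, 15, 20]), (23, [0, 17, 33, 23, 31, 10, 7, 6, 9, 8, 5, 12, 11, 14, 13, 16, 15, 1, 19,
   18, 21, 20, 23, 23, 23, 34, 27, 26, 32, 30, 29, 4, 28, 2, 25], [19, 24, 17, 16, 18, 22, 21,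
   2, 7, 14, 9, 10, 11, 4, 15, 20]), (25, [0, 25, 33, 13, 11, 10, 7, 6, 12, 14, 5, 4, 8, 3, 9,
   20, 17, 16, 19, 18, 15, 22, 21, 24, 23, 25, 25, 30, 29, 28, 27, 32, 31, 2, 25], [22, 23, 3,
   27, 26, 28, 32, 33, 34, 29, 30, 31, 4, 15, 16, 18]), (27, [0, 25, 21, 27, 15, 10, 7, 6, 9,
   8, 5, 12, 11, 14, 13, 4, 18, 24, 16, 20, 19, 2, 23, 22, 17, 1, 27, 27, 29, 28, 27, 32, 31,
   34, 33], [25, 34, 29, 30, 31, 4, 11, 10, 9, 14, 7, 2, 33, 32, 28, 26]), (28, [0, 17, 33, 23,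
   31, 10, 7, 6, 9, 8, 5, 12, 11, 14, 13, 20, 18, 1, 16, 24, 15, 22, 21, 3, 19, 34, 28, 30, 28,
   28, 27, 4, 28, 2, 25], [32, 33, 34, 29, 30, 31]), (29, [0, 17, 21, 27, 31, 10, 7, 6, 9, 8,
   5, 12, 11, 14, 13, 20, 18, 1, 16, 24, 15, 2, 23, 22, 19, 26, 25, 3, 29, 29, 29, 4, 33, 32,
   29], [28, 32, 31, 30, 27, 26]), (31, [0, 17, 33, 23, 31, 10, 7, 6, 9, 8, 5, 12, 11, 14, 13,
   20, 18, 1, 16, 24, 15, 22, 21, 3, 19, 34, 27, 26, 29, 28, 31, 31, 31, 2, 25], [6, 8, 12, 13,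
   3, 27, 30, 29, 34, 33, 32, 28, 26, 25, 1, 5]), (33, [0, 25, 33, 13, 11, 6, 5, 14, 12, 10, 9,
   4, 8, 3, 7, 20, 17, 16, 19, 18, 15, 22, 21, 24, 23, 1, 27, 26, 29, 28, 31, 30, 33, 33, 33],
   [25, 34, 29, 30, 27, 3, 23, 22, 18, 16, 15, 4, 31, 32, 28, 26])]

/-- 2-factors of switched graphs of `P34` in which the cycle through the new edge is odd. -/
def P34Switches : List ((ℕ × ℕ × ℕ × ℕ) × List ℕ × List ℕ) :=
  [((5, 1, 8, 9), [0, 5, 33, 27, 11, 10, 7, 6, 12, 8, 5, 4, 8, 14, 13, 20, 17, 16, 19, 18, 15,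
   22, 21, 24, 23, 34, 28, 3, 26, 30, 29, 32, 31, 2, 25], [5, 6, 8]), ((17, 1, 18, 19), [0, 17,
   7, 23, 11, 10, 8, 2, 6, 14, 5, 4, 13, 12, 9, 16, 15, 24, 22, 18, 21, 20, 18, 3, 17, 34, 27,
   26, 29, 28, 31, 30, 33, 32, 25], [17, 16, 18]), ((25, 1, 28, 29), [0, 25, 33, 13, 11, 10, 7,
   6, 12, 14, 5, 4, 8, 3, 9, 20, 17, 16, 19, 18, 15, 22, 21, 24, 23, 34, 27, 26, 32, 28, 31,
   30, 28, 2, 25], [25, 26, 28]), ((7, 2, 8, 9), [0, 25, 7, 13, 31, 6, 5, 14, 12, 8, 11, 10, 8,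
   3, 7, 20, 17, 16, 19, 18, 15, 22, 21, 24, 23, 1, 28, 30, 26, 34, 27, 4, 33, 32, 29], [7, 6,
   8]), ((21, 2, 18, 19), [0, 5, 21, 13, 15, 1, 8, 14, 6, 10, 9, 12, 11, 3, 7, 4, 18, 24, 16,
   18, 21, 20, 23, 22, 17, 34, 27, 26, 29, 28, 31, 30, 33, 32, 25], [21, 22, 18]), ((33, 2, 28,
   29), [0, 25, 33, 13, 11, 6, 5, 14, 12, 10, 9, 4, 8, 3, 7, 20, 17, 16, 19, 18, 15, 22, 21,
   24, 23, 1, 28, 30, 26, 28, 27, 32, 31, 34, 33], [33, 32, 28]), ((13, 3, 8, 9), [0, 25, 7,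
   13, 31, 10, 8, 2, 6, 8, 5, 12, 11, 14, 13, 20, 17, 16, 19, 18, 15, 22, 21, 24, 23, 1, 28,
   30, 26, 34, 27, 4, 33, 32, 29], [13, 12, 8]), ((23, 3, 18, 19), [0, 17, 33, 23, 31, 10, 7,
   6, 9, 8, 5, 12, 11, 14, 13, 20, 18, 1, 16, 18, 15, 22, 21, 24, 23, 34, 27, 26, 32, 30, 29,
   4, 28, 2, 25], [23, 22, 18]), ((27, 3, 28, 29), [0, 17, 21, 27, 31, 10, 7, 6, 9, 8, 5, 12,
   11, 14, 13, 20, 18, 1, 16, 24, 15, 2, 23, 22, 19, 26, 25, 30, 32, 28, 27, 4, 28, 34, 33],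
   [27, 26, 28]), ((11, 4, 8, 9), [0, 5, 33, 27, 11, 1, 8, 14, 6, 8, 11, 10, 13, 12, 7, 20, 17,
   16, 19, 18, 15, 22, 21, 24, 23, 34, 28, 3, 26, 30, 29, 32, 31, 2, 25], [11, 12, 8]), ((15,
   4, 18, 19), [0, 25, 21, 27, 15, 10, 7, 6, 9, 8, 5, 12, 11, 14, 13, 20, 17, 16, 22, 18, 15,
   2, 18, 24, 23, 1, 28, 3, 26, 34, 31, 30, 33, 32, 29], [15, 16, 18]), ((31, 4, 28, 29), [0,
   17, 21, 27, 31, 10, 7, 6, 9, 8, 5, 12, 11, 14, 13, 20, 18, 1, 16, 24, 15, 2, 23, 22, 19, 34,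
   28, 3, 26, 28, 31, 30, 33, 32, 25], [31, 32, 28]), ((5, 6, 11, 12), [0, 25, 33, 13, 11, 10,
   5, 14, 9, 8, 5, 4, 11, 3, 7, 20, 17, 16, 19, 18, 15, 22, 21, 24, 23, 1, 28, 30, 26, 34, 27,
   32, 31, 2, 29], [5, 1, 17, 24, 19, 20, 21, 2, 7, 6, 8, 12, 13, 14, 9, 10, 11]), ((5, 10, 7,
   14), [0, 5, 21, 23, 11, 1, 7, 6, 9, 8, 5, 4, 13, 12, 7, 20, 17, 16, 22, 24, 15, 2, 18, 3,
   19, 34, 27, 26, 29, 28, 31, 30, 33, 32, 25], [5, 6, 8, 12, 11, 10, 9, 14, 13, 3, 27, 30, 29,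
   34, 33, 2, 7]), ((6, 7, 13, 12), [0, 25, 33, 23, 15, 6, 5, 6, 9, 8, 11, 10, 13, 14, 13, 4,
   18, 24, 16, 20, 19, 22, 21, 3, 17, 1, 28, 30, 26, 34, 27, 32, 31, 2, 29], [6, 8, 12, 11, 4,
   31, 30, 29, 28, 32, 33, 34, 25, 26, 27, 3, 13]), ((8, 9, 18, 19), [0, 5, 21, 27, 31, 1, 8,
   14, 6, 8, 11, 10, 13, 12, 7, 20, 17, 16, 22, 18, 15, 2, 18, 24, 23, 34, 28, 3, 26, 30, 29,
   4, 33, 32, 25], [8, 12, 11, 4, 15, 16, 18]), ((8, 9, 28, 29), [0, 25, 21, 13, 15, 6, 5, 14,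
   12, 8, 11, 10, 8, 3, 7, 4, 18, 24, 16, 20, 19, 2, 23, 22, 17, 1, 28, 30, 26, 28, 27, 32, 31,
   34, 33], [8, 6, 7, 2, 33, 32, 28]), ((10, 11, 13, 14), [0, 5, 7, 27, 31, 1, 8, 2, 6, 10, 9,
   10, 13, 12, 13, 20, 17, 16, 19, 18, 15, 22, 21, 24, 23, 34, 28, 3, 26, 30, 29, 4, 33, 32,
   25], [10, 5, 6, 7, 14, 9, 8, 12, 11, 4, 15, 16, 18, 22, 23, 3, 13]), ((15, 16, 21, 22), [0,
   5, 21, 23, 11, 1, 8, 14, 6, 10, 9, 4, 13, 12, 7, 20, 15, 24, 19, 18, 15, 2, 21, 3, 17, 34,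
   27, 26, 29, 28, 31, 30, 33, 32, 25], [15, 4, 31, 32, 28, 26, 25, 1, 17, 16, 18, 22, 23, 24,
   19, 20, 21]), ((15, 20, 17, 24), [0, 25, 21, 27, 15, 10, 7, 6, 9, 8, 5, 12, 11, 14, 13, 4,
   17, 16, 19, 18, 15, 2, 23, 22, 17, 1, 28, 3, 26, 34, 31, 30, 33, 32, 29], [15, 16, 18, 22,
   21, 20, 19, 24, 23, 3, 13, 12, 8, 6, 5, 1, 17]), ((16, 17, 23, 22), [0, 25, 21, 27, 15, 10,
   7, 6, 9, 8, 5, 12, 11, 14, 13, 4, 18, 16, 16, 20, 19, 2, 23, 24, 23, 1, 28, 3, 26, 34, 31,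
   30, 33, 32, 29], [16, 15, 20, 21, 22, 18, 19, 24, 17, 1, 5, 6, 8, 12, 13, 3, 23]), ((18, 19,
   28, 29), [0, 5, 33, 23, 11, 1, 8, 14, 6, 10, 9, 4, 13, 12, 7, 16, 15, 24, 22, 18, 21, 20,
   18, 3, 17, 34, 27, 26, 32, 28, 31, 30, 28, 2, 25], [18, 16, 17, 1, 25, 26, 28]), ((20, 21,
   23, 24), [0, 5, 33, 13, 31, 1, 8, 14, 6, 10, 9, 12, 11, 3, 7, 20, 17, 16, 19, 18, 15, 20,
   23, 22, 23, 34, 27, 26, 32, 30, 29, 4, 28, 2, 25], [20, 19, 24, 17, 1, 25, 26, 28, 29, 34,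
   33, 32, 31, 30, 27, 3, 23]), ((25, 26, 32, 33), [0, 5, 21, 13, 15, 1, 8, 14, 6, 10, 9, 12,
   11, 3, 7, 4, 18, 24, 16, 20, 19, 2, 23, 22, 17, 34, 25, 30, 29, 28, 27, 32, 31, 32, 25],
   [25, 1, 17, 16, 15, 20, 21, 22, 18, 19, 24, 23, 3, 27, 26, 28, 32]), ((25, 34, 27, 30), [0,
   25, 33, 13, 11, 10, 7, 6, 12, 14, 5, 4, 8, 3, 9, 20, 17, 16, 19, 18, 15, 22, 21, 24, 23, 1,
   27, 26, 29, 28, 27, 32, 31, 2, 25], [25, 26, 28, 32, 33, 34, 29, 30, 31, 4, 15, 16, 18, 22,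
   23, 3, 27]), ((26, 27, 31, 32), [0, 17, 7, 23, 11, 6, 5, 2, 12, 10, 9, 4, 8, 14, 13, 20, 18,
   1, 16, 24, 15, 22, 21, 3, 19, 26, 25, 26, 29, 28, 31, 30, 31, 34, 33], [26, 28, 32, 33, 2,
   21, 20, 19, 18, 22, 23, 24, 17, 16, 15, 4, 31]), ((30, 31, 33, 34), [0, 25, 21, 27, 15, 10,
   7, 6, 9, 8, 5, 12, 11, 14, 13, 4, 18, 24, 16, 20, 19, 2, 23, 22, 17, 1, 28, 3, 26, 30, 29,
   30, 33, 32, 33], [30, 27, 26, 25, 34, 29, 28, 32, 31, 4, 11, 10, 9, 14, 7, 2, 33])]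

/-- The adjacency matrix of `P34`, as a binary number. -/
def P34Bits : ℕ := 260938209497282761684244923927544010457205690171085684197326535261549705661277139299378375174738853013272424926345765475167342129858694712556139531696619801546237391379409813393490444322729964983815713926438448439998916915566708682478018636010424820757303052538205484685040415622244804103344145292858161438339994877510872473896445792644635283226640

theorem P34_adj_iff (i j : Fin 34) :
    P34.Adj i j ↔ P34Bits.testBit (34 * i.val + j.val) = true := by
  revert i j
  unfold P34
  decide +kernel

instance : DecidableRel P34.Adj := fun i j => decidable_of_iff _ (P34_adj_iff i j).symm

theorem noGadgetPair_P34 : NoGadgetPair P34 :=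
  noGadgetPair_of_lists P34Edges rfl P34Matchings P34Switches (by decide +kernel)
    (by decide +kernel) (by decide +kernel) (by decide +kernel)

/-! ### Candidates for bold-edges, and pairs of edges of the Petersen graph -/

theorem sameEdge_of_bold_P18 {x y : Fin 18} (hxy : P18.Adj x y) (hx : ¬ HasEvenDeletion P18 x)
    (hy : ¬ HasEvenDeletion P18 y) :
    ∃ e ∈ ([(2, 6), (4, 8)] : List (ℕ × ℕ)), SameEdge e (x.val + 1) (y.val + 1) :=
  sameEdge_of_lists P18Edges rfl _ P18Deletions (by decide +kernel) (by decide +kernel) hxy hx hy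

theorem sameEdge_of_bold_P26 {x y : Fin 26} (hxy : P26.Adj x y) (hx : ¬ HasEvenDeletion P26 x)
    (hy : ¬ HasEvenDeletion P26 y) :
    ∃ e ∈ ([(2, 5)] : List (ℕ × ℕ)), SameEdge e (x.val + 1) (y.val + 1) :=
  sameEdge_of_lists P26Edges rfl _ P26Deletions (by decide +kernel) (by decide +kernel) hxy hx hy

theorem sameEdge_of_bold_P34 {x y : Fin 34} (hxy : P34.Adj x y) (hx : ¬ HasEvenDeletion P34 x)
    (hy : ¬ HasEvenDeletion P34 y) :
    ∃ e ∈ ([] : List (ℕ × ℕ)), SameEdge e (x.val + 1) (y.val + 1) :=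
  sameEdge_of_lists P34Edges rfl _ P34Deletions (by decide +kernel) (by decide +kernel) hxy hx hy


/-- The unmatchable pairs are the pairs of edges with no edge between them. Each end of one edge
then has a common neighbour with each end of the other, and these midpoints determine the
automorphism. -/
theorem isPetersenAut_pairFrame : ∀ a b, petersen.Adj a b → ∀ c, c ≠ a ∧ c ≠ b →
    ∀ d, petersen.Adj c d ∧ d ≠ a ∧ d ≠ b →
    (∃ l ∈ petersenMatchings, l.getD (a.val + 1) 0 = b.val + 1 ∧
      l.getD (c.val + 1) 0 = d.val + 1) ∨ IsPetersenAut (petersenPairFrame a b c d) := by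
  decide +kernel

theorem isMatchingList_petersen : ∀ l ∈ petersenMatchings, IsMatchingList petersen l := by
  decide +kernel

/-! ### Dot products with the Petersen graph -/

/-- One dot product decides for all: by the pair frames every unmatchable pair, with any naming of
its ends, is the image of the pair `0 1`, `3 8`, which are the edges with labels `12` and `49`. -/
theorem petersenDotsIso_of_iso {V : Type} {X : Type*} {L : SimpleGraph V} {H : SimpleGraph X}
    {x y r s t u : V} (h : Nonempty (snarkDotProduct L x y r s t u petersen 0 1 3 8 ≃g H)) :
    PetersenDotsIso L H x y r s t u := by
  intro a b c d ⟨hab, hcd, ⟨hac, had, hbc, hbd⟩, hm⟩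
  rcases isPetersenAut_pairFrame a b hab c ⟨hac.symm, hbc.symm⟩ d ⟨hcd, had.symm, hbd.symm⟩ with
    ⟨l, hl, h1, h2⟩ | hf
  · refine absurd ⟨partnerOf 10 l, fun v => (isMatchingList_petersen l hl v).1,
      fun v => (isMatchingList_petersen l hl v).2, ?_, ?_⟩ hm
    · rw [partnerOf, h1, vertexOf_succ]
    · rw [partnerOf, h2, vertexOf_succ]
  · obtain ⟨ψ, hψ⟩ := hf.exists_iso
    obtain ⟨e⟩ := h
    have key := snarkDotProductIso (Iso.refl (G := L)) ψ x y r s t u 0 1 3 8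
    rw [hψ] at key
    exact ⟨key.symm.trans e⟩

theorem petersenDotsIso_of_certificate {n k : ℕ} [NeZero k] {L : SimpleGraph (Fin n)}
    {H : SimpleGraph (Fin k)} {x y r s t u : Fin n} (f g : List ℕ)
    (h : IsDotCertificate L H x y r s t u 0 1 3 8 f g) (hxy : x ≠ y) (hk : k = n + 8) :
    PetersenDotsIso L H x y r s t u :=
  petersenDotsIso_of_iso (h.nonempty_iso hxy hk)

/-- By the edge frames every choice of `x y r s t u` is the image of `0 1 4 5 2 6`, so a single
isomorphism to `P18` has to be exhibited. -/
theorem petersenDotsIso_petersen {x y r s t u : Fin 10} (hxy : petersen.Adj x y) (hrs : r ≠ s)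
    (htu : t ≠ u) (hx : petersen.neighborSet x \ {y} = {r, s})
    (hy : petersen.neighborSet y \ {x} = {t, u}) :
    PetersenDotsIso petersen P18 x y r s t u := by
  have hr := hx.ge (Set.mem_insert r {s})
  have hs := hx.ge (Set.mem_insert_of_mem r rfl)
  have ht := hy.ge (Set.mem_insert t {u})
  have hu := hy.ge (Set.mem_insert_of_mem t rfl)
  have h0 : PetersenDotsIso petersen P18 0 1 4 5 2 6 :=
    petersenDotsIso_of_certificate [0, 0, 1, 2, 3, 5, 7, 4, 6, 8]
      [11, 15, 14, 9, 10, 18, 16, 13, 17, 12] (by decide +kernel) (by decide) rfl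
  obtain ⟨φ, hφ⟩ := (isPetersenAut_edgeFrame x y hxy r hr s ⟨hs.1, hs.2, hrs⟩ t ht u
    ⟨hu.1, hu.2, htu⟩).exists_iso
  have := h0.map φ
  rw [hφ] at this
  exact this

/-- The two candidate edges have labels `26` and `48`, one above the indices. The zeros in the first
lists are fillers at the deleted vertices. -/
theorem petersenDotsIso_P18 : PetersenDotsIso P18 P26 1 5 0 2 4 6 ∧
    PetersenDotsIso P18 P26 3 7 0 4 2 6 :=
  ⟨petersenDotsIso_of_certificate
    [1, 0, 4, 2, 3, 0, 6, 5, 7, 8, 9, 10, 11, 12, 13, 14, 15, 16]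
    [19, 23, 22, 17, 18, 26, 24, 21, 25, 20] (by decide +kernel) (by decide) rfl,
   petersenDotsIso_of_certificate
    [1, 2, 3, 0, 4, 5, 6, 0, 7, 12, 13, 11, 10, 8, 9, 16, 15, 14]
    [19, 23, 22, 17, 18, 26, 24, 21, 25, 20] (by decide +kernel) (by decide) rfl⟩

theorem petersenDotsIso_P26 : PetersenDotsIso P26 P34 1 4 0 2 3 5 :=
  petersenDotsIso_of_certificate
    [1, 0, 4, 2, 0, 3, 5, 6, 7, 8, 9, 10, 11, 12, 13, 14, 15, 16, 17, 18, 19, 20, 21, 22, 23, 24]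
    [25, 31, 32, 33, 34, 26, 30, 28, 27, 29] (by decide +kernel) (by decide) rfl

theorem PetersenDotsIso.of_sameEdge {n : ℕ} {X : Type*} {L : SimpleGraph (Fin n)}
    {H : SimpleGraph X} {x y r s t u x₀ y₀ r₀ s₀ t₀ u₀ : Fin n}
    (h : PetersenDotsIso L H x₀ y₀ r₀ s₀ t₀ u₀) (hx₀ : L.neighborSet x₀ \ {y₀} = {r₀, s₀})
    (hy₀ : L.neighborSet y₀ \ {x₀} = {t₀, u₀}) (hx : L.neighborSet x \ {y} = {r, s})
    (hy : L.neighborSet y \ {x} = {t, u}) (he : x = x₀ ∧ y = y₀ ∨ x = y₀ ∧ y = x₀) :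
    PetersenDotsIso L H x y r s t u := by
  rcases he with ⟨rfl, rfl⟩ | ⟨rfl, rfl⟩
  · exact h.of_pair_eq (hx.symm.trans hx₀) (hy.symm.trans hy₀)
  · exact h.swap.of_pair_eq (hx.symm.trans hy₀) (hy.symm.trans hx₀)

theorem neighborSet_diff_eq {n : ℕ} {L : SimpleGraph (Fin n)} {x y r s : Fin n}
    (h : ∀ v, L.Adj x v ∧ v ≠ y ↔ v = r ∨ v = s) : L.neighborSet x \ {y} = {r, s} :=
  Set.ext h

/-! ### The classification of the constructible graphs -/

/-- One step of the chain from the Petersen graph to `P34`. The last conjunct ends it: no edge of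
`P34` passes the test for bold-edges. -/
theorem exists_iso_of_dot {V W : Type u} {L : SimpleGraph V} {R : SimpleGraph W}
    {x y r s t u : V} {a b c d : W} (hL : IsCubic L) (hR : IsCubic R) (hbold : IsBoldEdge L x y)
    (hgadget : IsGadgetPair R a b c d) (ψ : R ≃g petersen)
    (hx : L.neighborSet x \ {y} = {r, s}) (hy : L.neighborSet y \ {x} = {t, u}) :
    let G := snarkDotProduct L x y r s t u R a b c d
    (Nonempty (L ≃g petersen) → Nonempty (G ≃g P18)) ∧
      (Nonempty (L ≃g P18) → Nonempty (G ≃g P26)) ∧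
      (Nonempty (L ≃g P26) → Nonempty (G ≃g P34)) ∧ ¬ Nonempty (L ≃g P34) := by
  have hpair := hgadget.isUnmatchablePair ψ hR
  -- The notation `{r, s}` allows `r = s`; cubicity excludes this.
  have hne : ∀ {x y r s : V}, L.Adj x y → L.neighborSet x \ {y} = {r, s} → r ≠ s := by
    rintro x y r _ hadj h rfl
    have := hL.ncard_diff hadj
    rw [h] at this
    simp at this
  have key : ∀ {k : ℕ} {X : Type} {L' : SimpleGraph (Fin k)} {H : SimpleGraph X} (φ : L ≃g L'),
      PetersenDotsIso L' H (φ x) (φ y) (φ r) (φ s) (φ t) (φ u) →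
      Nonempty (snarkDotProduct L x y r s t u R a b c d ≃g H) := by
    intro k X L' H φ h
    obtain ⟨e⟩ := h _ _ _ _ hpair
    exact ⟨(snarkDotProductIso φ ψ x y r s t u a b c d).trans e⟩
  refine ⟨?_, ?_, ?_, ?_⟩
  · rintro ⟨φ⟩
    exact key φ (petersenDotsIso_petersen (φ.map_adj_iff.2 hbold.adj)
      (φ.injective.ne (hne hbold.adj hx)) (φ.injective.ne (hne hbold.adj.symm hy))
      (neighborSet_diff_image φ hx) (neighborSet_diff_image φ hy))
  · rintro ⟨φ⟩
    obtain ⟨h1, h2⟩ := hbold.not_hasEvenDeletion φ hL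
    obtain ⟨e, he, hs⟩ := sameEdge_of_bold_P18 (φ.map_adj_iff.2 hbold.adj) h1 h2
    have hx' := neighborSet_diff_image φ hx
    have hy' := neighborSet_diff_image φ hy
    simp only [List.mem_cons, List.not_mem_nil, or_false] at he
    rcases he with rfl | rfl
    · refine key φ (petersenDotsIso_P18.1.of_sameEdge (neighborSet_diff_eq (by decide +kernel))
        (neighborSet_diff_eq (by decide +kernel)) hx' hy' ?_)
      simp only [SameEdge] at hs
      simp only [Fin.ext_iff]
      omega
    · refine key φ (petersenDotsIso_P18.2.of_sameEdge (neighborSet_diff_eq (by decide +kernel))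
        (neighborSet_diff_eq (by decide +kernel)) hx' hy' ?_)
      simp only [SameEdge] at hs
      simp only [Fin.ext_iff]
      omega
  · rintro ⟨φ⟩
    obtain ⟨h1, h2⟩ := hbold.not_hasEvenDeletion φ hL
    obtain ⟨e, he, hs⟩ := sameEdge_of_bold_P26 (φ.map_adj_iff.2 hbold.adj) h1 h2
    simp only [List.mem_cons, List.not_mem_nil, or_false] at he
    subst he
    refine key φ (petersenDotsIso_P26.of_sameEdge (neighborSet_diff_eq (by decide +kernel))
      (neighborSet_diff_eq (by decide +kernel)) (neighborSet_diff_image φ hx)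
      (neighborSet_diff_image φ hy) ?_)
    simp only [SameEdge] at hs
    simp only [Fin.ext_iff]
    omega
  · rintro ⟨φ⟩
    obtain ⟨h1, h2⟩ := hbold.not_hasEvenDeletion φ hL
    obtain ⟨e, he, -⟩ := sameEdge_of_bold_P34 (φ.map_adj_iff.2 hbold.adj) h1 h2
    simp at he

/-- Neither end of a bold-edge can be a leaf, and two hubs are never adjacent. -/
theorem IsBoldEdge.not_iso_ring {V : Type*} {L : SimpleGraph V} {x y : V} (hL : IsCubic L)
    (h : IsBoldEdge L x y) {t : ℕ} (ht : 5 ≤ t) (hodd : Odd t) : ¬ Nonempty (L ≃g ring t) := by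
  rintro ⟨φ⟩
  obtain ⟨h1, h2⟩ := h.not_hasEvenDeletion φ hL
  have hx : (φ x).2 = 3 := by_contra fun h => h1 (hasEvenDeletion_ring ht hodd h)
  have hy : (φ y).2 = 3 := by_contra fun h => h2 (hasEvenDeletion_ring ht hodd h)
  rcases (ring_adj (by omega)).1 (φ.map_adj_iff.2 h.adj) with h | h
  · exact (ringRel_iff.1 h).elim (fun h => h.2.2 hy) fun h => h.1 hx
  · exact (ringRel_iff.1 h).elim (fun h => h.2.2 hx) fun h => h.1 hy

/-- The five alternatives are closed under the construction: the right factor must be the Petersen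
graph, the left one the Petersen graph, `P18` or `P26`. -/
theorem BoldGadgetConstructible.classification {V : Type u} {G : SimpleGraph V}
    (h : BoldGadgetConstructible G) :
    Nonempty (G ≃g BoldGadget.petersen) ∨ (∃ t, 5 ≤ t ∧ Odd t ∧ Nonempty (G ≃g ring t)) ∨
      Nonempty (G ≃g P18) ∨ Nonempty (G ≃g P26) ∨ Nonempty (G ≃g P34) := by
  induction h with
  | petersen G e => exact .inl ⟨e⟩
  | flower G t ht hodd e => exact .inr (.inl ⟨t, ht, hodd, ⟨e.trans (flowerIso t)⟩⟩)
  | dot L R G x y r s t u a b c d _ _ snarkL snarkR bold gadget hx hy e ihL ihR =>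
    have hL := snarkL.cubic
    have hR := snarkR.cubic
    obtain ⟨ψ⟩ : Nonempty (R ≃g BoldGadget.petersen) := by
      rcases ihR with h | ⟨t, ht, hodd, ⟨φ⟩⟩ | ⟨⟨φ⟩⟩ | ⟨⟨φ⟩⟩ | ⟨⟨φ⟩⟩
      · exact h
      · exact absurd gadget ((noGadgetPair_ring ht hodd).not_isGadgetPair φ hR)
      · exact absurd gadget (noGadgetPair_P18.not_isGadgetPair φ hR)
      · exact absurd gadget (noGadgetPair_P26.not_isGadgetPair φ hR)
      · exact absurd gadget (noGadgetPair_P34.not_isGadgetPair φ hR)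
    obtain ⟨h1, h2, h3, h4⟩ := exists_iso_of_dot hL hR bold gadget ψ hx hy
    rcases ihL with h | ⟨t, ht, hodd, h⟩ | h | h | h
    · exact .inr (.inr (.inl ((h1 h).map e.trans)))
    · exact absurd h (bold.not_iso_ring hL ht hodd)
    · exact .inr (.inr (.inr (.inl ((h2 h).map e.trans))))
    · exact .inr (.inr (.inr (.inr ((h3 h).map e.trans))))
    · exact absurd h h4

end BoldGadget

theorem theorem5p3 {V : Type*} [Finite V] (G : SimpleGraph V)
    (hsnark : BoldGadget.IsSnark G)
    (hodd : BoldGadget.IsOddTwoFactored G)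
    (hcyc : BoldGadget.cyclicEdgeConnectivity G = 4)
    (hconstr : BoldGadget.BoldGadgetConstructible G) :
    Nonempty (G ≃g BoldGadget.P18) ∨ Nonempty (G ≃g BoldGadget.P26) ∨
      Nonempty (G ≃g BoldGadget.P34) := by
  -- Connectivity exactly four separates the dot products from the starting graphs.
  have hcut : ¬ BoldGadget.FiveLeCuts G := fun h => by
    have := h.five_le_cyclicEdgeConnectivity
    rw [hcyc] at this
    exact absurd this (by decide)
  rcases hconstr.classification with ⟨⟨φ⟩⟩ | ⟨t, ht, -, ⟨φ⟩⟩ | h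
  · exact absurd (BoldGadget.fiveLeCuts_petersen.of_iso φ) hcut
  · exact absurd ((BoldGadget.fiveLeCuts_ring ht).of_iso φ) hcut
  · exact h
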